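/- Work in the category $Top$ of $k$-spaces (compactly generated spaces), with its products; "weak equivalence" means weak homotopy equivalence. For $k\ge 0$ let $\Psi_k$ be the category whose objects are (isomorphism classes of) non-planar rooted trees with one distinguished vertex, the pearl, and with $k$ leaves labelled bijectively by $\{1,\dots,k\}$, such that the pearl has any arity $\ge 0$ and all other vertices have arity $\ge 2$; the morphisms are contractions of inner edges (an edge contraction at the pearl yields the pearl). Thus $\Psi_k$ is a finite poset. Its terminal object is the pearled corolla $c_k$. For $k\ge 2$: - $c'_k$ is the tree with two vertices, a pearled root of arity one whose only input edge is attached to the other vertex, of arity $k$; - $\Psi'_k$ is the subcategory of $\Psi_k$ with all objects and with all morphisms except $c'_k\to c_k$; - $\Psi_k^U$ is the full subcategory of $\Psi_k$ of the objects that have no morphism to $c'_k$. For a category $C$, $\partial C$ is its full subcategory of non-terminal objects. For a diagram $F\colon C\to Top$ put $\operatorname{hocolim}_C F=|(-\downarrow C)|\otimes_C F(-)$. A diagram $\rho\colon\Psi_k\to Top$, $k\ge 2$, is *coherent* if the natural map $$\operatorname{hocolim}_{\partial\Psi_k}\rho\longrightarrow\operatorname{hocolim}_{\Psi'_k}\rho$$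 is a weak equivalence, and *strongly coherent* if the natural map $$\operatorname{hocolim}_{\partial\Psi_k^U}\rho\longrightarrow\rho(c_k)$$ is a weak equivalence. For a topological (symmetric) operad $O$ and $k\ge 0$ let $\rho_k^O\colon\Psi_k\to Top$ be the diagram $$T\longmapsto O(|p|)\times\prod_{v\ne p}O(|v|),$$ where $p$ is the pearl of $T$, $v$ runs over the other vertices, and $|\cdot|$ denotes arity; on morphisms it is given by operadic composition along the contracted edges, after choosing planar representatives of the trees. The operad $O$ is *coherent* (respectively *$k$-coherent*) if $\rho_i^O$ is coherent for all $i\ge 2$ (respectively for all $2\le i\le k$), and it is *strongly coherent* (respectively *strongly $k$-coherent*) if $\rho_i^O$ is strongly coherent for all $i\ge 2$ (respectively for all $2\le i\le k$). **Theorem.** (i) If a diagram $\rho\colon\Psi_k\to Top$, $k\ge 2$, is strongly coherent, then it is coherent. (ii) If an operad is strongly coherent (respectively strongly $k$-coherent), then it is coherent (respectively $k$-coherent). -/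

import Mathlib

open CategoryTheory Topology

universe u

noncomputable section

/-! ### Weak homotopy equivalences -/

/-- The map induced by a continuous map on the sets of path components. -/
def zerothHomotopyMap {X Y : Type*} [TopologicalSpace X] [TopologicalSpace Y] (f : C(X, Y)) :
    ZerothHomotopy X → ZerothHomotopy Y :=
  Quotient.map f fun _ _ h => Nonempty.map (fun p => p.map f.continuous) h

/-- The map induced by a continuous map on the `n`-th homotopy groups. -/
def homotopyGroupMap (n : ℕ) {X Y : Type*} [TopologicalSpace X] [TopologicalSpace Y]
    (f : C(X, Y)) (x : X) : HomotopyGroup.Pi n X x → HomotopyGroup.Pi n Y (f x) :=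
  Quotient.map
    (fun γ : GenLoop (Fin n) X x =>
      (⟨f.comp γ.1, fun y hy => congrArg f (γ.2 y hy)⟩ : GenLoop (Fin n) Y (f x)))
    fun _ _ h => h.comp_continuousMap f

/-- A continuous map is a weak homotopy equivalence if it induces a bijection on path components
and, for every base point, bijections (hence isomorphisms) on all higher homotopy groups. -/
structure IsWeakHomotopyEquiv {X Y : Type*} [TopologicalSpace X] [TopologicalSpace Y]
    (f : C(X, Y)) : Prop where
  bijective_zeroth : Function.Bijective (zerothHomotopyMap f)
  bijective_pi : ∀ n : ℕ, 1 ≤ n → ∀ x : X, Function.Bijective (homotopyGroupMap n f x)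

/-! ### Homotopy colimits over finite posets -/

/-- The geometric realization `|p ↓ P|` of the nerve of the category of objects under `p`. For a
finite poset `P` this category is the sub-poset `{q | p ≤ q}`, and the points of the realization
of its nerve are the probability weights on `P` supported on a chain contained in it. -/
def UnderComplex {P : Type} [PartialOrder P] [Fintype P] (p : P) : Type :=
  {w : stdSimplex ℝ P // IsChain (· ≤ ·) {q | w q ≠ 0} ∧ ∀ q, w q ≠ 0 → p ≤ q}

instance {P : Type} [PartialOrder P] [Fintype P] (p : P) : TopologicalSpace (UnderComplex p) :=
  instTopologicalSpaceSubtype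

/-- The inclusion `|p' ↓ P| → |p ↓ P|` induced by a morphism `p ≤ p'`. -/
def UnderComplex.incl {P : Type} [PartialOrder P] [Fintype P] {p p' : P} (h : p ≤ p')
    (x : UnderComplex p') : UnderComplex p :=
  ⟨x.1, x.2.1, fun q hq => h.trans (x.2.2 q hq)⟩

/-- The relation generating the coend `|(- ↓ P)| ⊗_P F`. -/
inductive HocolimRel {P : Type} [PartialOrder P] [Fintype P] (F : P ⥤ TopCat.{u}) :
    (Σ p : P, UnderComplex p × F.obj p) → (Σ p : P, UnderComplex p × F.obj p) → Prop
  | glue {p p' : P} (h : p ≤ p') (x : UnderComplex p') (a : F.obj p) :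
      HocolimRel F ⟨p, x.incl h, a⟩ ⟨p', x, F.map (homOfLE h) a⟩

/-- The homotopy colimit `hocolim_P F = |(- ↓ P)| ⊗_P F(-)`, i.e. the quotient space of
`∐_p |p ↓ P| × F(p)` by the relations `(α^* x, a) ∼ (x, α_* a)`. -/
def Hocolim {P : Type} [PartialOrder P] [Fintype P] (F : P ⥤ TopCat.{u}) : Type u :=
  Quot (HocolimRel F)

instance {P : Type} [PartialOrder P] [Fintype P] (F : P ⥤ TopCat.{u}) :
    TopologicalSpace (Hocolim F) :=
  inferInstanceAs (TopologicalSpace (Quot (HocolimRel F)))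

/-- The map `|p ↓ P| → |f p ↓ Q|` induced by a monotone map `f : P → Q`; it pushes weights
forward, so it is linear on simplices and is `f` on vertices. -/
def UnderComplex.map {P Q : Type} [PartialOrder P] [Fintype P] [PartialOrder Q] [Fintype Q]
    (f : P →o Q) {p : P} (x : UnderComplex p) : UnderComplex (f p) :=
  have key : ∀ q, stdSimplex.map f x.1 q ≠ 0 → ∃ p', x.1 p' ≠ 0 ∧ f p' = q := by
    intro q hq
    by_contra! hcon
    apply hq
    classical
    rw [stdSimplex.map_coe, FunOnFinite.linearMap_apply_apply]
    refine Finset.sum_eq_zero fun p' hp' => ?_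
    by_contra hne
    exact hcon p' hne (by simpa using hp')
  ⟨stdSimplex.map f x.1, by
    intro a ha b hb _
    obtain ⟨a', ha', rfl⟩ := key a ha
    obtain ⟨b', hb', rfl⟩ := key b hb
    exact (x.2.1.total ha' hb').imp (fun h => f.monotone h) (fun h => f.monotone h), by
    intro q hq
    obtain ⟨p', hp', rfl⟩ := key q hq
    exact f.monotone (x.2.2 p' hp')⟩

theorem UnderComplex.continuous_map {P Q : Type} [PartialOrder P] [Fintype P] [PartialOrder Q]
    [Fintype Q] (f : P →o Q) (p : P) :
    Continuous (UnderComplex.map f : UnderComplex p → UnderComplex (f p)) :=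
  Continuous.subtype_mk ((stdSimplex.continuous_map f).comp continuous_subtype_val) _

/-- The natural map `hocolim_P (f^* F) → hocolim_Q F` induced by a functor `f : P → Q`. -/
def hocolimMap {P Q : Type} [PartialOrder P] [Fintype P] [PartialOrder Q] [Fintype Q]
    (f : P →o Q) (F : Q ⥤ TopCat.{u}) : C(Hocolim (f.monotone.functor ⋙ F), Hocolim F) where
  toFun := Quot.lift (fun z => Quot.mk _ ⟨f z.1, z.2.1.map f, z.2.2⟩) (by
    rintro _ _ ⟨h, x, a⟩
    exact Quot.sound (HocolimRel.glue (F := F) (f.monotone h) (x.map f) a))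
  continuous_toFun := by
    refine continuous_quot_lift _ (continuous_sigma fun p => ?_)
    have h : Continuous fun z : UnderComplex p × F.obj (f p) => (z.1.map f, z.2) :=
      ((UnderComplex.continuous_map f p).comp continuous_fst).prodMk continuous_snd
    exact continuous_quot_mk.comp
      ((continuous_sigmaMk (σ := fun q => UnderComplex q × F.obj q) (i := f p)).comp h)

/-- The natural map `hocolim_P F → Z` induced by a cocone `F ⇒ Z`; it factors through
`colim_P F`. -/
def hocolimDesc {P : Type} [PartialOrder P] [Fintype P] (F : P ⥤ TopCat.{u})
    (s : Limits.Cocone F) : C(Hocolim F, s.pt) where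
  toFun := Quot.lift (fun z => s.ι.app z.1 z.2.2) (by
    rintro _ _ ⟨h, x, a⟩
    exact (ConcreteCategory.congr_hom (s.w (homOfLE h)) a).symm)
  continuous_toFun := by
    refine continuous_quot_lift _ (continuous_sigma fun p => ?_)
    exact (s.ι.app p).hom.continuous.comp continuous_snd

/-! ### The categories of pearled trees -/

/-- An object of `Ψ_k`: an (isomorphism class of a) non-planar rooted tree with a pearl, with `k`
leaves labelled bijectively by `{1, …, k}`, whose pearl has any arity `≥ 0` and whose other
vertices have arity `≥ 2`.

Such a tree is recorded by its vertices, a vertex `v` being encoded by the set of all leaves that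
lie above `v`, together with the additional symbol `none` when the pearl is `v` itself or lies
above `v`. This identifies these trees with the families of sets below: the root is the full
set, two vertices are either comparable (nested sets) or in different branches (disjoint sets), the
trunk consists of the sets containing `none`, the pearl is the smallest of them, and the arity
condition says that a vertex outside the trunk has at least two leaves above it. -/
@[ext]
structure PearledTree (k : ℕ) where
  /-- The vertices. -/
  vertices : Finset (Finset (Option (Fin k)))
  root_mem : Finset.univ ∈ vertices
  laminar : ∀ v ∈ vertices, ∀ w ∈ vertices, v ⊆ w ∨ w ⊆ v ∨ Disjoint v w
  arity : ∀ v ∈ vertices, none ∈ v ∨ 2 ≤ v.card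

namespace PearledTree

variable {k : ℕ}

/-- Contracting the inner edge between a vertex `v` and the vertex below it deletes the set encoding
`v` and keeps the others. Hence there is a (unique) morphism `T → T'` of `Ψ_k` if and only if the
vertices of `T'` are among those of `T`, and `Ψ_k` is a poset. -/
instance : PartialOrder (PearledTree k) where
  le T T' := T'.vertices ⊆ T.vertices
  le_refl T := Finset.Subset.refl _
  le_trans T T' T'' h h' := h'.trans h
  le_antisymm T T' h h' := PearledTree.ext (Finset.Subset.antisymm h' h)

instance : Fintype (PearledTree k) :=
  Fintype.ofInjective PearledTree.vertices fun _ _ h => PearledTree.ext h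

/-- The pearled `k`-corolla `c_k`, whose only vertex is the pearl. -/
def corolla (k : ℕ) : PearledTree k where
  vertices := {Finset.univ}
  root_mem := by simp
  laminar := by simp
  arity := by simp

/-- The pearled corolla is the terminal object of `Ψ_k`. -/
instance : OrderTop (PearledTree k) where
  top := corolla k
  le_top T := Finset.singleton_subset_iff.2 T.root_mem

/-- The tree `c'_k`, `k ≥ 2`, with two vertices: a pearled root of arity one, whose only incoming
edge is attached to the other vertex, of arity `k`. -/
def corollaPrime (hk : 2 ≤ k) : PearledTree k where
  vertices := {Finset.univ, Finset.univ.erase none}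
  root_mem := by simp
  laminar := by
    intro v hv w hw
    simp only [Finset.mem_insert, Finset.mem_singleton] at hv hw
    rcases hv with rfl | rfl <;> rcases hw with rfl | rfl <;> simp
  arity := by
    intro v hv
    simp only [Finset.mem_insert, Finset.mem_singleton] at hv
    rcases hv with rfl | rfl
    · simp
    · right
      simp [Finset.card_erase_of_mem, hk]

theorem eq_of_corollaPrime_le (hk : 2 ≤ k) {T : PearledTree k} (h : corollaPrime hk ≤ T) :
    T = corollaPrime hk ∨ T = corolla k := by
  have h' : T.vertices ⊆ {Finset.univ, Finset.univ.erase none} := h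
  by_cases hm : Finset.univ.erase none ∈ T.vertices
  · refine Or.inl (PearledTree.ext (Finset.Subset.antisymm h' ?_))
    intro v hv
    rcases Finset.mem_insert.1 hv with rfl | hv
    · exact T.root_mem
    · exact Finset.mem_singleton.1 hv ▸ hm
  · refine Or.inr (PearledTree.ext (Finset.Subset.antisymm (fun v hv => ?_)
      (Finset.singleton_subset_iff.2 T.root_mem)))
    rcases Finset.mem_insert.1 (h' hv) with rfl | hv'
    · exact Finset.mem_singleton_self _
    · exact absurd (Finset.mem_singleton.1 hv' ▸ hv) hm

theorem corollaPrime_ne_corolla (hk : 2 ≤ k) : corollaPrime hk ≠ corolla k := by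
  intro h
  have h1 : Finset.univ.erase none ∈ (corolla k).vertices := h ▸ by simp [corollaPrime]
  exact Finset.notMem_erase none Finset.univ
    ((Finset.mem_singleton.1 h1).symm.subset (Finset.mem_univ none))

end PearledTree

open PearledTree

/-- The category `∂C` of non-terminal objects of a category `C`, for a poset `C`. -/
abbrev Boundary (C : Type) [PartialOrder C] : Type := {c : C // ¬ IsTop c}

instance (C : Type) [PartialOrder C] [Fintype C] : Fintype (Boundary C) :=
  Fintype.ofFinite _

/-- The inclusion functor `∂C → C`. -/
def Boundary.incl (C : Type) [PartialOrder C] : Boundary C →o C :=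
  ⟨Subtype.val, fun _ _ h => h⟩

/-- The category `Ψ'_k`, `k ≥ 2`: it has all objects of `Ψ_k`, and all its morphisms except
`c'_k → c_k`. -/
@[ext]
structure PsiPrime {k : ℕ} (hk : 2 ≤ k) where
  /-- The underlying object of `Ψ_k`. -/
  tree : PearledTree k

namespace PsiPrime

variable {k : ℕ} (hk : 2 ≤ k)

instance : PartialOrder (PsiPrime hk) where
  le T T' := T.tree ≤ T'.tree ∧ ¬ (T.tree = corollaPrime hk ∧ T'.tree = corolla k)
  le_refl T := ⟨le_rfl, fun h => corollaPrime_ne_corolla hk (h.1.symm.trans h.2)⟩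
  le_trans T T' T'' h h' := ⟨h.1.trans h'.1, by
    rintro ⟨h0, h2⟩
    rcases eq_of_corollaPrime_le hk (h0 ▸ h.1) with h1 | h1
    · exact h'.2 ⟨h1, h2⟩
    · exact h.2 ⟨h0, h1⟩⟩
  le_antisymm T T' h h' := PsiPrime.ext (le_antisymm h.1 h'.1)

instance : Fintype (PsiPrime hk) :=
  Fintype.ofInjective PsiPrime.tree fun _ _ h => PsiPrime.ext h

/-- The inclusion functor `Ψ'_k → Ψ_k`. -/
def incl : PsiPrime hk →o PearledTree k := ⟨PsiPrime.tree, fun _ _ h => h.1⟩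

/-- The inclusion functor `∂Ψ_k → Ψ'_k`. -/
def ofBoundary : Boundary (PearledTree k) →o PsiPrime hk :=
  ⟨fun T => ⟨T.1⟩, fun _ T' h => ⟨h, fun e => T'.2 (by
    have h' : T'.1 = ⊤ := e.2
    exact h' ▸ isTop_top)⟩⟩

end PsiPrime

/-- The category `Ψ_k^U`, `k ≥ 2`: the full subcategory of `Ψ_k` of objects that have no morphism
to `c'_k`. -/
abbrev PsiU {k : ℕ} (hk : 2 ≤ k) : Type := {T : PearledTree k // ¬ T ≤ corollaPrime hk}

instance {k : ℕ} (hk : 2 ≤ k) : Fintype (PsiU hk) := Fintype.ofFinite _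

/-- The inclusion functor `Ψ_k^U → Ψ_k`. -/
def PsiU.incl {k : ℕ} (hk : 2 ≤ k) : PsiU hk →o PearledTree k := ⟨Subtype.val, fun _ _ h => h⟩

/-! ### Coherence and strong coherence of diagrams -/

/-- The natural map `hocolim_{∂Ψ_k} ρ → hocolim_{Ψ'_k} ρ`. -/
def coherenceMap {k : ℕ} (hk : 2 ≤ k) (ρ : PearledTree k ⥤ TopCat.{u}) :
    C(Hocolim ((Boundary.incl (PearledTree k)).monotone.functor ⋙ ρ),
      Hocolim ((PsiPrime.incl hk).monotone.functor ⋙ ρ)) :=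
  hocolimMap (PsiPrime.ofBoundary hk) ((PsiPrime.incl hk).monotone.functor ⋙ ρ)

/-- A diagram `ρ : Ψ_k → Top`, `k ≥ 2`, is coherent if the natural map
`hocolim_{∂Ψ_k} ρ → hocolim_{Ψ'_k} ρ` is a weak equivalence. -/
def IsCoherent {k : ℕ} (hk : 2 ≤ k) (ρ : PearledTree k ⥤ TopCat.{u}) : Prop :=
  IsWeakHomotopyEquiv (coherenceMap hk ρ)

/-- The cocone over a diagram restricted along `f : P → Q` whose point is the value of the diagram
at the terminal object. -/
def topCocone {P Q : Type} [PartialOrder P] [PartialOrder Q] [OrderTop Q] (f : P →o Q)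
    (F : Q ⥤ TopCat.{u}) : Limits.Cocone (f.monotone.functor ⋙ F) where
  pt := F.obj ⊤
  ι :=
    { app := fun _ => F.map (homOfLE le_top)
      naturality := fun p p' h => by
        refine Eq.trans ?_ (Category.comp_id _).symm
        exact (F.map_comp _ _).symm }

/-- The inclusion functor `∂Ψ_k^U → Ψ_k`. -/
def boundaryPsiUIncl {k : ℕ} (hk : 2 ≤ k) : Boundary (PsiU hk) →o PearledTree k :=
  (PsiU.incl hk).comp (Boundary.incl (PsiU hk))

/-- The natural map `hocolim_{∂Ψ_k^U} ρ → ρ(c_k)`. -/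
def strongCoherenceMap {k : ℕ} (hk : 2 ≤ k) (ρ : PearledTree k ⥤ TopCat.{u}) :
    C(Hocolim ((boundaryPsiUIncl hk).monotone.functor ⋙ ρ), ρ.obj (corolla k)) :=
  hocolimDesc _ (topCocone (boundaryPsiUIncl hk) ρ)

/-- A diagram `ρ : Ψ_k → Top`, `k ≥ 2`, is strongly coherent if the natural map
`hocolim_{∂Ψ_k^U} ρ → ρ(c_k)` is a weak equivalence. -/
def IsStronglyCoherent {k : ℕ} (hk : 2 ≤ k) (ρ : PearledTree k ⥤ TopCat.{u}) : Prop :=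
  IsWeakHomotopyEquiv (strongCoherenceMap hk ρ)

/-! ### Topological operads -/

/-- A `Σ`-sequence in the category `Top` of `k`-spaces: spaces `M(n)`, `n ≥ 0`, with a right action
of the symmetric group `Σ_n` on `M(n)`. -/
structure SigmaSeq where
  /-- The spaces `M(n)`. -/
  obj : ℕ → Type u
  [topology : ∀ n, TopologicalSpace (obj n)]
  [kspace : ∀ n, CompactlyGeneratedSpace (obj n)]
  /-- The right action `x · σ`. -/
  act : ∀ {n : ℕ}, obj n → Equiv.Perm (Fin n) → obj n
  act_one : ∀ {n : ℕ} (x : obj n), act x 1 = x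
  act_mul : ∀ {n : ℕ} (x : obj n) (σ τ : Equiv.Perm (Fin n)), act x (σ * τ) = act (act x σ) τ
  continuous_act : ∀ {n : ℕ} (σ : Equiv.Perm (Fin n)), Continuous fun x : obj n => act x σ

attribute [instance] SigmaSeq.topology SigmaSeq.kspace

/-- The right action of bijections `e : {1, …, a} → {1, …, b}` (where necessarily `a = b`): if `x`
is an operation with inputs `1, …, b`, then the input `i` of `x · e` is the input `e i` of `x`. -/
def SigmaSeq.pull (M : SigmaSeq.{u}) {a b : ℕ} (e : Fin a ≃ Fin b) (x : M.obj b) : M.obj a :=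
  M.act (Fin.equiv_iff_eq.1 ⟨e⟩ ▸ x) (e.trans (finCongr (Fin.equiv_iff_eq.1 ⟨e⟩).symm))

/-- A topological operad, i.e. an operad in the category of `k`-spaces (the products that are the
sources of the composition maps carry the `k`-space topology). The inputs
`1, …, m_1 + ⋯ + m_n` of a composite `x(y_1, …, y_n)` are identified with the pairs of an index `i`
and an input of `y_i`, in lexicographic order, by `finSigmaFinEquiv`. -/
structure TopOperad extends SigmaSeq.{u} where
  /-- The unit in `O(1)`. -/
  one : obj 1
  /-- The composition `O(n) × O(m_1) × ⋯ × O(m_n) → O(m_1 + ⋯ + m_n)`. -/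
  comp : ∀ {n : ℕ} {m : Fin n → ℕ}, obj n → (∀ i, obj (m i)) → obj (∑ i, m i)
  continuous_comp : ∀ {n : ℕ} {m : Fin n → ℕ},
    Continuous[TopologicalSpace.compactlyGenerated.{u} (obj n × ∀ i, obj (m i)), _]
      fun p : obj n × ∀ i, obj (m i) => comp p.1 p.2
  /-- Equivariance in the outer operation. -/
  comp_act_left : ∀ {n : ℕ} {m : Fin n → ℕ} (x : obj n) (σ : Equiv.Perm (Fin n))
    (y : ∀ i, obj (m i)),
    comp (act x σ) (fun i => y (σ i)) =
      toSigmaSeq.pull (finSigmaFinEquiv.symm.trans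
        ((Equiv.sigmaCongrLeft (β := fun i => Fin (m i)) σ).trans finSigmaFinEquiv)) (comp x y)
  /-- Equivariance in the inner operations. -/
  comp_act_right : ∀ {n : ℕ} {m : Fin n → ℕ} (x : obj n) (y : ∀ i, obj (m i))
    (τ : ∀ i, Equiv.Perm (Fin (m i))),
    comp x (fun i => act (y i) (τ i)) =
      toSigmaSeq.pull (finSigmaFinEquiv.symm.trans
        ((Equiv.sigmaCongrRight τ).trans finSigmaFinEquiv)) (comp x y)
  one_comp : ∀ {n : ℕ} (x : obj n),
    comp one (fun _ => x) = toSigmaSeq.pull (finCongr (by simp)) x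
  comp_one : ∀ {n : ℕ} (x : obj n),
    comp x (fun _ => one) = toSigmaSeq.pull (finCongr (by simp)) x
  /-- Associativity `x(y_1, …, y_n)(z_1, z_2, …) = x(y_1(z_1, …), …, y_n(…, z_{m_1 + ⋯ + m_n}))`. -/
  comp_assoc : ∀ {n : ℕ} {m : Fin n → ℕ} {l : Fin (∑ i, m i) → ℕ} (x : obj n)
    (y : ∀ i, obj (m i)) (z : ∀ s, obj (l s)),
    comp (comp x y) z =
      toSigmaSeq.pull (finSigmaFinEquiv.symm.trans
        ((Equiv.sigmaCongrLeft (β := fun s => Fin (l s)) finSigmaFinEquiv).symm.trans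
          ((Equiv.sigmaAssoc fun i j => Fin (l (finSigmaFinEquiv ⟨i, j⟩))).trans
            ((Equiv.sigmaCongrRight fun _ => finSigmaFinEquiv).trans finSigmaFinEquiv))))
        (comp x fun i => comp (y i) fun j => z (finSigmaFinEquiv ⟨i, j⟩))

namespace SigmaSeq

variable (M : SigmaSeq.{u})

theorem pull_perm {n : ℕ} (e : Equiv.Perm (Fin n)) (x : M.obj n) : M.pull e x = M.act x e := rfl

theorem pull_refl {n : ℕ} (x : M.obj n) : M.pull (Equiv.refl _) x = x := M.act_one x

theorem pull_pull {a b c : ℕ} (e : Fin a ≃ Fin b) (f : Fin b ≃ Fin c) (x : M.obj c) :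
    M.pull e (M.pull f x) = M.pull (e.trans f) x := by
  obtain rfl : b = c := Fin.equiv_iff_eq.1 ⟨f⟩
  obtain rfl : a = b := Fin.equiv_iff_eq.1 ⟨e⟩
  exact (M.act_mul x f e).symm

theorem continuous_pull {a b : ℕ} (e : Fin a ≃ Fin b) :
    Continuous fun x : M.obj b => M.pull e x := by
  obtain rfl : a = b := Fin.equiv_iff_eq.1 ⟨e⟩
  exact M.continuous_act e

end SigmaSeq

namespace TopOperad

variable (O : TopOperad.{u})

theorem comp_pull_left {n n' : ℕ} {m : Fin n → ℕ} (x : O.obj n) (σ : Fin n' ≃ Fin n)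
    (y : ∀ i, O.obj (m i)) :
    O.comp (O.pull σ x) (fun i => y (σ i)) =
      O.pull (finSigmaFinEquiv.symm.trans
        ((Equiv.sigmaCongrLeft (β := fun i => Fin (m i)) σ).trans finSigmaFinEquiv))
        (O.comp x y) := by
  obtain rfl : n' = n := Fin.equiv_iff_eq.1 ⟨σ⟩
  exact O.comp_act_left x σ y

theorem comp_pull_right {n : ℕ} {m m' : Fin n → ℕ} (x : O.obj n) (y : ∀ i, O.obj (m i))
    (τ : ∀ i, Fin (m' i) ≃ Fin (m i)) :
    O.comp x (fun i => O.pull (τ i) (y i)) =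
      O.pull (finSigmaFinEquiv.symm.trans
        ((Equiv.sigmaCongrRight τ).trans finSigmaFinEquiv)) (O.comp x y) := by
  obtain rfl : m' = m := funext fun i => Fin.equiv_iff_eq.1 ⟨τ i⟩
  exact O.comp_act_right x y τ

theorem assoc_aux₀ {n d : ℕ} {m : Fin n → ℕ} {l : Fin (∑ i, m i) → ℕ} {d' : Fin n → ℕ}
    (φ : Fin d ≃ Σ s, Fin (l s)) (h : ∀ i, Fin (m i) → Fin (∑ i, m i))
    (hh : h = fun i j => finSigmaFinEquiv ⟨i, j⟩)
    (φ' : Fin d ≃ Σ i, Fin (d' i)) (φ'' : ∀ i, Fin (d' i) ≃ Σ j, Fin (l (h i j)))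
    (hφ : ∀ i j r, φ (φ'.symm ⟨i, (φ'' i).symm ⟨j, r⟩⟩) = ⟨h i j, r⟩)
    (x : O.obj n) (y : ∀ i, O.obj (m i)) (z : ∀ s, O.obj (l s)) :
    O.pull (φ.trans finSigmaFinEquiv) (O.comp (O.comp x y) z) =
      O.pull (φ'.trans finSigmaFinEquiv) (O.comp x fun i =>
        O.pull ((φ'' i).trans finSigmaFinEquiv) (O.comp (y i) fun j => z (h i j))) := by
  subst hh
  rw [O.comp_assoc, O.comp_pull_right, O.pull_pull, O.pull_pull]
  congr 1
  ext t
  obtain ⟨⟨i, u⟩, rfl⟩ := φ'.symm.surjective t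
  obtain ⟨⟨j, r⟩, rfl⟩ := (φ'' i).symm.surjective u
  have e1 : (Equiv.sigmaCongrLeft (β := fun s => Fin (l s)) finSigmaFinEquiv).symm
      ⟨finSigmaFinEquiv ⟨i, j⟩, r⟩ = ⟨⟨i, j⟩, r⟩ := by
    rw [Equiv.symm_apply_eq]; rfl
  simp only [Equiv.trans_apply, hφ, Equiv.symm_apply_apply, e1, Equiv.apply_symm_apply,
    Equiv.sigmaCongrRight_apply]
  rfl

theorem assoc_aux {n c d : ℕ} {m : Fin n → ℕ} {l : Fin c → ℕ} {d' : Fin n → ℕ}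
    (ψ : Fin c ≃ Σ i, Fin (m i)) (φ : Fin d ≃ Σ s, Fin (l s))
    (g : ∀ i, Fin (m i) → Fin c) (hg : ∀ i j, ψ (g i j) = ⟨i, j⟩)
    (φ' : Fin d ≃ Σ i, Fin (d' i)) (φ'' : ∀ i, Fin (d' i) ≃ Σ j, Fin (l (g i j)))
    (hφ : ∀ i j r, φ (φ'.symm ⟨i, (φ'' i).symm ⟨j, r⟩⟩) = ⟨g i j, r⟩)
    (x : O.obj n) (y : ∀ i, O.obj (m i)) (z : ∀ s, O.obj (l s)) :
    O.pull (φ.trans finSigmaFinEquiv) (O.comp (O.pull (ψ.trans finSigmaFinEquiv) (O.comp x y)) z) =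
      O.pull (φ'.trans finSigmaFinEquiv) (O.comp x fun i =>
        O.pull ((φ'' i).trans finSigmaFinEquiv) (O.comp (y i) fun j => z (g i j))) := by
  obtain ⟨e, he⟩ : ∃ e, e = ψ.trans finSigmaFinEquiv := ⟨_, rfl⟩
  obtain ⟨l', rfl⟩ : ∃ l' : Fin (∑ i, m i) → ℕ, l = fun i => l' (e i) :=
    ⟨fun s => l (e.symm s), by simp⟩
  obtain ⟨z', rfl⟩ : ∃ z' : ∀ s, O.obj (l' s), z = fun i => z' (e i) :=
    ⟨Equiv.piCongrLeft (fun s => O.obj (l' s)) e z,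
      ((Equiv.piCongrLeft (fun s => O.obj (l' s)) e).symm_apply_apply z).symm⟩
  rw [← he, O.comp_pull_left, O.pull_pull]
  have key := O.assoc_aux₀ (φ.trans (Equiv.sigmaCongrLeft (β := fun s => Fin (l' s)) e))
    (fun i j => e (g i j)) (by funext i j; simp [he, hg]) φ' φ''
    (by intro i j r; rw [Equiv.trans_apply, hφ]; rfl) x y z'
  rw [← key]
  congr 1
  ext t
  simp

theorem assoc_aux' {n c d : ℕ} {R : Type} {m : Fin n → ℕ} {l : R → ℕ} {d' : Fin n → ℕ}
    (α : Fin c ≃ R) (ψ : Fin c ≃ Σ i, Fin (m i)) (φ : Fin d ≃ Σ r, Fin (l r))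
    (g : ∀ i, Fin (m i) → R) (hg : ∀ i j, ψ (α.symm (g i j)) = ⟨i, j⟩)
    (φ' : Fin d ≃ Σ i, Fin (d' i)) (φ'' : ∀ i, Fin (d' i) ≃ Σ j, Fin (l (g i j)))
    (hφ : ∀ i j r, φ (φ'.symm ⟨i, (φ'' i).symm ⟨j, r⟩⟩) = ⟨g i j, r⟩)
    (x : O.obj n) (y : ∀ i, O.obj (m i)) (z : ∀ s, O.obj (l s)) :
    O.pull ((φ.trans (Equiv.sigmaCongrLeft (β := fun r => Fin (l r)) α).symm).trans
        finSigmaFinEquiv)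
      (O.comp (O.pull (ψ.trans finSigmaFinEquiv) (O.comp x y)) fun s => z (α s)) =
      O.pull (φ'.trans finSigmaFinEquiv) (O.comp x fun i =>
        O.pull ((φ'' i).trans finSigmaFinEquiv) (O.comp (y i) fun j => z (g i j))) := by
  obtain ⟨g, rfl⟩ : ∃ g' : ∀ i, Fin (m i) → Fin c, g = fun i j => α (g' i j) :=
    ⟨fun i j => α.symm (g i j), by simp⟩
  refine O.assoc_aux (l := fun s => l (α s)) ψ _ g (by simpa using hg) φ' φ'' ?_ x y
    fun s => z (α s)
  intro i j r
  rw [Equiv.trans_apply, hφ, Equiv.symm_apply_eq]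
  rfl

end TopOperad

/-- The finite set `S` is the disjoint union of the finite sets `A q`, `q ∈ Q`. -/
structure Decomp {ι : Type} (S Q : Finset ι) (A : ι → Finset ι) : Prop where
  mem_iff : ∀ c, c ∈ S ↔ ∃ q ∈ Q, c ∈ A q
  unique : ∀ q ∈ Q, ∀ q' ∈ Q, ∀ c, c ∈ A q → c ∈ A q' → q = q'

/-- A chosen total order of a finite set. -/
def ord {ι : Type} (S : Finset ι) : Fin S.card ≃ S := S.equivFin.symm

namespace Decomp

variable {ι : Type} {S Q : Finset ι} {A : ι → Finset ι}

/-- The bijection between a disjoint union of finite sets and the set of pairs of an index and an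
element of the corresponding set. -/
def equiv (h : Decomp S Q A) : S ≃ Σ q : Q, A q :=
  (Equiv.ofBijective
    (fun p : Σ q : Q, A q => (⟨p.2.1, (h.mem_iff _).2 ⟨p.1.1, p.1.2, p.2.2⟩⟩ : S))
    ⟨by
      rintro ⟨⟨q, hq⟩, ⟨c, hc⟩⟩ ⟨⟨q', hq'⟩, ⟨c', hc'⟩⟩ e
      obtain rfl : c = c' := congrArg Subtype.val e
      obtain rfl := h.unique q hq q' hq' c hc hc'
      rfl, by
      rintro ⟨c, hc⟩
      obtain ⟨q, hq, hc'⟩ := (h.mem_iff c).1 hc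
      exact ⟨⟨⟨q, hq⟩, ⟨c, hc'⟩⟩, rfl⟩⟩).symm

/-- The bijection `equiv`, on positions with respect to the chosen orders of `S` and the `A q`. -/
def posEquiv (h : Decomp S Q A) : Fin S.card ≃ Σ q : Q, Fin (A q).card :=
  ((ord S).trans h.equiv).trans (Equiv.sigmaCongrRight fun q => (ord (A q)).symm)

theorem ord_posEquiv_symm (h : Decomp S Q A) (q : Q) (j : Fin (A q).card) :
    (ord S (h.posEquiv.symm ⟨q, j⟩)).1 = (ord (A q) j).1 := by
  change (ord S ((ord S).symm (h.equiv.symm ⟨q, ord (A q) j⟩))).1 = _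
  rw [Equiv.apply_symm_apply]
  rfl

end Decomp

namespace TopOperad

variable (O : TopOperad.{u}) {ι : Type} {S Q R : Finset ι} {A B D : ι → Finset ι}

/-- The composite of an operation `x` and operations `y q`, where the inputs of `x` are labelled by
the elements of `Q`, those of `y q` by the elements of `A q`, and those of the composite by the
elements of the disjoint union `S` of the sets `A q` (all finite sets being ordered by `ord`). -/
def gcomp (h : Decomp S Q A) (x : O.obj Q.card) (y : ∀ q : Q, O.obj (A q).card) :
    O.obj S.card :=
  O.pull ((h.posEquiv.trans
      (Equiv.sigmaCongrLeft (β := fun q : Q => Fin (A q).card) (ord Q)).symm).trans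
        finSigmaFinEquiv)
    (O.comp x fun i => y (ord Q i))

/-- The unit, as an operation with one input labelled by the only element of `S`. -/
def unitAt (h : S.card = 1) : O.obj S.card := O.pull (finCongr h) O.one

theorem gcomp_assoc (h₁ : Decomp S R A) (h₂ : Decomp R Q B)
    (h₃ : ∀ q ∈ Q, Decomp (D q) (B q) A) (h₄ : Decomp S Q D) (x : O.obj Q.card)
    (y : ∀ q : Q, O.obj (B q).card) (z : ∀ r : R, O.obj (A r).card) :
    O.gcomp h₁ (O.gcomp h₂ x y) z =
      O.gcomp h₄ x fun q => O.gcomp (h₃ q.1 q.2) (y q) fun r =>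
        z ⟨r.1, (h₂.mem_iff _).2 ⟨q.1, q.2, r.2⟩⟩ := by
  refine O.assoc_aux' (l := fun r : R => (A r).card) (ord R) _ h₁.posEquiv
    (fun i j => ⟨(ord (B (ord Q i)) j).1, (h₂.mem_iff _).2 ⟨_, (ord Q i).2, (ord _ j).2⟩⟩)
    ?_ _ (fun i => ((h₃ (ord Q i).1 (ord Q i).2).posEquiv.trans
      (Equiv.sigmaCongrLeft (β := fun r : B (ord Q i) => Fin (A r).card) (ord _)).symm))
    ?_ x (fun i => y (ord Q i)) z
  · intro i j
    rw [Equiv.trans_apply, Equiv.symm_apply_eq, ← Equiv.eq_symm_apply]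
    apply (ord R).injective
    apply Subtype.ext
    rw [Equiv.apply_symm_apply]
    exact (h₂.ord_posEquiv_symm _ _).symm
  · intro i j r
    rw [← Equiv.eq_symm_apply]
    apply (ord S).injective
    apply Subtype.ext
    rw [h₁.ord_posEquiv_symm]
    refine (h₄.ord_posEquiv_symm _ _).trans ?_
    exact (h₃ (ord Q i).1 (ord Q i).2).ord_posEquiv_symm _ _

theorem gcomp_unit (h : Decomp Q Q A) (hA : ∀ q ∈ Q, A q = {q}) (x : O.obj Q.card)
    (hc : ∀ q : Q, (A q).card = 1) : O.gcomp h x (fun q => O.unitAt (hc q)) = x := by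
  unfold gcomp unitAt
  rw [O.comp_pull_right, O.comp_one, O.pull_pull, O.pull_pull]
  refine Eq.trans ?_ (O.pull_refl x)
  congr 1
  ext t
  obtain ⟨⟨i, j⟩, rfl⟩ := (h.posEquiv.trans
    (Equiv.sigmaCongrLeft (β := fun q : Q => Fin (A q).card) (ord Q)).symm).symm.surjective t
  have e1 : (h.posEquiv.trans
      (Equiv.sigmaCongrLeft (β := fun q : Q => Fin (A q).card) (ord Q)).symm).symm ⟨i, j⟩ = i := by
    apply (ord Q).injective
    apply Subtype.ext
    refine (h.ord_posEquiv_symm (ord Q i) j).trans ?_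
    exact Finset.mem_singleton.1 ((hA _ (ord Q i).2).subset (ord (A (ord Q i)) j).2)
  rw [Equiv.refl_apply]
  conv_rhs => rw [e1]
  have hj : (j : ℕ) = 0 := by have := j.2; have := hc (ord Q i); omega
  simp only [Equiv.trans_apply, Equiv.symm_trans_apply, Equiv.symm_symm, Equiv.apply_symm_apply,
    Equiv.symm_apply_apply, Equiv.sigmaCongrRight_apply, finCongr_apply, Fin.val_cast,
    finSigmaFinEquiv_apply]
  simp [hj]

theorem one_comp' (m : Fin 1 → ℕ) (y : ∀ i, O.obj (m i)) :
    O.comp O.one y = O.pull (finCongr (by simp)) (y 0) := by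
  obtain ⟨n, rfl⟩ : ∃ n, m = fun _ => n :=
    ⟨m 0, funext fun i => by rw [Subsingleton.elim i 0]⟩
  obtain ⟨x, rfl⟩ : ∃ x, y = fun _ => x :=
    ⟨y 0, funext fun i => by obtain rfl := Subsingleton.elim i 0; rfl⟩
  exact O.one_comp x

theorem unit_comp_aux {Q : Type} {n : ℕ} (m : Q → ℕ) (y : ∀ q, O.obj (m q)) (q₀ : Q)
    (α : Fin n ≃ Q) (e : Fin n ≃ Fin 1) (φ : Fin (m q₀) ≃ Σ q, Fin (m q))
    (hφ : ∀ j, φ j = ⟨q₀, j⟩) :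
    O.pull ((φ.trans (Equiv.sigmaCongrLeft (β := fun q => Fin (m q)) α).symm).trans
      finSigmaFinEquiv) (O.comp (O.pull e O.one) fun i => y (α i)) = y q₀ := by
  obtain rfl : n = 1 := Fin.equiv_iff_eq.1 ⟨e⟩
  obtain rfl : e = Equiv.refl _ := Subsingleton.elim _ _
  obtain rfl : q₀ = α 0 := by
    rw [← Equiv.symm_apply_eq]; exact Subsingleton.elim _ _
  rw [O.pull_refl, O.one_comp']
  refine (O.pull_pull _ _ _).trans (Eq.trans ?_ (O.pull_refl _))
  congr 1
  ext j
  have e1 : (Equiv.sigmaCongrLeft (β := fun q => Fin (m q)) α).symm ⟨α 0, j⟩ = ⟨0, j⟩ := by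
    rw [Equiv.symm_apply_eq]; rfl
  rw [Equiv.trans_apply, Equiv.trans_apply, Equiv.trans_apply, hφ, e1]
  exact finSigmaFinEquiv_one _

theorem gcomp_unit_left {b : ι} (h : Decomp (A b) Q A) (hQ : Q = {b}) (hc : Q.card = 1)
    (y : ∀ q : Q, O.obj (A q).card) :
    O.gcomp h (O.unitAt hc) y = y ⟨b, hQ ▸ Finset.mem_singleton_self b⟩ := by
  refine O.unit_comp_aux (fun q : Q => (A q).card) y ⟨b, hQ ▸ Finset.mem_singleton_self b⟩
    (ord Q) (finCongr hc) h.posEquiv fun j => ?_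
  rw [← Equiv.eq_symm_apply]
  apply (ord (A b)).injective
  apply Subtype.ext
  exact (h.ord_posEquiv_symm ⟨b, hQ ▸ Finset.mem_singleton_self b⟩ j).symm

end TopOperad

/-! ### The diagram of pearled trees of an operad -/

namespace PearledTree

/-- The maximal elements of the family `{C ∈ N | p C}`. -/
def maxima {α : Type} [DecidableEq α] (N : Finset (Finset α)) (p : Finset α → Prop) :
    Finset (Finset α) :=
  open Classical in N.filter fun C => p C ∧ ∀ D ∈ N, p D → C ⊆ D → C = D

/-- The maximal elements of `N` among those contained in `B`. -/
abbrev maximaLE {α : Type} [DecidableEq α] (N : Finset (Finset α)) (B : Finset α) :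
    Finset (Finset α) :=
  maxima N (· ⊆ B)

/-- The maximal elements of `N` among those strictly contained in `B`. -/
abbrev maximaLT {α : Type} [DecidableEq α] (N : Finset (Finset α)) (B : Finset α) :
    Finset (Finset α) :=
  maxima N (· ⊂ B)

section maxima

variable {α : Type} [DecidableEq α] {N N' : Finset (Finset α)} {p : Finset α → Prop}

theorem mem_maxima {C : Finset α} :
    C ∈ maxima N p ↔ C ∈ N ∧ p C ∧ ∀ D ∈ N, p D → C ⊆ D → C = D := by
  simp [maxima]

theorem maximaLE_of_mem {B : Finset α} (hB : B ∈ N) : maximaLE N B = {B} := by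
  ext C
  rw [mem_maxima, Finset.mem_singleton]
  constructor
  · rintro ⟨_, h, h'⟩
    exact h' B hB (Finset.Subset.refl _) h
  · rintro rfl
    exact ⟨hB, Finset.Subset.refl _, fun D _ h h' => Finset.Subset.antisymm h' h⟩

theorem maximaLE_eq_maximaLT {B : Finset α} (hB : B ∉ N) : maximaLE N B = maximaLT N B := by
  ext C
  have key : ∀ D ∈ N, D ⊆ B ↔ D ⊂ B := fun D hD =>
    ⟨fun h => h.ssubset_of_ne fun e => hB (e ▸ hD), fun h => h.subset⟩
  rw [mem_maxima, mem_maxima]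
  constructor
  · rintro ⟨h1, h2, h3⟩
    exact ⟨h1, (key C h1).1 h2, fun D hD h => h3 D hD ((key D hD).2 h)⟩
  · rintro ⟨h1, h2, h3⟩
    exact ⟨h1, (key C h1).2 h2, fun D hD h => h3 D hD ((key D hD).1 h)⟩

theorem decomp_maxima (hN : ∀ v ∈ N, ∀ w ∈ N, v ⊆ w ∨ w ⊆ v ∨ Disjoint v w)
    (hne : ∀ v ∈ N, v.Nonempty) (hsub : N' ⊆ N) (hp : ∀ C D, C ⊆ D → p D → p C) :
    Decomp (maxima N' p) (maxima N p) (maximaLE N') where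
  mem_iff C := by
    constructor
    · intro hC
      obtain ⟨h1, h2, h3⟩ := mem_maxima.1 hC
      classical
      obtain ⟨B, hCB, hB⟩ := (N.filter p).exists_le_maximal (a := C)
        (Finset.mem_filter.2 ⟨hsub h1, h2⟩)
      have hB1 := Finset.mem_filter.1 hB.1
      refine ⟨B, mem_maxima.2 ⟨hB1.1, hB1.2, fun D hD hpD hBD => ?_⟩, mem_maxima.2
        ⟨h1, hCB, fun D hD hDB hCD => h3 D hD (hp D B hDB hB1.2) hCD⟩⟩
      exact Finset.Subset.antisymm hBD (hB.2 (Finset.mem_filter.2 ⟨hD, hpD⟩) hBD)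
    · rintro ⟨B, hB, hC⟩
      obtain ⟨h1, h2, h3⟩ := mem_maxima.1 hC
      obtain ⟨h4, h5, h6⟩ := mem_maxima.1 hB
      refine mem_maxima.2 ⟨h1, hp C B h2 h5, fun D hD hpD hCD => ?_⟩
      rcases hN D (hsub hD) B h4 with h | h | h
      · exact h3 D hD h hCD
      · exact h3 D hD (h6 D (hsub hD) hpD h).symm.subset hCD
      · obtain ⟨a, ha⟩ := hne C (hsub h1)
        exact absurd (h2 ha) (Finset.disjoint_left.1 h (hCD ha))
  unique B hB B' hB' C hC hC' := by
    obtain ⟨h1, h2, -⟩ := mem_maxima.1 hC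
    obtain ⟨-, h2', -⟩ := mem_maxima.1 hC'
    obtain ⟨h4, h5, h6⟩ := mem_maxima.1 hB
    obtain ⟨h4', h5', h6'⟩ := mem_maxima.1 hB'
    rcases hN B h4 B' h4' with h | h | h
    · exact h6 B' h4' h5' h
    · exact (h6' B h4 h5 h).symm
    · obtain ⟨a, ha⟩ := hne C (hsub h1)
      exact absurd (h2' ha) (Finset.disjoint_left.1 h (h2 ha))

end maxima

variable {k : ℕ} {T T' T'' : PearledTree k}

/-- The vertices and the leaves of a tree; the leaf labelled `i` is encoded by `{i}`. -/
def nodes (T : PearledTree k) : Finset (Finset (Option (Fin k))) :=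
  T.vertices ∪ Finset.univ.image fun i => {some i}

/-- The set of inputs of a vertex `V`, i.e. the vertices and leaves immediately above `V`. Its
cardinality is the arity `|V|` of `V`. -/
abbrev inputs (T : PearledTree k) (V : Finset (Option (Fin k))) :
    Finset (Finset (Option (Fin k))) :=
  maximaLT T.nodes V

theorem mem_nodes {C : Finset (Option (Fin k))} :
    C ∈ T.nodes ↔ C ∈ T.vertices ∨ ∃ i, {some i} = C := by
  simp [nodes]

theorem nodes_nonempty (C : Finset (Option (Fin k))) (hC : C ∈ T.nodes) : C.Nonempty := by
  rcases mem_nodes.1 hC with h | ⟨i, rfl⟩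
  · rcases T.arity C h with h | h
    · exact ⟨_, h⟩
    · exact Finset.card_pos.1 (by omega)
  · exact Finset.singleton_nonempty _

theorem nodes_laminar : ∀ v ∈ T.nodes, ∀ w ∈ T.nodes, v ⊆ w ∨ w ⊆ v ∨ Disjoint v w := by
  have key : ∀ (i : Fin k) (w : Finset (Option (Fin k))), {some i} ⊆ w ∨ Disjoint {some i} w := by
    intro i w
    rw [Finset.singleton_subset_iff, Finset.disjoint_singleton_left]
    exact em _
  intro v hv w hw
  rcases mem_nodes.1 hv with hv | ⟨i, rfl⟩
  · rcases mem_nodes.1 hw with hw | ⟨i, rfl⟩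
    · exact T.laminar v hv w hw
    · exact Or.inr ((key i v).imp id fun h => h.symm)
  · exact (key i w).imp id Or.inr

theorem nodes_subset (h : T ≤ T') : T'.nodes ⊆ T.nodes :=
  Finset.union_subset_union (show T'.vertices ⊆ T.vertices from h) (Finset.Subset.refl _)

theorem decomp_LE (h : T ≤ T') (B : Finset (Option (Fin k))) :
    Decomp (maximaLE T'.nodes B) (maximaLE T.nodes B) (maximaLE T'.nodes) :=
  decomp_maxima nodes_laminar nodes_nonempty (nodes_subset h) fun _ _ h h' => h.trans h'

theorem decomp_LT (h : T ≤ T') (B : Finset (Option (Fin k))) :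
    Decomp (maximaLT T'.nodes B) (maximaLT T.nodes B) (maximaLE T'.nodes) :=
  decomp_maxima nodes_laminar nodes_nonempty (nodes_subset h)
    fun _ _ h h' => Finset.ssubset_of_subset_of_ssubset h h'

theorem decomp_LE_LT (h : T ≤ T') {B : Finset (Option (Fin k))} (hB : B ∉ T'.nodes) :
    Decomp (maximaLE T'.nodes B) (maximaLT T.nodes B) (maximaLE T'.nodes) :=
  maximaLE_eq_maximaLT hB ▸ decomp_LT h B

theorem mem_vertices_of_notMem {B : Finset (Option (Fin k))} (hB : B ∈ T.nodes)
    (hB' : B ∉ T'.nodes) : B ∈ T.vertices :=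
  (mem_nodes.1 hB).resolve_right fun h => hB' (mem_nodes.2 (Or.inr h))

theorem mem_nodes_of_mem_maxima {B : Finset (Option (Fin k))} {p : Finset (Option (Fin k)) → Prop}
    (hB : B ∈ maxima T.nodes p) : B ∈ T.nodes := (mem_maxima.1 hB).1

end PearledTree

namespace TopOperad

variable (O : TopOperad.{u}) {k : ℕ} {T T' T'' : PearledTree k}

/-- The set of the decorations of the vertices `V` of `T` by elements of `O(|V|)`, i.e.
`O(|p|) × ∏_{V ≠ p} O(|V|)` where `p` is the pearl. -/
def Decoration (T : PearledTree k) : Type u :=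
  ∀ V : {V // V ∈ T.vertices}, O.obj (T.inputs V.1).card

/-- The product in the category of `k`-spaces. -/
instance (T : PearledTree k) : TopologicalSpace (O.Decoration T) :=
  TopologicalSpace.compactlyGenerated.{u}
    (∀ V : {V // V ∈ T.vertices}, O.obj (T.inputs V.1).card)

variable {O}

/-- Let `T → T'` be a contraction, and `B` a vertex or leaf of `T`. If `B` is a vertex or leaf of
`T'`, the value is the unit. Otherwise the edge below `B` is contracted, and the value is the
composite of the decorations of `B` and of all vertices that are joined to `B` by contracted
edges above `B`; its inputs are the maximal vertices and leaves of `T'` contained in `B`. -/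
def evalAt (h : T ≤ T') (x : O.Decoration T) (B : Finset (Option (Fin k))) (hB : B ∈ T.nodes) :
    O.obj (maximaLE T'.nodes B).card :=
  open Classical in
  if hB' : B ∈ T'.nodes then
    O.unitAt (by rw [maximaLE_of_mem hB']; exact Finset.card_singleton B)
  else
    O.gcomp (decomp_LE_LT h hB') (x ⟨B, mem_vertices_of_notMem hB hB'⟩)
      fun C => evalAt h x C.1 (mem_nodes_of_mem_maxima C.2)
termination_by B.card
decreasing_by exact Finset.card_lt_card (mem_maxima.1 C.2).2.1

theorem evalAt_of_mem (h : T ≤ T') (x : O.Decoration T) (B : Finset (Option (Fin k)))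
    (hB : B ∈ T.nodes) (hB' : B ∈ T'.nodes) :
    evalAt h x B hB =
      O.unitAt (by rw [maximaLE_of_mem hB']; exact Finset.card_singleton B) := by
  rw [evalAt, dif_pos hB']

theorem evalAt_of_notMem (h : T ≤ T') (x : O.Decoration T) (B : Finset (Option (Fin k)))
    (hB : B ∈ T.nodes) (hB' : B ∉ T'.nodes) :
    evalAt h x B hB = O.gcomp (decomp_LE_LT h hB') (x ⟨B, mem_vertices_of_notMem hB hB'⟩)
      fun C => evalAt h x C.1 (mem_nodes_of_mem_maxima C.2) := by
  rw [evalAt, dif_neg hB']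

/-- The map induced by a contraction `T → T'`: the decoration of a vertex of `T'` is the operadic
composite of the decorations of all vertices of `T` that are contracted to it. -/
def Decoration.map (h : T ≤ T') (x : O.Decoration T) : O.Decoration T' := fun V =>
  O.gcomp (decomp_LT h V.1) (x ⟨V.1, h V.2⟩)
    fun C => evalAt h x C.1 (mem_nodes_of_mem_maxima C.2)

theorem Decoration.map_id (x : O.Decoration T) : x.map (le_refl T) = x := by
  funext V
  refine Eq.trans ?_ (O.gcomp_unit (decomp_LT (le_refl T) V.1)
    (fun C hC => maximaLE_of_mem (mem_nodes_of_mem_maxima hC)) (x V)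
    (fun C => by
      rw [maximaLE_of_mem (mem_nodes_of_mem_maxima C.2)]; exact Finset.card_singleton C.1))
  refine congrArg _ (funext fun C => ?_)
  exact evalAt_of_mem _ _ _ _ (mem_nodes_of_mem_maxima C.2)

theorem evalAt_trans (h : T ≤ T') (h' : T' ≤ T'') (x : O.Decoration T) (n : ℕ) :
    ∀ (B : Finset (Option (Fin k))) (hB : B ∈ T.nodes), B.card = n →
      evalAt (h.trans h') x B hB = O.gcomp (decomp_LE h' B) (evalAt h x B hB)
        fun C => evalAt (h.trans h') x C.1 (nodes_subset h (mem_nodes_of_mem_maxima C.2)) := by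
  induction n using Nat.strong_induction_on with
  | _ n ih =>
    intro B hB hn
    by_cases hB' : B ∈ T'.nodes
    · rw [evalAt_of_mem h x B hB hB']
      rw [O.gcomp_unit_left (decomp_LE h' B) (maximaLE_of_mem hB')]
    · have hB'' : B ∉ T''.nodes := fun hm => hB' (nodes_subset h' hm)
      rw [evalAt_of_notMem h x B hB hB', evalAt_of_notMem _ x B hB hB'']
      rw [O.gcomp_assoc (decomp_LE h' B) (decomp_LE_LT h hB') (fun q _ => decomp_LE h' q)
        (decomp_LE_LT (h.trans h') hB'')]
      refine congrArg _ (funext fun C => ?_)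
      exact ih _ (hn ▸ Finset.card_lt_card (mem_maxima.1 C.2).2.1) C.1 _ rfl

theorem evalAt_map (h : T ≤ T') (h' : T' ≤ T'') (x : O.Decoration T) (n : ℕ) :
    ∀ (B : Finset (Option (Fin k))) (hB : B ∈ T'.nodes), B.card = n →
      evalAt h' (x.map h) B hB = evalAt (h.trans h') x B (nodes_subset h hB) := by
  induction n using Nat.strong_induction_on with
  | _ n ih =>
    intro B hB hn
    by_cases hB'' : B ∈ T''.nodes
    · rw [evalAt_of_mem _ _ B _ hB'', evalAt_of_mem _ _ B _ hB'']
    · rw [evalAt_of_notMem _ _ B _ hB'', evalAt_of_notMem _ _ B _ hB'']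
      refine (congrArg _ (funext fun C => ih _
        (hn ▸ Finset.card_lt_card (mem_maxima.1 C.2).2.1) C.1 _ rfl)).trans ?_
      refine (O.gcomp_assoc (decomp_LE_LT h' hB'') (decomp_LT h B) (fun q _ => decomp_LE h' q)
        (decomp_LE_LT (h.trans h') hB'') _ _ _).trans ?_
      refine congrArg _ (funext fun C => ?_)
      exact (evalAt_trans h h' x _ C.1 _ rfl).symm

theorem Decoration.map_map (h : T ≤ T') (h' : T' ≤ T'') (x : O.Decoration T) :
    (x.map h).map h' = x.map (h.trans h') := by
  funext V
  refine (congrArg _ (funext fun C => evalAt_map h h' x _ C.1 _ rfl)).trans ?_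
  refine (O.gcomp_assoc (decomp_LT h' V.1) (decomp_LT h V.1) (fun q _ => decomp_LE h' q)
    (decomp_LT (h.trans h') V.1) _ _ _).trans ?_
  refine congrArg _ (funext fun C => ?_)
  exact (evalAt_trans h h' x _ C.1 _ rfl).symm

theorem continuous_to_compactlyGenerated {X : Type u} [t : TopologicalSpace X] {S : Type u}
    [TopologicalSpace S] [CompactSpace S] [T2Space S] {f : S → X} (hf : Continuous f) :
    Continuous[_, TopologicalSpace.compactlyGenerated.{u} X] f := by
  let F : (Σ i : (K : CompHaus.{u}) × C(K, X), i.1) → X := fun z => z.1.2 z.2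
  have h1 : Continuous[_, TopologicalSpace.compactlyGenerated.{u} X] F := continuous_coinduced_rng
  have h2 : Continuous (Sigma.mk (β := fun i : (K : CompHaus.{u}) × C(K, X) => i.1)
      ⟨CompHaus.of S, ⟨f, hf⟩⟩) := continuous_sigmaMk
  exact @Continuous.comp _ _ _ _ _ (TopologicalSpace.compactlyGenerated.{u} X) _ F h1 h2

theorem continuous_gcomp {ι : Type} {S Q : Finset ι} {A : ι → Finset ι} (h : Decomp S Q A)
    {K : Type u} [TopologicalSpace K] [CompactSpace K] [T2Space K] {x : K → O.obj Q.card}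
    {y : K → ∀ q : Q, O.obj (A q).card} (hx : Continuous x) (hy : ∀ q, Continuous fun s => y s q) :
    Continuous fun s => O.gcomp h (x s) (y s) := by
  refine (O.continuous_pull _).comp ?_
  have h1 : Continuous fun s => (x s, fun i => y s (ord Q i)) :=
    hx.prodMk (continuous_pi fun i => hy (ord Q i))
  exact @Continuous.comp _ _ _ _ (TopologicalSpace.compactlyGenerated.{u} _) _ _ _
    O.continuous_comp (continuous_to_compactlyGenerated h1)

theorem continuous_evalAt (h : T ≤ T') {K : Type u} [TopologicalSpace K] [CompactSpace K]
    [T2Space K] {x : K → O.Decoration T} (hx : ∀ V, Continuous fun s => x s V) (n : ℕ) :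
    ∀ (B : Finset (Option (Fin k))) (hB : B ∈ T.nodes), B.card = n →
      Continuous fun s => evalAt h (x s) B hB := by
  induction n using Nat.strong_induction_on with
  | _ n ih =>
    intro B hB hn
    by_cases hB' : B ∈ T'.nodes
    · simp only [evalAt_of_mem _ _ B _ hB']
      exact continuous_const
    · simp only [evalAt_of_notMem _ _ B _ hB']
      exact continuous_gcomp _ (hx _) fun C =>
        ih _ (hn ▸ Finset.card_lt_card (mem_maxima.1 C.2).2.1) C.1 _ rfl

theorem Decoration.continuous_map (h : T ≤ T') :
    Continuous (Decoration.map h : O.Decoration T → O.Decoration T') := by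
  refine continuous_from_compactlyGenerated
    (X := ∀ V : {V // V ∈ T.vertices}, O.obj (T.inputs V.1).card)
    (Y := O.Decoration T') (Decoration.map h) fun K g => ?_
  refine continuous_to_compactlyGenerated
    (X := ∀ V : {V // V ∈ T'.vertices}, O.obj (T'.inputs V.1).card) (continuous_pi fun V => ?_)
  have hg : ∀ V, Continuous fun s => g s V := fun V => (continuous_apply V).comp g.continuous
  exact continuous_gcomp _ (hg _) fun C => continuous_evalAt h hg _ C.1 _ rfl

variable (O)

/-- The diagram `ρ_k^O : Ψ_k → Top` of an operad `O`: it sends a tree `T` with pearl `p` to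
`O(|p|) × ∏_{V ≠ p} O(|V|)`, and a contraction to the map given by operadic composition. -/
def treeDiagram (k : ℕ) : PearledTree k ⥤ TopCat.{u} where
  obj T := TopCat.of (O.Decoration T)
  map f := TopCat.ofHom ⟨Decoration.map (leOfHom f), Decoration.continuous_map (leOfHom f)⟩
  map_id _ := by
    ext x
    exact Decoration.map_id x
  map_comp f g := by
    ext x
    exact (Decoration.map_map (leOfHom f) (leOfHom g) x).symm

/-- An operad `O` is coherent if the diagrams `ρ_i^O` are coherent for all `i ≥ 2`. -/
def IsCoherent : Prop :=
  ∀ (i : ℕ) (hi : 2 ≤ i), _root_.IsCoherent hi (O.treeDiagram i)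

/-- An operad `O` is `k`-coherent if the diagrams `ρ_i^O` are coherent for all `2 ≤ i ≤ k`. -/
def IsKCoherent (k : ℕ) : Prop :=
  ∀ (i : ℕ) (hi : 2 ≤ i), i ≤ k → _root_.IsCoherent hi (O.treeDiagram i)

/-- An operad `O` is strongly coherent if the diagrams `ρ_i^O` are strongly coherent for all
`i ≥ 2`. -/
def IsStronglyCoherent : Prop :=
  ∀ (i : ℕ) (hi : 2 ≤ i), _root_.IsStronglyCoherent hi (O.treeDiagram i)

/-- An operad `O` is strongly `k`-coherent if the diagrams `ρ_i^O` are strongly coherent for all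
`2 ≤ i ≤ k`. -/
def IsStronglyKCoherent (k : ℕ) : Prop :=
  ∀ (i : ℕ) (hi : 2 ≤ i), i ≤ k → _root_.IsStronglyCoherent hi (O.treeDiagram i)

end TopOperad

end

noncomputable section

open PearledTree

open Set Metric

/-! ### Homotopies on the unit ball of a normed space -/

section Ball

variable {E : Type*} [NormedAddCommGroup E] [NormedSpace ℝ E]
variable {A C Y : Type*} [TopologicalSpace A] [TopologicalSpace C] [TopologicalSpace Y]

/-! A point of hocolim over Ψ'_k carries a probability weight supported on a chain of trees; let t
be its weight at c_k. The natural map from hocolim over ∂Ψ_k has image in t = 0. Where t < 1, the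
weight at c_k can be removed and the rest renormalized, so this part deforms into hocolim over ∂Ψ_k.
Where t > 0, all weight can be moved linearly to c_k, so this part contracts onto ρ(c_k).

The arrow c'_k → c_k being absent, the trees with an arrow to c_k in Ψ'_k are exactly those other
than c'_k. Hence where 0 < t < 1 the remaining weight lies on trees other than c_k and c'_k. On
these, contracting the edge below a vertex that carries all leaves but not the pearl
(`PearledTree.prune`) is monotone, increasing, and has values in ∂Ψ_k^U. The resulting prism
homotopy (`prismMotion`) deforms {0 < t < 1}, at constant t, into the open cylinder on hocolim over
∂Ψ_k^U. So hocolim over Ψ'_k is, up to homotopy, hocolim over ∂Ψ_k with the mapping cylinder of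
hocolim_{∂Ψ_k^U} ρ → ρ(c_k) glued on (`nonempty_cylinderDecomposition`).

It remains to see that gluing on the mapping cylinder of a weak equivalence is a weak equivalence
(`CylinderDecomposition.isWeakHomotopyEquiv`). Weak equivalences are handled by compression: a map
of a ball with a lift on the sphere is deformed, relative to the sphere, to a map with a lift on the
whole ball (`IsWeakHomotopyEquiv.hasCompression`, and conversely
`IsWeakHomotopyEquiv.of_hasCompression`). Given such a ball in the glued space, one subdivides it
into cubes so small that each lies in {t < 1/2} or in {t > 0}. The former stay fixed; the latter are
pushed off {t = 1}, cell by cell, by compressing the pair ({t > 0}, {0 < t < 1}), which is possible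
because the glued map is a weak equivalence (`exists_homotopy_of_height`). The result lies in {t <
1} and deforms into the base.

The statement on operads is the statement on diagrams, applied to each tree diagram. -/

theorem continuousOn_ite_le {X : Type*} [TopologicalSpace X] {s : Set X} {a b : X → ℝ}
    {f g : X → Y} (ha : ContinuousOn a s) (hb : ContinuousOn b s)
    (hf : ContinuousOn f (s ∩ {x | a x ≤ b x})) (hg : ContinuousOn g (s ∩ {x | b x ≤ a x}))
    (hfg : ∀ x ∈ s, a x = b x → f x = g x) :
    ContinuousOn (fun x => if a x ≤ b x then f x else g x) s := by
  rw [continuousOn_iff_continuous_domRestrict] at *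
  refine continuous_if_le (f := fun x : s => a x) (g := fun x : s => b x)
    (f' := fun x : s => f x) (g' := fun x : s => g x) ha hb ?_ ?_ fun x hx => hfg x x.2 hx
  · rw [← continuousOn_iff_continuous_domRestrict] at hf
    exact hf.comp continuous_subtype_val.continuousOn fun x hx => ⟨x.2, hx⟩
  · rw [← continuousOn_iff_continuous_domRestrict] at hg
    exact hg.comp continuous_subtype_val.continuousOn fun x hx => ⟨x.2, hx⟩

/-- The bottom and the sides of the cylinder over the unit ball. -/
def ballCup (E : Type*) [NormedAddCommGroup E] : Set (E × ℝ) :=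
  {z | ‖z.1‖ ≤ 1 ∧ z.2 = 0 ∨ ‖z.1‖ = 1 ∧ z.2 ∈ Icc (0 : ℝ) 1}

/-- The cylinder over the unit ball. -/
def ballCyl (E : Type*) [NormedAddCommGroup E] : Set (E × ℝ) :=
  {z | ‖z.1‖ ≤ 1 ∧ z.2 ∈ Icc (0 : ℝ) 1}

/-- The side of the cylinder over the unit ball. -/
def sphereCyl (E : Type*) [NormedAddCommGroup E] : Set (E × ℝ) :=
  {z | ‖z.1‖ = 1 ∧ z.2 ∈ Icc (0 : ℝ) 1}

theorem norm_div_max_le {x : E} {r : ℝ} (hr : 0 < r) : ‖(max ‖x‖ r)⁻¹ • x‖ ≤ 1 := by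
  have h : 0 < max ‖x‖ r := lt_max_of_lt_right hr
  rw [norm_smul, norm_inv, Real.norm_of_nonneg h.le, inv_mul_le_one₀ h]
  exact le_max_left _ _

theorem norm_div_norm {x : E} (hx : x ≠ 0) : ‖(‖x‖)⁻¹ • x‖ = 1 := by
  rw [norm_smul, norm_inv, norm_norm, inv_mul_cancel₀ (norm_ne_zero_iff.2 hx)]

/-- The homotopy extension property of the pair of the unit ball and the unit sphere. -/
theorem exists_extension_of_ballCup {M : E × ℝ → Y} (hM : ContinuousOn M (ballCup E)) :
    ∃ M' : E × ℝ → Y, ContinuousOn M' (ballCyl E) ∧ EqOn M' M (ballCup E) ∧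
      ∀ W, MapsTo M (ballCup E) W → MapsTo M' (ballCyl E) W := by
  -- Central projection from (0, 2): the ray through (x, s) is (0, 2) + (x, s - 2) / m. It meets the
  -- sides when m = ‖x‖ and the bottom when m = 1 - s / 2.
  let m : E × ℝ → ℝ := fun z => max ‖z.1‖ (1 - z.2 / 2)
  let r : E × ℝ → E × ℝ := fun z => ((m z)⁻¹ • z.1, 2 - (2 - z.2) * (m z)⁻¹)
  have hm : ∀ z ∈ ballCyl E, 1 / 2 ≤ m z := fun z hz =>
    le_max_of_le_right (by linarith [hz.2.2])
  have hmc : Continuous m := by fun_prop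
  have hr : MapsTo r (ballCyl E) (ballCup E) := by
    intro z hz
    have h1 := hm z hz
    have hz2 := hz.2
    rcases le_total ‖z.1‖ (1 - z.2 / 2) with h | h
    · left
      refine ⟨norm_div_max_le (by linarith [hz2.2]), ?_⟩
      have : m z = 1 - z.2 / 2 := max_eq_right h
      simp only [r, this]
      have h2 : (2 - z.2) ≠ 0 := by linarith [hz2.2]
      have h3 : (2 - z.2) * (1 - z.2 / 2)⁻¹ = 2 := by
        rw [show 1 - z.2 / 2 = (2 - z.2) / 2 by ring]
        field_simp
      rw [h3]
      norm_num
    · right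
      have h2 : m z = ‖z.1‖ := max_eq_left h
      have hz1 := hz.1
      rw [h2] at h1
      refine ⟨?_, ?_⟩
      · simp only [r, h2]
        exact norm_div_norm (norm_pos_iff.1 (by linarith))
      · simp only [r, h2]
        have hp : 0 < ‖z.1‖ := by linarith
        constructor
        · rw [sub_nonneg, mul_inv_le_iff₀ hp]
          linarith
        · rw [sub_le_comm, le_mul_inv_iff₀ hp]
          linarith [hz2.2]
  have hrc : ContinuousOn r (ballCyl E) := by
    have : ContinuousOn (fun z => (m z)⁻¹) (ballCyl E) :=
      hmc.continuousOn.inv₀ fun z hz => by linarith [hm z hz]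
    fun_prop
  refine ⟨M ∘ r, hM.comp hrc hr, fun z hz => ?_, fun W hW => hW.comp hr⟩
  have : r z = z := by
    rcases hz with ⟨h1, h2⟩ | ⟨h1, h2⟩
    · have : m z = 1 := by simp [m, h2, h1]
      simp [r, this, h2, Prod.ext_iff]
    · have : m z = 1 := by
        simp only [m, h1]
        exact max_eq_left (by linarith [h2.1])
      simp [r, this]
  exact congrArg M this

omit [NormedSpace ℝ E] in
/-- Gluing a map on the ball and a homotopy on the sphere. -/
theorem exists_ballCup_map {h : E → Y} {H : E × ℝ → Y} {W : Set Y}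
    (hh : ContinuousOn h (closedBall 0 1)) (hW : MapsTo h (closedBall 0 1) W)
    (hH : ContinuousOn H (sphereCyl E)) (hHW : MapsTo H (sphereCyl E) W)
    (h0 : ∀ x, ‖x‖ = 1 → H (x, 0) = h x) :
    ∃ M : E × ℝ → Y, ContinuousOn M (ballCup E) ∧ MapsTo M (ballCup E) W ∧
      (∀ x, M (x, 0) = h x) ∧ EqOn M H (sphereCyl E) := by
  let M : E × ℝ → Y := fun z => if z.2 ≤ 0 then h z.1 else H z
  have hM0 : ∀ x, M (x, 0) = h x := fun x => by simp [M]
  have hMS : EqOn M H (sphereCyl E) := by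
    rintro ⟨x, s⟩ ⟨h1, h2⟩
    simp only [M]
    split_ifs with hs
    · obtain rfl : s = 0 := le_antisymm hs h2.1
      exact (h0 x h1).symm
    · rfl
  have hcl1 : IsClosed {z : E × ℝ | ‖z.1‖ ≤ 1 ∧ z.2 = 0} :=
    (isClosed_le continuous_fst.norm continuous_const).inter
      (isClosed_eq continuous_snd continuous_const)
  have hcl2 : IsClosed (sphereCyl E) :=
    (isClosed_eq (by fun_prop) (by fun_prop)).inter (isClosed_Icc.preimage continuous_snd)
  refine ⟨M, ContinuousOn.union_of_isClosed ?_ (hH.congr hMS) hcl1 hcl2, ?_, hM0, hMS⟩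
  · refine ContinuousOn.congr (f := fun z => h z.1) ?_ fun z hz => ?_
    · exact hh.comp continuous_fst.continuousOn fun z hz => by simpa using hz.1
    · simp [M, hz.2]
  · rintro ⟨x, s⟩ (⟨hz1, hz2⟩ | hz)
    · obtain rfl : s = 0 := hz2
      rw [hM0]
      exact hW (by simpa using hz1)
    · exact hMS hz ▸ hHW hz

/-- The homotopy extension property with control of the image: the extension only takes values
already taken on the bottom and the sides, so it stays in `W`. -/
theorem exists_homotopy_extension {h : E → Y} {H : E × ℝ → Y} {W : Set Y}
    (hh : ContinuousOn h (closedBall 0 1)) (hW : MapsTo h (closedBall 0 1) W)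
    (hH : ContinuousOn H (sphereCyl E)) (hHW : MapsTo H (sphereCyl E) W)
    (h0 : ∀ x, ‖x‖ = 1 → H (x, 0) = h x) :
    ∃ K : E × ℝ → Y, ContinuousOn K (ballCyl E) ∧ MapsTo K (ballCyl E) W ∧
      (∀ x, ‖x‖ ≤ 1 → K (x, 0) = h x) ∧ EqOn K H (sphereCyl E) := by
  obtain ⟨M, hM, hMW, hM0, hMS⟩ := exists_ballCup_map hh hW hH hHW h0
  obtain ⟨K, h1, h2, h3⟩ := exists_extension_of_ballCup hM
  exact ⟨K, h1, h3 W hMW, fun x hx => (h2 (Or.inl ⟨hx, rfl⟩)).trans (hM0 x),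
    fun z hz => (h2 (Or.inr hz)).trans (hMS hz)⟩

/-- Given a map `h` of the unit ball to `W` and a lift `g` of its restriction to the unit sphere
along `φ : Z → W`, there is an extension of `g` to the unit ball which is a lift of `h` up to
homotopy relative to the unit sphere. -/
def HasCompression (φ : A → C) (Z : Set A) (W : Set C) (g : E → A) (h : E → C) : Prop :=
  ∃ (g' : E → A) (H : E × ℝ → C), ContinuousOn g' (closedBall 0 1) ∧ MapsTo g' (closedBall 0 1) Z ∧
    (∀ x, ‖x‖ = 1 → g' x = g x) ∧ ContinuousOn H (ballCyl E) ∧ MapsTo H (ballCyl E) W ∧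
    (∀ x, ‖x‖ ≤ 1 → H (x, 0) = h x) ∧ (∀ x, ‖x‖ ≤ 1 → H (x, 1) = φ (g' x)) ∧
    ∀ x s, ‖x‖ = 1 → s ∈ Icc (0 : ℝ) 1 → H (x, s) = h x

/-- The existence of compressions is invariant under homotopies. -/
theorem HasCompression.of_homotopy {φ : A → C} {Z : Set A} {W : Set C} {G : E × ℝ → A}
    {H : E × ℝ → C} (hG : ContinuousOn G (sphereCyl E)) (hGZ : MapsTo G (sphereCyl E) Z)
    (hH : ContinuousOn H (ballCyl E)) (hHW : MapsTo H (ballCyl E) W)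
    (hGH : ∀ z ∈ sphereCyl E, φ (G z) = H z)
    (hc : HasCompression φ Z W (fun x => G (x, 1)) (fun x => H (x, 1))) :
    HasCompression φ Z W (fun x => G (x, 0)) (fun x => H (x, 0)) := by
  obtain ⟨g, K, hg, hgZ, hgG, hK, hKW, hK0, hK1, hKS⟩ := hc
  have hcollar : ∀ x : E, 1 / 2 ≤ ‖x‖ → ‖x‖ ≤ 1 →
      ((‖x‖)⁻¹ • x, 2 * (1 - ‖x‖)) ∈ sphereCyl E := fun x h1 h2 =>
    ⟨norm_div_norm (norm_pos_iff.1 (by linarith)), by constructor <;> simp only <;> linarith⟩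
  have hcollarc : ContinuousOn (fun x : E => ((‖x‖)⁻¹ • x, 2 * (1 - ‖x‖)))
      {x | 1 / 2 ≤ ‖x‖ ∧ ‖x‖ ≤ 1} := by
    have : ContinuousOn (fun x : E => (‖x‖)⁻¹) {x | 1 / 2 ≤ ‖x‖ ∧ ‖x‖ ≤ 1} :=
      continuous_norm.continuousOn.inv₀ fun z hz => by linarith [hz.1]
    fun_prop
  have hsub : sphereCyl E ⊆ ballCyl E := fun z hz => ⟨hz.1.le, hz.2⟩
  have hdouble : ∀ x : E, ‖x‖ ≤ 1 / 2 → ‖(2 : ℝ) • x‖ ≤ 1 := fun x hx => by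
    rw [norm_smul, Real.norm_of_nonneg (by norm_num)]; linarith
  -- The inner half-ball carries the given compression; the collar retraces `G`, the time 2(1 - ‖x‖)
  -- being 1 at radius 1/2 and 0 on the sphere.
  let g' : E → A := fun x =>
    if ‖x‖ ≤ 1 / 2 then g ((2 : ℝ) • x) else G ((‖x‖)⁻¹ • x, 2 * (1 - ‖x‖))
  have hhalf : ∀ x : E, ‖x‖ = 1 / 2 →
      ((‖x‖)⁻¹ • x, 2 * (1 - ‖x‖)) = ((2 : ℝ) • x, (1 : ℝ)) := fun x hx => by
    rw [hx]; norm_num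
  let m : E × ℝ → ℝ := fun z => max ‖z.1‖ (1 - z.2 / 2)
  have hmc : Continuous m := by fun_prop
  have hm : ∀ z ∈ ballCyl E, 1 / 2 ≤ m z := fun z hz =>
    le_max_of_le_right (by linarith [hz.2.2])
  -- `H ∘ r` is a homotopy relative to the sphere, starting at H(·, 0). It ends with the map that is
  -- H(·, 1), rescaled, on the inner half-ball and runs along the sides of `H` in the collar.
  let r : E × ℝ → E × ℝ := fun z => ((m z)⁻¹ • z.1, min z.2 (2 * (1 - ‖z.1‖)))
  have hr : MapsTo r (ballCyl E) (ballCyl E) := fun z hz =>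
    ⟨norm_div_max_le (by linarith [hz.2.2]),
      le_min hz.2.1 (by linarith [hz.1]), (min_le_left _ _).trans hz.2.2⟩
  have hrc : ContinuousOn r (ballCyl E) := by
    have : ContinuousOn (fun z => (m z)⁻¹) (ballCyl E) :=
      hmc.continuousOn.inv₀ fun z hz => by linarith [hm z hz]
    fun_prop
  have hr1 : ∀ x : E, 1 / 2 ≤ ‖x‖ → ‖x‖ ≤ 1 → r (x, 1) = ((‖x‖)⁻¹ • x, 2 * (1 - ‖x‖)) := by
    intro x h1 h2
    have : m (x, 1) = ‖x‖ := max_eq_left (by norm_num; linarith)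
    simp only [r, this]
    rw [min_eq_right (by linarith)]
  have hr1' : ∀ x : E, ‖x‖ ≤ 1 / 2 → r (x, 1) = ((2 : ℝ) • x, (1 : ℝ)) := by
    intro x h1
    have : m (x, 1) = 1 / 2 := by
      simp only [m]
      rw [max_eq_right (by linarith)]
      norm_num
    simp only [r, this]
    rw [min_eq_left (by linarith)]
    norm_num
  have hr0 : ∀ x : E, ‖x‖ ≤ 1 → r (x, 0) = (x, 0) := by
    intro x h1
    have : m (x, 0) = 1 := by simp [m, h1]
    simp only [r, this]
    rw [min_eq_left (by linarith)]
    simp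
  have hrS : ∀ (x : E) (s : ℝ), ‖x‖ = 1 → s ∈ Icc (0 : ℝ) 1 → r (x, s) = (x, 0) := by
    intro x s h1 h2
    have : m (x, s) = 1 := by
      simp only [m, h1]
      rw [max_eq_left (by linarith [h2.1])]
    simp only [r, this, h1]
    simp [h2.1]
  -- The second homotopy: compress the inner half-ball by `K`, leave the collar unchanged. `Q` below
  -- is the concatenation of `H ∘ r` and `N`.
  let N : E × ℝ → C := fun z =>
    if ‖z.1‖ ≤ 1 / 2 then K ((2 : ℝ) • z.1, z.2) else H ((‖z.1‖)⁻¹ • z.1, 2 * (1 - ‖z.1‖))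
  have hKmem : ∀ (x : E) (s : ℝ), ‖x‖ ≤ 1 / 2 → s ∈ Icc (0 : ℝ) 1 →
      ((2 : ℝ) • x, s) ∈ ballCyl E := fun x s h1 h2 => ⟨hdouble x h1, h2⟩
  have hN : ContinuousOn N (ballCyl E) := by
    refine continuousOn_ite_le (by fun_prop) (by fun_prop) ?_ ?_ ?_
    · exact hK.comp (by fun_prop) fun z hz => hKmem z.1 z.2 hz.2 hz.1.2
    · exact hH.comp (hcollarc.comp continuous_fst.continuousOn fun z hz => ⟨hz.2, hz.1.1⟩)
        fun z hz => hsub (hcollar _ hz.2 hz.1.1)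
    · rintro ⟨x, s⟩ hz hx
      simp only at hx
      have h2 : ‖(2 : ℝ) • x‖ = 1 := by
        rw [norm_smul, hx]; norm_num
      simp only [hhalf x hx]
      rw [hKS _ _ h2 hz.2]
  have hNW : MapsTo N (ballCyl E) W := by
    intro z hz
    simp only [N]
    split_ifs with h
    · exact hKW (hKmem _ _ h hz.2)
    · exact hHW (hsub (hcollar _ (not_le.1 h).le hz.1))
  let Q : E × ℝ → C := fun z => if z.2 ≤ 1 / 2 then H (r (z.1, 2 * z.2)) else N (z.1, 2 * z.2 - 1)
  have hmem1 : ∀ z ∈ ballCyl E, z.2 ≤ 1 / 2 → (z.1, 2 * z.2) ∈ ballCyl E := fun z hz h =>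
    ⟨hz.1, by simp only; constructor <;> linarith [hz.2.1]⟩
  have hmem2 : ∀ z ∈ ballCyl E, 1 / 2 ≤ z.2 → (z.1, 2 * z.2 - 1) ∈ ballCyl E := fun z hz h =>
    ⟨hz.1, by simp only; constructor <;> linarith [hz.2.2]⟩
  have hN0 : ∀ x, ‖x‖ ≤ 1 → N (x, 0) = H (r (x, 1)) := by
    intro x hx
    simp only [N]
    split_ifs with h
    · rw [hK0 _ (hdouble x h), hr1' x h]
    · rw [hr1 x (not_le.1 h).le hx]
  refine ⟨g', Q, ?_, ?_, ?_, ?_, ?_, ?_, ?_, ?_⟩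
  · refine continuousOn_ite_le (by fun_prop) (by fun_prop) ?_ ?_ ?_
    · exact hg.comp (by fun_prop) fun x hx => by simpa using hdouble x hx.2
    · have hb : ∀ x ∈ closedBall (0 : E) 1 ∩ {x | 1 / 2 ≤ ‖x‖}, ‖x‖ ≤ 1 := fun x hx => by
        simpa using hx.1
      exact hG.comp (hcollarc.mono fun x hx => ⟨hx.2, hb x hx⟩)
        fun x hx => hcollar x hx.2 (hb x hx)
    · intro x _ hx
      rw [hhalf x hx]
      refine hgG _ ?_
      rw [norm_smul, hx]; norm_num
  · intro x hx
    have hx' : ‖x‖ ≤ 1 := by simpa using hx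
    simp only [g']
    split_ifs with h
    · exact hgZ (by simpa using hdouble x h)
    · exact hGZ (hcollar x (not_le.1 h).le hx')
  · intro x hx
    simp only [g', hx]
    norm_num
  · refine continuousOn_ite_le (by fun_prop) (by fun_prop) ?_ ?_ ?_
    · exact hH.comp (hrc.comp (by fun_prop) fun z hz => hmem1 z hz.1 hz.2)
        fun z hz => hr (hmem1 z hz.1 hz.2)
    · exact hN.comp (by fun_prop) fun z hz => hmem2 z hz.1 hz.2
    · rintro ⟨x, s⟩ hz hs
      simp only at hs
      subst hs
      norm_num
      exact (hN0 x hz.1).symm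
  · intro z hz
    simp only [Q]
    split_ifs with h
    · exact hHW (hr (hmem1 z hz h))
    · exact hNW (hmem2 z hz (not_le.1 h).le)
  · intro x hx
    simp [Q, hr0 x hx]
  · intro x hx
    simp only [Q, N, g']
    norm_num
    split_ifs with h
    · exact hK1 _ (hdouble x (by linarith))
    · exact (hGH _ (hcollar x (by linarith [not_le.1 h]) hx)).symm
  · intro x s hx hs
    simp only [Q, N]
    split_ifs with h h'
    · rw [hrS x _ hx ⟨by linarith [hs.1], by linarith⟩]
    · norm_num [hx] at h'
    · simp [hx]

/-- If all maps of pairs from the ball and sphere to `(W, Z)` compress into `Z`, then homotopies of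
maps to `W` that end in `Z` extend from the sphere to the ball. -/
theorem exists_extension_of_hasCompression {Z W : Set Y} (hZW : ∀ k : E → Y,
      ContinuousOn k (closedBall 0 1) → MapsTo k (closedBall 0 1) W →
      (∀ x, ‖x‖ = 1 → k x ∈ Z) → HasCompression id Z W k k)
    {M : E × ℝ → Y} (hM : ContinuousOn M (ballCup E)) (hMW : MapsTo M (ballCup E) W)
    (hMZ : ∀ x, ‖x‖ = 1 → M (x, 1) ∈ Z) :
    ∃ M' : E × ℝ → Y, ContinuousOn M' (ballCyl E) ∧ EqOn M' M (ballCup E) ∧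
      MapsTo M' (ballCyl E) W ∧ ∀ x, ‖x‖ ≤ 1 → M' (x, 1) ∈ Z := by
  -- `q` parametrizes the cup by the ball: the inner half-ball gives the bottom, the collar gives
  -- the sides, and the sphere goes to the upper rim, where `M` lies in `Z`.
  let m : E → ℝ := fun x => max ‖x‖ (1 / 2)
  have hm : ∀ x, 1 / 2 ≤ m x := fun x => le_max_right _ _
  let q : E → E × ℝ := fun x => ((m x)⁻¹ • x, 2 * m x - 1)
  have hq : MapsTo q (closedBall 0 1) (ballCup E) := by
    intro x hx
    have hx' : ‖x‖ ≤ 1 := by simpa using hx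
    rcases le_total ‖x‖ (1 / 2) with h | h
    · refine Or.inl ⟨norm_div_max_le (by norm_num), ?_⟩
      have : m x = 1 / 2 := max_eq_right h
      simp [q, this]
    · have : m x = ‖x‖ := max_eq_left h
      refine Or.inr ⟨?_, ?_⟩
      · simp only [q, this]
        exact norm_div_norm (norm_pos_iff.1 (by linarith))
      · simp only [q, this]
        constructor <;> linarith
  have hqc : Continuous q := by
    have hmc : Continuous m := by fun_prop
    have : Continuous fun x => (m x)⁻¹ := hmc.inv₀ fun x => by linarith [hm x]
    fun_prop
  have hqS : ∀ x s, ‖x‖ = 1 → s ∈ Icc (0 : ℝ) 1 → q (((1 + s) / 2) • x) = (x, s) := by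
    intro x s hx hs
    have h1 : ‖((1 + s) / 2) • x‖ = (1 + s) / 2 := by
      rw [norm_smul, hx, mul_one, Real.norm_of_nonneg (by linarith [hs.1])]
    have : m (((1 + s) / 2) • x) = (1 + s) / 2 := by
      simp only [m, h1]; exact max_eq_left (by linarith [hs.1])
    simp only [q, this]
    rw [smul_smul, inv_mul_cancel₀ (by linarith [hs.1]), one_smul, Prod.mk.injEq]
    exact ⟨rfl, by ring⟩
  have hqS1 : ∀ x, ‖x‖ = 1 → q x = (x, 1) := by
    intro x hx
    have := hqS x 1 hx ⟨zero_le_one, le_rfl⟩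
    norm_num at this
    exact this
  obtain ⟨g, K, -, hgZ, -, hK, hKW, hK0, hK1, hKS⟩ := hZW (M ∘ q)
    (hM.comp hqc.continuousOn hq) (hMW.comp hq) (fun x hx => by
      rw [Function.comp, hqS1 x hx]; exact hMZ x hx)
  -- `θ` is chosen such that on the cup it is an inverse of `q`, placed at time 0, while a point (x,
  -- 1) of the top goes to time 1 if ‖x‖ ≤ 1/2 and to the sphere if ‖x‖ ≥ 1/2. In both cases `K` has
  -- values in `Z`: it ends there, and it is constant on the sphere.
  let a : E × ℝ → ℝ := fun z => max (1 + z.2) ((1 + 3 * z.2) * ‖z.1‖)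
  have ha : ∀ z ∈ ballCyl E, 1 ≤ a z := fun z hz => le_max_of_le_left (by linarith [hz.2.1])
  let θ : E × ℝ → E × ℝ := fun z =>
    ((1 / 2 * (1 + 3 * z.2) * (1 + z.2) * (a z)⁻¹) • z.1, z.2 * min 1 (2 * (1 - ‖z.1‖)))
  have hθn : ∀ z ∈ ballCyl E, ‖(θ z).1‖ = 1 / 2 * (1 + z.2) * ((1 + 3 * z.2) * ‖z.1‖ / a z) := by
    intro z hz
    have h0 := hz.2.1
    have h1 := ha z hz
    simp only [θ]
    rw [norm_smul, Real.norm_of_nonneg (by positivity)]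
    field_simp
  have hθ : MapsTo θ (ballCyl E) (ballCyl E) := by
    intro z hz
    have h0 := hz.2.1
    have h1 := ha z hz
    refine ⟨?_, ?_, ?_⟩
    · rw [hθn z hz]
      have h2 : (1 + 3 * z.2) * ‖z.1‖ / a z ≤ 1 := by
        rw [div_le_one (by linarith)]
        exact le_max_right _ _
      have h3 : 0 ≤ (1 + 3 * z.2) * ‖z.1‖ / a z := by positivity
      have h4 : 1 / 2 * (1 + z.2) ≤ 1 := by linarith [hz.2.2]
      have h5 : 0 ≤ 1 / 2 * (1 + z.2) := by linarith
      nlinarith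
    · exact mul_nonneg h0 (le_min zero_le_one (by linarith [hz.1]))
    · exact mul_le_one₀ hz.2.2 (le_min zero_le_one (by linarith [hz.1])) (min_le_left _ _)
  have hθc : ContinuousOn θ (ballCyl E) := by
    have hac : Continuous a := by fun_prop
    have : ContinuousOn (fun z => (a z)⁻¹) (ballCyl E) :=
      hac.continuousOn.inv₀ fun z hz => by linarith [ha z hz]
    fun_prop
  refine ⟨K ∘ θ, hK.comp hθc hθ, ?_, hKW.comp hθ, ?_⟩
  · rintro ⟨x, s⟩ (⟨hx, hs⟩ | ⟨hx, hs⟩)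
    · obtain rfl : s = 0 := hs
      have h1 : θ (x, 0) = ((1 / 2 : ℝ) • x, 0) := by
        have : a (x, 0) = 1 := by
          have hx' : ‖x‖ ≤ 1 := hx
          simp [a, hx']
        simp [θ, this]
      have h2 : ‖(1 / 2 : ℝ) • x‖ ≤ 1 / 2 := by
        have hx' : ‖x‖ ≤ 1 := hx
        rw [norm_smul, Real.norm_of_nonneg (by norm_num)]; linarith
      simp only [Function.comp, h1]
      rw [hK0 _ (by linarith)]
      have : m ((1 / 2 : ℝ) • x) = 1 / 2 := max_eq_right h2
      simp only [Function.comp, q, this, smul_smul]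
      norm_num
    · have hx' : ‖x‖ = 1 := hx
      have hs' : s ∈ Icc (0 : ℝ) 1 := hs
      have h1 : θ (x, s) = (((1 + s) / 2) • x, 0) := by
        have h4 : a (x, s) = 1 + 3 * s := by
          simp only [a, hx', mul_one]
          exact max_eq_right (by linarith [hs'.1])
        have h5 : 1 + 3 * s ≠ 0 := by linarith [hs'.1]
        simp only [θ, h4, hx', Prod.mk.injEq]
        refine ⟨?_, by norm_num⟩
        congr 1
        field_simp
      simp only [Function.comp, h1]
      rw [hK0 _ ?_]
      · simp only [Function.comp, hqS x s hx' hs']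
      · rw [norm_smul, hx', Real.norm_of_nonneg (by linarith [hs'.1])]
        linarith [hs'.2]
  · intro x hx
    have hmem : (x, (1 : ℝ)) ∈ ballCyl E := ⟨hx, zero_le_one, le_rfl⟩
    rcases le_total ‖x‖ (1 / 2) with h | h
    · have h1 : (θ (x, 1)).2 = 1 := by
        simp only [θ]
        rw [min_eq_left (by linarith), one_mul]
      have h2 : θ (x, 1) = ((θ (x, 1)).1, 1) := Prod.ext rfl h1
      have h3 := (hθ hmem).1
      rw [Function.comp, h2, hK1 _ h3]
      exact hgZ (by simpa using h3)
    · have h1 : ‖(θ (x, 1)).1‖ = 1 := by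
        rw [hθn _ hmem]
        have : a (x, 1) = 4 * ‖x‖ := by
          simp only [a]
          rw [max_eq_right (by linarith)]
          norm_num
        rw [this]
        norm_num
        exact norm_pos_iff.1 (by linarith)
      have h2 : θ (x, 1) = ((θ (x, 1)).1, (θ (x, 1)).2) := rfl
      rw [Function.comp, h2, hKS _ _ h1 (hθ hmem).2, Function.comp, hqS1 _ h1]
      exact hMZ _ h1

end Ball

/-! ### The unit ball of the supremum norm as a cube -/

section Cube

open unitInterval

variable {n : ℕ}

/-- The affine map from the unit interval to `[-1, 1]`, in each coordinate. -/
def ofCube {ι : Type*} (y : ι → I) : ι → ℝ := fun i => 2 * (y i : ℝ) - 1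

/-- The affine retraction of the line onto the unit interval that sends `[-1, 1]` onto it, in each
coordinate. -/
def toCube {ι : Type*} (x : ι → ℝ) : ι → I := fun i => projIcc 0 1 zero_le_one ((x i + 1) / 2)

theorem continuous_ofCube {ι : Type*} : Continuous (ofCube : (ι → I) → ι → ℝ) := by
  unfold ofCube; fun_prop

theorem continuous_toCube {ι : Type*} : Continuous (toCube : (ι → ℝ) → ι → I) := by
  unfold toCube
  exact continuous_pi fun i => continuous_projIcc.comp (by fun_prop)

theorem toCube_ofCube {ι : Type*} (y : ι → I) : toCube (ofCube y) = y := by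
  funext i
  simp [toCube, ofCube]

theorem coe_projIcc_half {a : ℝ} (ha : |a| ≤ 1) :
    (projIcc (0 : ℝ) 1 zero_le_one ((a + 1) / 2) : ℝ) = (a + 1) / 2 := by
  rw [abs_le] at ha
  rw [projIcc_of_mem zero_le_one ⟨by linarith [ha.1], by linarith [ha.2]⟩]

variable {ι : Type*} [Fintype ι]

theorem norm_apply_le {x : ι → ℝ} (hx : ‖x‖ ≤ 1) (i : ι) : |x i| ≤ 1 := (norm_le_pi_norm x i).trans hx

theorem ofCube_toCube {x : ι → ℝ} (hx : ‖x‖ ≤ 1) : ofCube (toCube x) = x := by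
  funext i
  simp only [ofCube, toCube]
  rw [coe_projIcc_half (norm_apply_le hx i)]
  ring

theorem norm_ofCube_le (y : ι → I) : ‖ofCube y‖ ≤ 1 := by
  rw [pi_norm_le_iff_of_nonneg zero_le_one]
  intro i
  rw [Real.norm_eq_abs, abs_le]
  constructor <;> simp only [ofCube] <;> linarith [(y i).2.1, (y i).2.2]

theorem exists_abs_eq_one {x : ι → ℝ} (hx : ‖x‖ = 1) : ∃ i, |x i| = 1 := by
  by_contra! h
  have : ‖x‖ < 1 := (pi_norm_lt_iff zero_lt_one).2 fun i => lt_of_le_of_ne (norm_apply_le hx.le i) (h i)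
  exact this.ne hx

theorem norm_eq_one_of_abs_eq_one {x : ι → ℝ} (hx : ‖x‖ ≤ 1) {i : ι} (hi : |x i| = 1) : ‖x‖ = 1 :=
  le_antisymm hx (hi ▸ norm_le_pi_norm x i)

theorem norm_ofCube_eq_one {y : ι → I} : ‖ofCube y‖ = 1 ↔ y ∈ Cube.boundary ι := by
  have key : ∀ i, |ofCube y i| = 1 ↔ y i = 0 ∨ y i = 1 := by
    intro i
    rw [abs_eq zero_le_one, or_comm, Subtype.ext_iff, Subtype.ext_iff]
    simp only [ofCube, Set.Icc.coe_zero, Set.Icc.coe_one]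
    constructor <;> rintro (h | h)
    · left; linarith
    · right; linarith
    · left; linarith
    · right; linarith
  constructor
  · intro h
    obtain ⟨i, hi⟩ := exists_abs_eq_one h
    exact ⟨i, (key i).1 hi⟩
  · rintro ⟨i, hi⟩
    exact norm_eq_one_of_abs_eq_one (norm_ofCube_le y) ((key i).2 hi)

theorem toCube_mem_boundary {x : ι → ℝ} (hx : ‖x‖ = 1) : toCube x ∈ Cube.boundary ι := by
  rw [← norm_ofCube_eq_one, ofCube_toCube hx.le, hx]

end Cube

/-! ### Compressions on cubes and homotopy groups. -/

section WeakEquiv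

open unitInterval

variable {A C : Type*} [TopologicalSpace A] [TopologicalSpace C] {n : ℕ}

theorem GenLoop.exists_of_continuousOn {ι : Type*} [Fintype ι] {f : (ι → ℝ) → C} {c : C}
    (hf : ContinuousOn f (closedBall 0 1)) (hc : ∀ x, ‖x‖ = 1 → f x = c) :
    ∃ γ : GenLoop ι C c, ∀ y, γ.1 y = f (ofCube y) :=
  ⟨⟨⟨fun y => f (ofCube y), hf.comp_continuous continuous_ofCube fun y => by
    simpa using norm_ofCube_le y⟩, fun y hy => hc _ (norm_ofCube_eq_one.2 hy)⟩, fun _ => rfl⟩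

/-- A homotopy between generalized loops, as a map on the cylinder. -/
theorem GenLoop.Homotopic.of_continuousOn {ι : Type*} [Fintype ι] {c : C} {γ γ' : GenLoop ι C c}
    {H : (ι → ℝ) × ℝ → C} (hH : ContinuousOn H (ballCyl (ι → ℝ)))
    (h0 : ∀ y, H (ofCube y, 0) = γ.1 y) (h1 : ∀ y, H (ofCube y, 1) = γ'.1 y)
    (hS : ∀ x s, ‖x‖ = 1 → s ∈ Icc (0 : ℝ) 1 → H (x, s) = c) : GenLoop.Homotopic γ γ' := by
  refine ⟨⟨⟨⟨fun z => H (ofCube z.2, z.1), ?_⟩, fun y => by simpa using h0 y,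
    fun y => by simpa using h1 y⟩, fun s y hy => ?_⟩⟩
  · exact hH.comp_continuous ((continuous_ofCube.comp continuous_snd).prodMk
      (continuous_subtype_val.comp continuous_fst)) fun z => ⟨norm_ofCube_le _, z.1.2⟩
  · exact (hS _ _ (norm_ofCube_eq_one.2 hy) s.2).trans (γ.2 y hy).symm

theorem abs_eq_one_of_norm_fin_one {x : Fin 1 → ℝ} (hx : ‖x‖ = 1) : |x 0| = 1 := by
  obtain ⟨i, hi⟩ := exists_abs_eq_one hx
  rwa [Subsingleton.elim i 0] at hi

/-- A map along which all maps of pairs from balls and spheres can be compressed is a weak homotopy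
equivalence. -/
theorem IsWeakHomotopyEquiv.of_hasCompression {φ : C(A, C)} (hne : Nonempty C → Nonempty A)
    (hc : ∀ (n : ℕ) (g : (Fin n → ℝ) → A) (h : (Fin n → ℝ) → C), ContinuousOn g (sphere 0 1) →
      ContinuousOn h (closedBall 0 1) → (∀ x, ‖x‖ = 1 → φ (g x) = h x) →
      HasCompression φ univ univ g h) : IsWeakHomotopyEquiv φ where
  bijective_zeroth := by
    constructor
    · intro a b
      induction a using Quotient.inductionOn with | _ a
      induction b using Quotient.inductionOn with | _ b
      intro hab
      obtain ⟨γ⟩ : Joined (φ a) (φ b) := Quotient.exact hab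
      refine Quotient.sound ?_
      -- A path between φ(a) and φ(b) is a map of the 1-ball whose restriction to the two end points
      -- has the lift a, b; the compressed lift is a path from a to b.
      obtain ⟨g', -, hg', -, hgg', -⟩ := hc 1 (fun x => if x 0 ≤ 0 then a else b)
        (fun x => γ.extend ((x 0 + 1) / 2))
        (continuousOn_ite_le (by fun_prop) (by fun_prop) continuousOn_const continuousOn_const
          fun x hx h0 => by
            have := abs_eq_one_of_norm_fin_one (by simpa using hx)
            norm_num [h0] at this)
        (γ.continuous_extend.comp (by fun_prop)).continuousOn fun x hx => by
          have := abs_eq_one_of_norm_fin_one hx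
          rcases eq_or_eq_neg_of_abs_eq this with h | h <;> norm_num [h]
      have h1 : ∀ c : ℝ, ‖(fun _ => c : Fin 1 → ℝ)‖ = |c| := fun c => by
        rw [pi_norm_const, Real.norm_eq_abs]
      refine ⟨⟨⟨fun t : I => g' (fun _ => 2 * (t : ℝ) - 1), ?_⟩, ?_, ?_⟩⟩
      · refine hg'.comp_continuous (by fun_prop) fun t => ?_
        rw [mem_closedBall_zero_iff, h1, abs_le]
        constructor <;> linarith [t.2.1, t.2.2]
      · have := hgg' (fun _ => -1) (by rw [h1]; norm_num)
        simpa using this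
      · have := hgg' (fun _ => 1) (by rw [h1]; norm_num)
        norm_num at this ⊢
        exact this
    · intro c
      induction c using Quotient.inductionOn with | _ c
      obtain ⟨a⟩ := hne ⟨c⟩
      -- The 0-ball is a point of norm 0 and its sphere is empty, so the map on the sphere is
      -- irrelevant; the homotopy is a path from c into the image.
      obtain ⟨g', H, -, -, -, hH, -, hH0, hH1, -⟩ := hc 0 (fun _ => a) (fun _ => c)
        continuousOn_const continuousOn_const fun x hx => by
          rw [Subsingleton.elim x 0, norm_zero] at hx
          norm_num at hx
      have h00 : ‖(0 : Fin 0 → ℝ)‖ ≤ 1 := norm_zero.trans_le zero_le_one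
      refine ⟨Quotient.mk _ (g' 0), Quotient.sound (Joined.symm ⟨⟨⟨fun t : I => H (0, t), ?_⟩,
        ?_, ?_⟩⟩)⟩
      · exact hH.comp_continuous (by fun_prop) fun t => ⟨h00, t.2⟩
      · simpa using hH0 0 h00
      · simpa using hH1 0 h00
  bijective_pi n hn a := by
    constructor
    · intro γ₀ γ₁
      induction γ₀ using Quotient.inductionOn with | _ γ₀
      induction γ₁ using Quotient.inductionOn with | _ γ₁
      intro hγ
      obtain ⟨F⟩ := Quotient.exact hγ
      refine Quotient.sound ?_
      have htail : ∀ x : Fin (n + 1) → ℝ, ‖x‖ ≤ 1 → ‖Fin.tail x‖ ≤ 1 := fun x hx => by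
        rw [pi_norm_le_iff_of_nonneg zero_le_one]
        exact fun i => norm_apply_le hx i.succ
      have htail1 : ∀ x : Fin (n + 1) → ℝ, ‖x‖ = 1 → |x 0| ≠ 1 → ‖Fin.tail x‖ = 1 := by
        intro x hx h0
        obtain ⟨i, hi⟩ := exists_abs_eq_one hx
        rcases Fin.eq_zero_or_eq_succ i with rfl | ⟨j, rfl⟩
        · exact absurd hi h0
        · exact norm_eq_one_of_abs_eq_one (htail x hx.le) hi
      have htc : Continuous (Fin.tail : (Fin (n + 1) → ℝ) → Fin n → ℝ) :=
        continuous_pi fun i => continuous_apply _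
      -- The homotopy is a map of the (n + 1)-ball with a lift on its sphere: γ₀ and γ₁ on the faces
      -- x₀ = -1 and x₀ = 1, the base point on the other faces. The case distinction at x₀ = 0 is
      -- harmless, since there a point of the sphere lies on one of the other faces. The lift on the
      -- whole ball is the homotopy sought.
      obtain ⟨g', -, hg', -, hgg', -⟩ := hc (n + 1)
        (fun x => if x 0 ≤ 0 then γ₀.1 (toCube (Fin.tail x)) else γ₁.1 (toCube (Fin.tail x)))
        (fun x => F (projIcc 0 1 zero_le_one ((x 0 + 1) / 2), toCube (Fin.tail x))) (by
          refine continuousOn_ite_le (by fun_prop) (by fun_prop)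
            (γ₀.1.continuous.comp (continuous_toCube.comp htc)).continuousOn
            (γ₁.1.continuous.comp (continuous_toCube.comp htc)).continuousOn fun x hx h0 => ?_
          have := toCube_mem_boundary (htail1 x (by simpa using hx) (by simp [h0]))
          rw [γ₀.2 _ this, γ₁.2 _ this])
        (F.continuous.comp ((continuous_projIcc.comp (by fun_prop)).prodMk
          (continuous_toCube.comp htc))).continuousOn (by
          intro x hx
          by_cases h0 : |x 0| = 1
          · rcases eq_or_eq_neg_of_abs_eq h0 with h | h
            · norm_num [h]
            · norm_num [h]
          · have hb := toCube_mem_boundary (htail1 x hx h0)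
            refine Eq.trans ?_ (F.eq_fst _ hb).symm
            change φ _ = φ (γ₀.1 _)
            rw [γ₁.2 _ hb, γ₀.2 _ hb, ite_self])
      have hcons : ∀ z ∈ ballCyl (Fin n → ℝ), ‖(Fin.cons (2 * z.2 - 1) z.1 : Fin (n + 1) → ℝ)‖ ≤ 1 := by
        intro z hz
        rw [pi_norm_le_iff_of_nonneg zero_le_one]
        refine Fin.cases ?_ fun i => ?_
        · rw [Fin.cons_zero, Real.norm_eq_abs, abs_le]
          constructor <;> linarith [hz.2.1, hz.2.2]
        · rw [Fin.cons_succ]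
          exact norm_apply_le hz.1 i
      have hconsc : Continuous fun z : (Fin n → ℝ) × ℝ =>
          (Fin.cons (2 * z.2 - 1) z.1 : Fin (n + 1) → ℝ) := by
        refine continuous_pi (Fin.cases ?_ fun i => ?_)
        · simp only [Fin.cons_zero]; fun_prop
        · simp only [Fin.cons_succ]; fun_prop
      refine GenLoop.Homotopic.of_continuousOn (H := fun z => g' (Fin.cons (2 * z.2 - 1) z.1))
        (hg'.comp hconsc.continuousOn fun z hz => by simpa using hcons z hz) ?_ ?_ ?_
      · intro y
        rw [hgg' _ (norm_eq_one_of_abs_eq_one (i := 0)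
          (hcons (ofCube y, 0) ⟨norm_ofCube_le y, by simp⟩) (by norm_num))]
        norm_num [toCube_ofCube]
      · intro y
        rw [hgg' _ (norm_eq_one_of_abs_eq_one (i := 0)
          (hcons (ofCube y, 1) ⟨norm_ofCube_le y, by simp⟩) (by norm_num))]
        norm_num [toCube_ofCube]
      · intro x s hx hs
        obtain ⟨i, hi⟩ := exists_abs_eq_one hx
        rw [hgg' _ (norm_eq_one_of_abs_eq_one (i := i.succ)
          (hcons (x, s) ⟨hx.le, hs⟩) (by simpa using hi))]
        have hb := toCube_mem_boundary hx
        simp only [Fin.tail_cons]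
        rw [γ₀.2 _ hb, γ₁.2 _ hb, ite_self]
    · intro γ
      induction γ using Quotient.inductionOn with | _ γ
      -- The boundary of a loop lifts to the constant map at `a`, so the compressed map is a loop in
      -- the source.
      obtain ⟨g', H, hg', -, hgg', hH, -, hH0, hH1, hHS⟩ := hc n (fun _ => a)
        (fun x => γ.1 (toCube x)) continuousOn_const
        (γ.1.continuous.comp continuous_toCube).continuousOn
        fun x hx => (γ.2 _ (toCube_mem_boundary hx)).symm
      obtain ⟨γ', hγ'⟩ := GenLoop.exists_of_continuousOn hg' hgg'
      refine ⟨Quotient.mk _ γ', Quotient.sound (GenLoop.Homotopic.symm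
        (GenLoop.Homotopic.of_continuousOn hH (fun y => ?_) (fun y => ?_) fun x s hx hs => ?_))⟩
      · rw [hH0 _ (norm_ofCube_le y)]
        simp only [toCube_ofCube]
      · rw [hH1 _ (norm_ofCube_le y), ← hγ']
        rfl
      · exact (hHS x s hx hs).trans (γ.2 _ (toCube_mem_boundary hx))

theorem IsWeakHomotopyEquiv.nonempty {φ : C(A, C)} (hφ : IsWeakHomotopyEquiv φ) (hC : Nonempty C) :
    Nonempty A := by
  obtain ⟨c⟩ := hC
  obtain ⟨a, -⟩ := hφ.bijective_zeroth.2 (Quotient.mk _ c)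
  exact a.exists_rep.nonempty

/-- Here `h` is a loop at φ(a), and surjectivity on π_n provides the compression. The general case
reduces to this one by homotopy extension. -/
theorem IsWeakHomotopyEquiv.hasCompression_const {φ : C(A, C)} (hφ : IsWeakHomotopyEquiv φ)
    (hn : 1 ≤ n) (a : A) {h : (Fin n → ℝ) → C} (hh : ContinuousOn h (closedBall 0 1))
    (hS : ∀ x, ‖x‖ = 1 → h x = φ a) : HasCompression φ univ univ (fun _ => a) h := by
  obtain ⟨γ, hγ⟩ := GenLoop.exists_of_continuousOn hh hS
  obtain ⟨γ', hγ'⟩ := (hφ.bijective_pi n hn a).2 (Quotient.mk _ γ)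
  induction γ' using Quotient.inductionOn with | _ γ'
  obtain ⟨F⟩ := GenLoop.Homotopic.symm (Quotient.exact hγ')
  refine ⟨fun x => γ'.1 (toCube x), fun z => F (projIcc 0 1 zero_le_one z.2, toCube z.1),
    (γ'.1.continuous.comp continuous_toCube).continuousOn, fun _ _ => trivial,
    fun x hx => γ'.2 _ (toCube_mem_boundary hx), ?_, fun _ _ => trivial, ?_, ?_, ?_⟩
  · exact (F.continuous.comp ((continuous_projIcc.comp continuous_snd).prodMk
      (continuous_toCube.comp continuous_fst))).continuousOn
  · intro x hx
    simp only [projIcc_left]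
    refine (F.apply_zero _).trans ?_
    rw [hγ, ofCube_toCube hx]
  · intro x hx
    simp only [projIcc_right]
    exact F.apply_one _
  · intro x s hx hs
    refine (F.eq_fst _ (toCube_mem_boundary hx)).trans ?_
    rw [hγ, ofCube_toCube hx.le]

end WeakEquiv

/-! ### Weak homotopy equivalences have compressions -/

section CollapseBoundary

variable {m : ℕ}

/-- A vector in the direction of the image of `y` under the map from the ball to the sphere that
collapses the boundary of the ball. -/
def collapseVec (y : Fin m → ℝ) : Fin (m + 1) → ℝ := Fin.cons (2 * ‖y‖ - 1) ((1 - ‖y‖) • y)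

/-- The map from the ball to the sphere that collapses the boundary of the ball. -/
def collapseBoundary (y : Fin m → ℝ) : Fin (m + 1) → ℝ := (‖collapseVec y‖)⁻¹ • collapseVec y

theorem collapseVec_zero (y : Fin m → ℝ) : collapseVec y 0 = 2 * ‖y‖ - 1 := rfl

theorem collapseVec_succ (y : Fin m → ℝ) (i : Fin m) : collapseVec y i.succ = (1 - ‖y‖) * y i := rfl

theorem tail_collapseVec (y : Fin m → ℝ) : Fin.tail (collapseVec y) = (1 - ‖y‖) • y := rfl

theorem collapseVec_ne_zero (y : Fin m → ℝ) : collapseVec y ≠ 0 := by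
  intro h
  have h0 := congrFun h 0
  rw [collapseVec_zero, Pi.zero_apply] at h0
  have h1 : (1 - ‖y‖) • y = 0 := by
    rw [← tail_collapseVec, h]; rfl
  rcases smul_eq_zero.1 h1 with h2 | h2
  · linarith
  · rw [h2, norm_zero] at h0; norm_num at h0

theorem norm_collapseBoundary (y : Fin m → ℝ) : ‖collapseBoundary y‖ = 1 :=
  norm_div_norm (collapseVec_ne_zero y)

theorem continuous_collapseBoundary :
    Continuous (collapseBoundary : (Fin m → ℝ) → Fin (m + 1) → ℝ) := by
  have h : Continuous (collapseVec : (Fin m → ℝ) → Fin (m + 1) → ℝ) := by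
    refine continuous_pi (Fin.cases ?_ fun i => ?_)
    · simp only [collapseVec_zero]; fun_prop
    · simp only [collapseVec_succ]; fun_prop
  exact (h.norm.inv₀ fun y => norm_ne_zero_iff.2 (collapseVec_ne_zero y)).smul h

theorem collapseBoundary_of_norm_eq_one {y : Fin m → ℝ} (hy : ‖y‖ = 1) :
    collapseBoundary y = Fin.cons 1 0 := by
  have h : collapseVec y = Fin.cons 1 0 := by
    rw [collapseVec, hy]; norm_num
  have h1 : ‖(Fin.cons 1 0 : Fin (m + 1) → ℝ)‖ = 1 := by
    refine norm_eq_one_of_abs_eq_one (i := 0) ?_ (by simp)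
    rw [pi_norm_le_iff_of_nonneg zero_le_one]
    exact Fin.cases (by simp) fun i => by simp
  rw [collapseBoundary, h, h1, inv_one, one_smul]

/-- The two vectors lie on one ray. Comparing first coordinates and norms of the tails shows that
either the radii agree or they are 0 and 1; the latter is excluded because 2r - 1 then has opposite
signs. With equal radii in (0, 1) the ratio is 1. -/
theorem collapseBoundary_eq_iff {y y' : Fin m → ℝ} (hy : ‖y‖ ≤ 1) (hy' : ‖y'‖ ≤ 1)
    (h : collapseBoundary y = collapseBoundary y') : y = y' ∨ ‖y‖ = 1 ∧ ‖y'‖ = 1 := by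
  have hp : ∀ y : Fin m → ℝ, 0 < ‖collapseVec y‖ := fun y => norm_pos_iff.2 (collapseVec_ne_zero y)
  obtain ⟨c, hc, hv⟩ : ∃ c : ℝ, 0 < c ∧ collapseVec y = c • collapseVec y' := by
    refine ⟨‖collapseVec y‖ * ‖collapseVec y'‖⁻¹, mul_pos (hp y) (inv_pos.2 (hp y')), ?_⟩
    have := congrArg (‖collapseVec y‖ • ·) h
    simp only [collapseBoundary] at this
    rw [smul_inv_smul₀ (hp y).ne'] at this
    rwa [smul_smul] at this
  have h0 : 2 * ‖y‖ - 1 = c * (2 * ‖y'‖ - 1) := congrFun hv 0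
  have ht : (1 - ‖y‖) • y = c • (1 - ‖y'‖) • y' := by
    rw [← tail_collapseVec, hv]; rfl
  have hn : (1 - ‖y‖) * ‖y‖ = c * ((1 - ‖y'‖) * ‖y'‖) := by
    have := congrArg norm ht
    rwa [norm_smul, norm_smul, norm_smul, Real.norm_of_nonneg (by linarith),
      Real.norm_of_nonneg hc.le, Real.norm_of_nonneg (by linarith)] at this
  have hr0 := norm_nonneg y
  have hr0' := norm_nonneg y'
  generalize hr : ‖y‖ = r at *
  generalize hr' : ‖y'‖ = r' at *
  -- Elimination of `c` from `h0` and `hn`. The second factor is a sum of nonnegative terms.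
  have key : (r' - r) * ((1 - r) * (1 - r') + r * r') = 0 := by
    have : (1 - r) * r * (c * (2 * r' - 1)) = c * ((1 - r') * r') * (2 * r - 1) := by
      rw [← hn, ← h0]
    have h2 : c * ((r' - r) * ((1 - r) * (1 - r') + r * r')) = 0 := by linear_combination this
    exact (mul_eq_zero.1 h2).resolve_left hc.ne'
  have hrr : r = r' := by
    rcases mul_eq_zero.1 key with h1 | h1
    · linarith
    · have a1 : 0 ≤ (1 - r) * (1 - r') := mul_nonneg (by linarith) (by linarith)
      have a2 : 0 ≤ r * r' := mul_nonneg hr0 hr0'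
      have a3 : (1 - r) * (1 - r') = 0 := by linarith
      have a4 : r * r' = 0 := by linarith
      rcases mul_eq_zero.1 a3 with b | b <;> rcases mul_eq_zero.1 a4 with b' | b'
      · linarith
      · have : r = 1 := by linarith
        subst b' this
        nlinarith
      · have : r' = 1 := by linarith
        subst b' this
        nlinarith
      · linarith
  subst hrr
  by_cases h1 : r = 1
  · exact Or.inr ⟨h1, h1⟩
  left
  by_cases h2 : r = 0
  · rw [norm_eq_zero.1 (hr.trans h2), norm_eq_zero.1 (hr'.trans h2)]
  have h3 : 0 < (1 - r) * r :=
    mul_pos (sub_pos.2 (lt_of_le_of_ne hy h1)) (lt_of_le_of_ne hr0 (Ne.symm h2))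
  have hc1 : c = 1 := by
    have : (c - 1) * ((1 - r) * r) = 0 := by linarith
    linarith [(mul_eq_zero.1 this).resolve_right h3.ne']
  rw [hc1, one_smul] at ht
  exact smul_right_injective _ (sub_ne_zero.2 (Ne.symm h1)) ht

/-- The radius of a preimage comes from the intermediate value theorem, its direction from the tail
of `x`. For m = 0 the pole with first coordinate 1 would be missed, as there is no vector of norm 1
to collapse. -/
theorem exists_collapseBoundary_eq (hm : 1 ≤ m) {x : Fin (m + 1) → ℝ} (hx : ‖x‖ = 1) :
    ∃ y : Fin m → ℝ, ‖y‖ ≤ 1 ∧ collapseBoundary y = x := by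
  by_cases hz : Fin.tail x = 0
  · have hx0 : |x 0| = 1 := by
      obtain ⟨i, hi⟩ := exists_abs_eq_one hx
      rcases Fin.eq_zero_or_eq_succ i with rfl | ⟨j, rfl⟩
      · exact hi
      · have : x j.succ = 0 := congrFun hz j
        norm_num [this] at hi
    have hxc : x = Fin.cons (x 0) 0 := by rw [← hz, Fin.cons_self_tail]
    rcases eq_or_eq_neg_of_abs_eq hx0 with h | h
    · have : Nonempty (Fin m) := ⟨⟨0, hm⟩⟩
      have h1 : ‖(fun _ => 1 : Fin m → ℝ)‖ = 1 := by rw [pi_norm_const]; norm_num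
      exact ⟨fun _ => 1, h1.le, by rw [collapseBoundary_of_norm_eq_one h1, hxc, h]⟩
    · refine ⟨0, by simp, ?_⟩
      have h1 : collapseVec (0 : Fin m → ℝ) = x := by
        rw [hxc, h]; simp [collapseVec]
      rw [collapseBoundary, h1, hx, inv_one, one_smul]
  · set z := Fin.tail x
    have hz0 : 0 < ‖z‖ := norm_pos_iff.2 hz
    -- A zero r of `f` is a radius at which 2r - 1 and r(1 - r) are in the ratio of x₀ to ‖z‖.
    let f : ℝ → ℝ := fun r => r * (1 - r) * x 0 - (2 * r - 1) * ‖z‖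
    have hf : ContinuousOn f (Icc 0 1) := by fun_prop
    obtain ⟨r, hr, hfr⟩ := intermediate_value_Icc' zero_le_one hf
      (show (0 : ℝ) ∈ Icc (f 1) (f 0) by constructor <;> simp only [f] <;> nlinarith)
    have hr0 : r ≠ 0 := by
      rintro rfl; simp only [f] at hfr; nlinarith
    have hr1 : r ≠ 1 := by
      rintro rfl; simp only [f] at hfr; nlinarith
    have hrp : 0 < r := lt_of_le_of_ne hr.1 hr0.symm
    have hrl : r < 1 := lt_of_le_of_ne hr.2 hr1
    have hn : ‖(r / ‖z‖) • z‖ = r := by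
      rw [norm_smul, Real.norm_of_nonneg (by positivity), div_mul_cancel₀ _ hz0.ne']
    have hc : 0 < r * (1 - r) / ‖z‖ := div_pos (mul_pos hrp (by linarith)) hz0
    have hv : collapseVec ((r / ‖z‖) • z) = (r * (1 - r) / ‖z‖) • x := by
      funext i
      refine Fin.cases ?_ (fun j => ?_) i
      · rw [collapseVec_zero, hn, Pi.smul_apply, smul_eq_mul]
        simp only [f] at hfr
        field_simp
        linarith
      · rw [collapseVec_succ, hn, Pi.smul_apply, Pi.smul_apply, smul_eq_mul, smul_eq_mul]
        simp only [z, Fin.tail]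
        ring
    refine ⟨(r / ‖z‖) • z, hn.trans_le hr.2, ?_⟩
    rw [collapseBoundary, hv, norm_smul, hx, mul_one, Real.norm_of_nonneg hc.le,
      inv_smul_smul₀ hc.ne']

end CollapseBoundary

/-! ### From bijections on homotopy groups to compressions. -/

section WeakEquiv

open unitInterval

variable {A C : Type*} [TopologicalSpace A] [TopologicalSpace C]

/-- A map from the sphere whose composite with a weak homotopy equivalence is null-homotopic is
null-homotopic. -/
theorem IsWeakHomotopyEquiv.exists_nullhomotopy {φ : C(A, C)} (hφ : IsWeakHomotopyEquiv φ) {m : ℕ}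
    {g : (Fin (m + 1) → ℝ) → A} {h : (Fin (m + 1) → ℝ) → C} (hg : ContinuousOn g (sphere 0 1))
    (hh : ContinuousOn h (closedBall 0 1)) (hgh : ∀ x, ‖x‖ = 1 → φ (g x) = h x) :
    ∃ (a : A) (G : (Fin (m + 1) → ℝ) × ℝ → A), ContinuousOn G (sphereCyl (Fin (m + 1) → ℝ)) ∧
      (∀ x, ‖x‖ = 1 → G (x, 0) = g x) ∧ ∀ x, ‖x‖ = 1 → G (x, 1) = a := by
  rcases Nat.eq_zero_or_pos m with rfl | hm
  · have h1 : ∀ c : ℝ, ‖(fun _ => c : Fin 1 → ℝ)‖ = |c| := fun c => by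
      rw [pi_norm_const, Real.norm_eq_abs]
    obtain ⟨γ⟩ : Joined (g fun _ => 1) (g fun _ => -1) := by
      refine Quotient.exact (hφ.bijective_zeroth.1 (Quotient.sound ⟨⟨⟨fun t : I =>
        h (fun _ => 1 - 2 * (t : ℝ)), ?_⟩, ?_, ?_⟩⟩))
      · refine hh.comp_continuous (by fun_prop) fun t => ?_
        rw [mem_closedBall_zero_iff, h1, abs_le]
        constructor <;> linarith [t.2.1, t.2.2]
      · have := hgh (fun _ => 1) (by rw [h1]; norm_num)
        simpa using this.symm
      · have := hgh (fun _ => -1) (by rw [h1]; norm_num)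
        norm_num
        exact this.symm
    have hx : ∀ x : Fin 1 → ℝ, ‖x‖ = 1 → (x = fun _ => 1) ∨ x = fun _ => -1 := fun x hx => by
      refine (eq_or_eq_neg_of_abs_eq (abs_eq_one_of_norm_fin_one hx)).imp ?_ ?_ <;>
      · intro h
        funext i
        rwa [Subsingleton.elim i 0]
    -- The sphere consists of 1 and -1. At 1 the maximum is the time, so the path is followed; at -1
    -- it is 1, so the end point is kept.
    refine ⟨g fun _ => -1, fun z => γ.extend (max z.2 ((1 - z.1 0) / 2)),
      (γ.continuous_extend.comp (by fun_prop)).continuousOn, fun x h => ?_, fun x h => ?_⟩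
    · rcases hx x h with rfl | rfl <;> norm_num
    · rcases hx x h with rfl | rfl <;> norm_num
  · have hq : MapsTo (collapseBoundary : (Fin m → ℝ) → _) (closedBall 0 1) (sphere 0 1) :=
      fun y _ => by simpa using norm_collapseBoundary y
    set p : Fin (m + 1) → ℝ := Fin.cons 1 0 with hp
    have hp1 : ∀ y : Fin m → ℝ, ‖y‖ = 1 → collapseBoundary y = p := fun y hy =>
      collapseBoundary_of_norm_eq_one hy
    obtain ⟨γ, hγ⟩ := GenLoop.exists_of_continuousOn
      (hg.comp continuous_collapseBoundary.continuousOn hq) (c := g p)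
      fun y hy => by rw [Function.comp, hp1 y hy]
    have hpn : ‖p‖ = 1 := by
      have : Nonempty (Fin m) := ⟨⟨0, hm⟩⟩
      rw [← hp1 (fun _ => 1) (by rw [pi_norm_const]; norm_num)]
      exact norm_collapseBoundary _
    have hconv : ∀ z ∈ ballCyl (Fin m → ℝ),
        (1 - z.2) • collapseBoundary z.1 + z.2 • p ∈ closedBall (0 : Fin (m + 1) → ℝ) 1 :=
      fun z hz => (convex_closedBall _ _) (by simp [norm_collapseBoundary]) (by simp [hpn])
        (by linarith [hz.2.2]) hz.2.1 (by ring)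
    -- After `φ` the loop bounds through `h`: contract the ball linearly to the point `p` of the
    -- sphere to which the boundary is collapsed. Injectivity on π_m brings the null-homotopy back
    -- to `A`.
    obtain ⟨F⟩ : GenLoop.Homotopic γ GenLoop.const := by
      refine Quotient.exact ((hφ.bijective_pi m hm (g p)).1 (Quotient.sound
        (GenLoop.Homotopic.of_continuousOn
          (H := fun z => h ((1 - z.2) • collapseBoundary z.1 + z.2 • p))
          (hh.comp ?_ hconv) ?_ ?_ ?_)))
      · have := continuous_collapseBoundary (m := m)
        fun_prop
      · intro y
        simp only [sub_zero, one_smul, zero_smul, add_zero]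
        rw [← hgh _ (norm_collapseBoundary _)]
        exact congrArg φ (hγ y).symm
      · intro y
        simp only [sub_self, zero_smul, one_smul, zero_add]
        rw [← hgh _ hpn]
        rfl
      · intro x s hx _
        simp only
        rw [hp1 x hx, ← add_smul, sub_add_cancel, one_smul, hgh _ hpn]
    -- A continuous surjection from a compact space to a Hausdorff space is a quotient map. Its only
    -- identifications are on the boundary of the cube, where `F` is constant, so `F` descends to
    -- the cylinder on the sphere.
    let Q : I × (Fin m → I) → sphereCyl (Fin (m + 1) → ℝ) := fun z =>
      ⟨(collapseBoundary (ofCube z.2), z.1), norm_collapseBoundary _, z.1.2⟩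
    have hQc : Continuous Q := Continuous.subtype_mk (((continuous_collapseBoundary.comp
      continuous_ofCube).comp continuous_snd).prodMk
        (continuous_subtype_val.comp continuous_fst)) _
    have hQs : Function.Surjective Q := by
      rintro ⟨⟨x, s⟩, hx, hs⟩
      obtain ⟨y, hy, hyx⟩ := exists_collapseBoundary_eq hm hx
      refine ⟨(⟨s, hs⟩, toCube y), Subtype.ext (Prod.ext ?_ rfl)⟩
      simpa only [Q, ofCube_toCube hy] using hyx
    have hQ := IsQuotientMap.of_surjective_continuous hQs hQc
    have hfac : Function.FactorsThrough F.toContinuousMap Q := by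
      rintro ⟨s, y⟩ ⟨s', y'⟩ hss
      have h1 := congrArg Subtype.val hss
      simp only [Q, Prod.mk.injEq] at h1
      obtain rfl : s = s' := Subtype.ext h1.2
      rcases collapseBoundary_eq_iff (norm_ofCube_le y) (norm_ofCube_le y') h1.1 with h2 | ⟨h2, h3⟩
      · rw [← toCube_ofCube y, h2, toCube_ofCube]
      · rw [norm_ofCube_eq_one] at h2 h3
        refine (F.eq_fst _ h2).trans (Eq.trans ?_ (F.eq_fst _ h3).symm)
        rw [γ.2 _ h2, γ.2 _ h3]
    let G' : C(sphereCyl (Fin (m + 1) → ℝ), A) :=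
      IsQuotientMap.lift (f := ⟨Q, hQc⟩) hQ F.toContinuousMap hfac
    have hG' : ∀ z, G' (Q z) = F z := fun z =>
      DFunLike.congr_fun (IsQuotientMap.lift_comp (f := ⟨Q, hQc⟩) hQ F.toContinuousMap hfac) z
    classical
    let G : (Fin (m + 1) → ℝ) × ℝ → A := fun z =>
      if hz : z ∈ sphereCyl (Fin (m + 1) → ℝ) then G' ⟨z, hz⟩ else g p
    have hG : ∀ (s : I) (y : Fin m → ℝ), ‖y‖ ≤ 1 → G (collapseBoundary y, s) = F (s, toCube y) := by
      intro s y hy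
      have hmem : (collapseBoundary y, (s : ℝ)) ∈ sphereCyl (Fin (m + 1) → ℝ) :=
        ⟨norm_collapseBoundary y, s.2⟩
      simp only [G, dif_pos hmem]
      rw [← hG']
      congr 1
      exact Subtype.ext (Prod.ext (by simp only [Q, ofCube_toCube hy]) rfl)
    refine ⟨g p, G, ?_, fun x hx => ?_, fun x hx => ?_⟩
    · rw [continuousOn_iff_continuous_domRestrict]
      convert! G'.continuous using 1
      funext z
      simp only [domRestrict_apply, G, dif_pos z.2]
    · obtain ⟨y, hy, rfl⟩ := exists_collapseBoundary_eq hm hx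
      refine (hG 0 y hy).trans ((F.apply_zero _).trans ?_)
      rw [hγ, ofCube_toCube hy]
      rfl
    · obtain ⟨y, hy, rfl⟩ := exists_collapseBoundary_eq hm hx
      exact (hG 1 y hy).trans (F.apply_one _)

/-- The map on the sphere is null-homotopic in `A` by injectivity. Extending the image of the
null-homotopy to the ball reduces the claim to a constant map on the sphere, which is surjectivity.
-/
theorem IsWeakHomotopyEquiv.hasCompression {φ : C(A, C)} (hφ : IsWeakHomotopyEquiv φ) {n : ℕ}
    {g : (Fin n → ℝ) → A} {h : (Fin n → ℝ) → C} (hg : ContinuousOn g (sphere 0 1))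
    (hh : ContinuousOn h (closedBall 0 1)) (hgh : ∀ x, ‖x‖ = 1 → φ (g x) = h x) :
    HasCompression φ univ univ g h := by
  cases n with
  | zero =>
    have hx : ∀ x : Fin 0 → ℝ, ‖x‖ ≠ 1 := fun x => by
      rw [Subsingleton.elim x 0, norm_zero]; norm_num
    obtain ⟨a, ha⟩ := hφ.bijective_zeroth.2 (Quotient.mk _ (h 0))
    induction a using Quotient.inductionOn with | _ a
    obtain ⟨γ⟩ := Joined.symm (Quotient.exact ha)
    refine ⟨fun _ => a, fun z => γ.extend z.2, continuousOn_const, fun _ _ => trivial,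
      fun x h => absurd h (hx x), (γ.continuous_extend.comp continuous_snd).continuousOn,
      fun _ _ => trivial, fun x _ => ?_, fun x _ => ?_, fun x _ h => absurd h (hx x)⟩
    · rw [Subsingleton.elim x 0]; simp
    · simp
  | succ m =>
    obtain ⟨a, G, hG, hG0, hG1⟩ := hφ.exists_nullhomotopy hg hh hgh
    obtain ⟨K, hK, -, hK0, hKG⟩ := exists_homotopy_extension (W := univ) hh (fun _ _ => trivial)
      (φ.continuous.comp_continuousOn hG) (fun _ _ => trivial) fun x hx => by
        rw [Function.comp, hG0 x hx, hgh x hx]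
    have hc : HasCompression φ univ univ (fun x => G (x, 1)) (fun x => K (x, 1)) := by
      obtain ⟨g', H, h1, h2, h3, h4⟩ := hφ.hasCompression_const (n := m + 1) (by omega) a
        (h := fun x => K (x, 1)) (hK.comp (by fun_prop) fun x hx => ⟨by simpa using hx, by simp⟩)
        fun x hx => by
          rw [hKG ⟨hx, by simp⟩, Function.comp, hG1 x hx]
      exact ⟨g', H, h1, h2, fun x hx => (h3 x hx).trans (hG1 x hx).symm, h4⟩
    obtain ⟨g', H, h1, h2, h3, h4, h5, h6, h7, h8⟩ := HasCompression.of_homotopy hG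
      (mapsTo_univ _ _) hK (mapsTo_univ _ _) (fun z hz => (hKG hz).symm) hc
    refine ⟨g', H, h1, h2, fun x hx => (h3 x hx).trans (hG0 x hx), h4, h5,
      fun x hx => (h6 x hx).trans (hK0 x hx), h7, fun x s hx hs =>
      (h8 x s hx hs).trans (hK0 x hx.le)⟩

end WeakEquiv

/-! ### Compressions of maps of pairs into a mapping cylinder -/

section Cylinder

variable {E : Type*} [NormedAddCommGroup E] [NormedSpace ℝ E]
variable {A C X Y : Type*} [TopologicalSpace A] [TopologicalSpace C] [TopologicalSpace X]
  [TopologicalSpace Y]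

omit [NormedSpace ℝ E] in
theorem HasCompression.congr {φ : A → C} {Z : Set A} {W : Set C} {g g' : E → A} {h h' : E → C}
    (H : HasCompression φ Z W g h) (hg : ∀ x, ‖x‖ = 1 → g x = g' x)
    (hh : ∀ x, ‖x‖ ≤ 1 → h x = h' x) : HasCompression φ Z W g' h' := by
  obtain ⟨k, K, h1, h2, h3, h4, h5, h6, h7, h8⟩ := H
  exact ⟨k, K, h1, h2, fun x hx => (h3 x hx).trans (hg x hx), h4, h5,
    fun x hx => (h6 x hx).trans (hh x hx), h7, fun x s hx hs => (h8 x s hx hs).trans (hh x hx.le)⟩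

/-- Renaming coordinates is an isometry for the supremum norm. The cells of a grid are cubes on
varying finite sets of coordinates, not on `Fin n`. -/
theorem HasCompression.of_equiv {ι κ : Type*} [Fintype ι] [Fintype κ] (e : κ ≃ ι) {φ : A → C}
    {Z : Set A} {W : Set C} {g : (ι → ℝ) → A} {h : (ι → ℝ) → C}
    (H : HasCompression φ Z W (fun x : κ → ℝ => g (x ∘ e.symm)) fun x => h (x ∘ e.symm)) :
    HasCompression φ Z W g h := by
  obtain ⟨k, K, h1, h2, h3, h4, h5, h6, h7, h8⟩ := H
  have hn : ∀ x : ι → ℝ, ‖x ∘ e‖ = ‖x‖ := by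
    intro x
    refine le_antisymm ?_ ?_
    · exact (pi_norm_le_iff_of_nonneg (norm_nonneg _)).2 fun i => norm_le_pi_norm x (e i)
    · refine (pi_norm_le_iff_of_nonneg (norm_nonneg _)).2 fun i => ?_
      simpa using norm_le_pi_norm (x ∘ e) (e.symm i)
  have hc : ∀ x : ι → ℝ, (x ∘ e) ∘ e.symm = x := fun x => by
    funext i; simp
  have hcont : Continuous fun x : ι → ℝ => x ∘ e := by fun_prop
  have hb : MapsTo (fun x : ι → ℝ => x ∘ e) (closedBall 0 1) (closedBall 0 1) := fun x hx => by
    simpa [hn] using hx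
  have hcy : MapsTo (fun z : (ι → ℝ) × ℝ => (z.1 ∘ e, z.2)) (ballCyl (ι → ℝ)) (ballCyl (κ → ℝ)) :=
    fun z hz => ⟨(hn z.1).trans_le hz.1, hz.2⟩
  refine ⟨fun x => k (x ∘ e), fun z => K (z.1 ∘ e, z.2), h1.comp hcont.continuousOn hb,
    h2.comp hb, fun x hx => ?_, h4.comp (by fun_prop) hcy, h5.comp hcy, fun x hx => ?_,
    fun x hx => h7 _ ((hn x).trans_le hx), fun x s hx hs => ?_⟩
  · exact (h3 _ ((hn x).trans hx)).trans (congrArg g (hc x))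
  · exact (h6 _ ((hn x).trans_le hx)).trans (congrArg h (hc x))
  · exact (h8 _ s ((hn x).trans hx) hs).trans (congrArg h (hc x))

omit [NormedSpace ℝ E] in
-- The last clause is what makes constraints on the image, and constancy on the sphere, pass to the
-- concatenation.
theorem exists_homotopy_trans {H H' : E × ℝ → Y} (hH : ContinuousOn H (ballCyl E))
    (hH' : ContinuousOn H' (ballCyl E)) (h : ∀ x, ‖x‖ ≤ 1 → H (x, 1) = H' (x, 0)) :
    ∃ K : E × ℝ → Y, ContinuousOn K (ballCyl E) ∧ (∀ x, K (x, 0) = H (x, 0)) ∧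
      (∀ x, K (x, 1) = H' (x, 1)) ∧ ∀ x, ∀ s ∈ Icc (0 : ℝ) 1, ∃ s' ∈ Icc (0 : ℝ) 1,
        K (x, s) = H (x, s') ∨ K (x, s) = H' (x, s') := by
  refine ⟨fun z => if z.2 ≤ 1 / 2 then H (z.1, 2 * z.2) else H' (z.1, 2 * z.2 - 1), ?_, ?_, ?_, ?_⟩
  · refine continuousOn_ite_le (by fun_prop) (by fun_prop) ?_ ?_ ?_
    · exact hH.comp (by fun_prop) fun z hz => ⟨hz.1.1, by
        have := hz.1.2.1
        have : z.2 ≤ 1 / 2 := hz.2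
        constructor <;> simp only <;> linarith⟩
    · exact hH'.comp (by fun_prop) fun z hz => ⟨hz.1.1, by
        have := hz.1.2.2
        have : 1 / 2 ≤ z.2 := hz.2
        constructor <;> simp only <;> linarith⟩
    · intro z hz hs
      norm_num [hs]
      exact h _ hz.1
  · intro x; norm_num
  · intro x; norm_num
  · intro x s hs
    simp only
    split_ifs with h'
    · exact ⟨2 * s, ⟨by linarith [hs.1], by linarith⟩, Or.inl rfl⟩
    · exact ⟨2 * s - 1, ⟨by linarith, by linarith [hs.2]⟩, Or.inr rfl⟩

theorem exists_continuousOn_extension [Nonempty A] {s : Set Y} (f : C(s, A)) :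
    ∃ f' : Y → A, ContinuousOn f' s ∧ ∀ y : s, f' y = f y := by
  classical
  refine ⟨fun y => if h : y ∈ s then f ⟨y, h⟩ else Classical.arbitrary A, ?_, fun y => by simp⟩
  rw [continuousOn_iff_continuous_domRestrict]
  convert! f.continuous using 1
  funext y
  simp

/-- The structure of a map `f : X → Y` that presents `Y`, up to homotopy, as the result of gluing the
mapping cylinder of `φ : A → C` to `X` along a map from `A` to `X`. -/
structure CylinderDecomposition (φ : C(A, C)) (f : C(X, Y)) where
  /-- The height function; it vanishes on `X`. -/
  t : Y → ℝ
  continuous_t : Continuous t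
  t_base : ∀ x, t (f x) = 0
  /-- The map from the cylinder on `A`. -/
  cyl : A × ℝ → Y
  continuousOn_cyl : ContinuousOn cyl (univ ×ˢ Icc (0 : ℝ) 1)
  t_cyl : ∀ a, ∀ u ∈ Icc (0 : ℝ) 1, t (cyl (a, u)) = u
  /-- The upper end of the mapping cylinder. -/
  top : C(C, Y)
  /-- The projection onto the upper end. -/
  proj : C(Y, C)
  cyl_one : ∀ a, cyl (a, 1) = top (φ a)
  t_top : ∀ c, t (top c) = 1
  proj_cyl : ∀ a, ∀ u ∈ Icc (0 : ℝ) 1, proj (cyl (a, u)) = φ a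
  /-- The contraction of `{t > 0}` onto the upper end. -/
  up : Y × ℝ → Y
  continuousOn_up : ContinuousOn up ({y | 0 < t y} ×ˢ Icc (0 : ℝ) 1)
  t_up_pos : ∀ y, 0 < t y → ∀ s ∈ Icc (0 : ℝ) 1, 0 < t (up (y, s))
  up_zero : ∀ y, 0 < t y → up (y, 0) = y
  up_one : ∀ y, 0 < t y → up (y, 1) = top (proj y)
  up_cyl : ∀ a, ∀ u ∈ Ioc (0 : ℝ) 1, ∀ s ∈ Icc (0 : ℝ) 1,
    up (cyl (a, u), s) = cyl (a, u + s * (1 - u))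
  /-- The homotopy inverse of the map from the open cylinder on `A`. -/
  retr : C({y | 0 < t y ∧ t y < 1}, A)
  /-- The homotopy from the identity of `{0 < t < 1}`. -/
  mid : Y × ℝ → Y
  continuousOn_mid : ContinuousOn mid ({y | 0 < t y ∧ t y < 1} ×ˢ Icc (0 : ℝ) 1)
  t_mid : ∀ y, 0 < t y → t y < 1 → ∀ s ∈ Icc (0 : ℝ) 1, t (mid (y, s)) = t y
  mid_zero : ∀ y, 0 < t y → t y < 1 → mid (y, 0) = y
  mid_one : ∀ y : {y | 0 < t y ∧ t y < 1}, mid (y, 1) = cyl (retr y, t y)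
  /-- The retraction of `{t < 1}` onto `X`. -/
  base : C({y | t y < 1}, X)
  base_map : ∀ x (h : t (f x) < 1), base ⟨f x, h⟩ = x
  /-- The deformation of `{t < 1}` into `X`. -/
  down : Y × ℝ → Y
  continuousOn_down : ContinuousOn down ({y | t y < 1} ×ˢ Icc (0 : ℝ) 1)
  down_zero : ∀ y, t y < 1 → down (y, 0) = y
  down_one : ∀ y : {y | t y < 1}, down (y, 1) = f (base y)
  down_map : ∀ x, ∀ s ∈ Icc (0 : ℝ) 1, down (f x, s) = f x

/-- Maps of pairs from the ball and sphere to the pair of the complement `{t > 0}` of the base of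
the mapping cylinder of a weak homotopy equivalence and the complement `{0 < t < 1}` of both ends
can be compressed. -/
theorem CylinderDecomposition.hasCompression {φ : C(A, C)} {f : C(X, Y)}
    (D : CylinderDecomposition φ f) (hφ : IsWeakHomotopyEquiv φ)
    {ι : Type*} [Fintype ι] {k : (ι → ℝ) → Y} (hk : ContinuousOn k (closedBall 0 1))
    (hkW : MapsTo k (closedBall 0 1) {y | 0 < D.t y})
    (hkZ : ∀ x, ‖x‖ = 1 → k x ∈ {y | 0 < D.t y ∧ D.t y < 1}) :
    HasCompression id {y | 0 < D.t y ∧ D.t y < 1} {y | 0 < D.t y} k k := by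
  revert hkW hkZ
  obtain ⟨t, ht, -, cyl, hcyl, htcyl, top, π, hcyltop, httop, hπcyl, F, hF, hFt, hF0, hF1, hFcyl,
    r, Θ, hΘ, hΘt, hΘ0, hΘ1, -, -, -, -, -, -, -⟩ := D
  dsimp only
  intro hkW hkZ
  let e := (Fintype.equivFin ι).symm
  have hA : Nonempty A := hφ.nonempty ⟨π (k 0)⟩
  obtain ⟨r', hr', hrr'⟩ := exists_continuousOn_extension r
  have hkS : ContinuousOn k (sphere 0 1) := hk.mono sphere_subset_closedBall
  have hGmap : MapsTo (fun z : (ι → ℝ) × ℝ => (k z.1, z.2)) (sphereCyl (ι → ℝ))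
      ({y | 0 < t y ∧ t y < 1} ×ˢ Icc (0 : ℝ) 1) := fun z hz => ⟨hkZ _ hz.1, hz.2⟩
  have hfst : MapsTo Prod.fst (sphereCyl (ι → ℝ)) (sphere 0 1) := fun z hz => by simpa using hz.1
  have hG : ContinuousOn (fun z : (ι → ℝ) × ℝ => Θ (k z.1, z.2)) (sphereCyl (ι → ℝ)) :=
    hΘ.comp ((hkS.comp continuous_fst.continuousOn hfst).prodMk continuous_snd.continuousOn) hGmap
  have hGZ : MapsTo (fun z : (ι → ℝ) × ℝ => Θ (k z.1, z.2)) (sphereCyl (ι → ℝ))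
      {y | 0 < t y ∧ t y < 1} := fun z hz => by
    have := hkZ _ hz.1
    simp only [mem_ofPred_eq, hΘt _ this.1 this.2 _ hz.2]
    exact this
  -- `mid` moves the sphere within {0 < t < 1} into the image of the cylinder. The motion extends to
  -- the ball inside {t > 0}, so it suffices to compress the end map `k₁`.
  obtain ⟨K, hK, hKW, hK0, hKS⟩ := exists_homotopy_extension hk hkW hG (fun z hz => (hGZ hz).1)
    fun x hx => hΘ0 _ (hkZ x hx).1 (hkZ x hx).2
  refine HasCompression.congr (HasCompression.of_homotopy hG hGZ hK hKW (fun z hz => (hKS hz).symm)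
    ?_) (fun x hx => hΘ0 _ (hkZ x hx).1 (hkZ x hx).2) hK0
  set k₁ : (ι → ℝ) → Y := fun x => K (x, 1) with hk₁
  have hone : ∀ x : ι → ℝ, ‖x‖ ≤ 1 → (x, (1 : ℝ)) ∈ ballCyl (ι → ℝ) := fun x hx =>
    ⟨hx, zero_le_one, le_rfl⟩
  have hk₁c : ContinuousOn k₁ (closedBall 0 1) :=
    hK.comp (by fun_prop) fun x hx => hone x (by simpa using hx)
  have hk₁W : ∀ x, ‖x‖ ≤ 1 → 0 < t (k₁ x) := fun x hx => hKW (hone x hx)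
  have hk₁S : ∀ x, ‖x‖ = 1 → k₁ x = cyl (r' (k x), t (k x)) := fun x hx => by
    rw [hk₁]
    refine (hKS ⟨hx, zero_le_one, le_rfl⟩).trans ?_
    exact (hΘ1 ⟨k x, hkZ x hx⟩).trans (by rw [← hrr'])
  have hrk : ContinuousOn (fun x => r' (k x)) (sphere 0 1) :=
    hr'.comp hkS fun x hx => hkZ x (by simpa using hx)
  have htk : ContinuousOn (fun x => t (k x)) (sphere 0 1) := ht.comp_continuousOn hkS
  -- On the sphere `k₁` lifts to the cylinder; here one looks for a lift to A × (0, 1] on the whole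
  -- ball, and only afterwards lowers its height below 1.
  have hstep : HasCompression cyl (univ ×ˢ Ioc (0 : ℝ) 1) {y | 0 < t y}
      (fun x => (r' (k x), t (k x))) k₁ := by
    -- At the upper end of the cylinder the problem is one for `φ` alone.
    have htop : HasCompression cyl (univ ×ˢ Ioc (0 : ℝ) 1) {y | 0 < t y}
        (fun x => (r' (k x), 1)) (fun x => top (π (k₁ x))) := by
      have hφc : HasCompression φ univ univ (fun x => r' (k x)) (fun x => π (k₁ x)) := by
        refine HasCompression.of_equiv e (hφ.hasCompression ?_ ?_ ?_)
        all_goals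
          have hn : ∀ x : Fin (Fintype.card ι) → ℝ, ‖x ∘ e.symm‖ = ‖x‖ := by
            intro x
            refine le_antisymm ?_ ?_
            · exact (pi_norm_le_iff_of_nonneg (norm_nonneg _)).2 fun i =>
                norm_le_pi_norm x (e.symm i)
            · refine (pi_norm_le_iff_of_nonneg (norm_nonneg _)).2 fun i => ?_
              simpa using norm_le_pi_norm (x ∘ e.symm) (e i)
        · exact hrk.comp (by fun_prop) fun x hx => by simpa [hn] using hx
        · exact (π.continuous.comp_continuousOn hk₁c).comp (by fun_prop)
            fun x hx => by simpa [hn] using hx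
        · intro x hx
          have hx' := (hn x).trans hx
          rw [hk₁S _ hx', hπcyl _ _ ⟨(hkZ _ hx').1.le, (hkZ _ hx').2.le⟩]
      obtain ⟨g, H, h1, -, h3, h4, -, h6, h7, h8⟩ := hφc
      refine ⟨fun x => (g x, 1), fun z => top (H z), h1.prodMk continuousOn_const,
        fun x _ => ⟨trivial, zero_lt_one, le_rfl⟩, fun x hx => congrArg (·, (1 : ℝ)) (h3 x hx),
        top.continuous.comp_continuousOn h4, fun z _ => ?_, fun x hx => ?_, fun x hx => ?_,
        fun x s hx hs => ?_⟩
      · simp [httop]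
      · simp only [h6 x hx]
      · simp only [h7 x hx, hcyltop]
      · simp only [h8 x s hx hs]
    have hpt : ∀ z ∈ sphereCyl (ι → ℝ), t (k z.1) + z.2 * (1 - t (k z.1)) ∈ Ioc (0 : ℝ) 1 := by
      intro z hz
      have h1 := hkZ _ hz.1
      have h2 : 0 < 1 - t (k z.1) := by linarith [h1.2]
      constructor
      · have := mul_nonneg hz.2.1 h2.le
        linarith [h1.1]
      · nlinarith [hz.2.2]
    have hb : MapsTo (fun z : (ι → ℝ) × ℝ => (k₁ z.1, z.2)) (ballCyl (ι → ℝ))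
        ({y | 0 < t y} ×ˢ Icc (0 : ℝ) 1) := fun z hz => ⟨hk₁W _ hz.1, hz.2⟩
    have hfstb : MapsTo Prod.fst (ballCyl (ι → ℝ)) (closedBall 0 1) := fun z hz => by
      simpa using hz.1
    -- `up` deforms `k₁` to the upper end, and over the sphere this lifts to a linear motion of the
    -- height to 1. By homotopy invariance the compression at the upper end gives one of `k₁`.
    refine HasCompression.congr (HasCompression.of_homotopy (φ := cyl)
      (G := fun z => (r' (k z.1), t (k z.1) + z.2 * (1 - t (k z.1))))
      (H := fun z => F (k₁ z.1, z.2)) ?_ ?_ ?_ ?_ ?_ (htop.congr ?_ ?_)) ?_ ?_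
    · have h1 : ContinuousOn (fun z : (ι → ℝ) × ℝ => r' (k z.1)) (sphereCyl (ι → ℝ)) :=
        hrk.comp continuous_fst.continuousOn hfst
      have h2 : ContinuousOn (fun z : (ι → ℝ) × ℝ => t (k z.1)) (sphereCyl (ι → ℝ)) :=
        htk.comp continuous_fst.continuousOn hfst
      exact h1.prodMk (by fun_prop)
    · exact fun z hz => ⟨trivial, hpt z hz⟩
    · exact hF.comp ((hk₁c.comp continuous_fst.continuousOn hfstb).prodMk
        continuous_snd.continuousOn) hb
    · exact fun z hz => hFt _ (hb hz).1 _ hz.2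
    · intro z hz
      rw [hk₁S _ hz.1, hFcyl _ _ ⟨(hkZ _ hz.1).1, (hkZ _ hz.1).2.le⟩ _ hz.2]
    · intro x hx
      norm_num
    · intro x hx
      exact (hF1 _ (hk₁W x hx)).symm
    · intro x hx
      simp
    · intro x hx
      exact hF0 _ (hk₁W x hx)
  obtain ⟨g, H, h1, h2, h3, h4, h5, h6, h7, h8⟩ := hstep
  have hfstb : MapsTo Prod.fst (ballCyl (ι → ℝ)) (closedBall 0 1) := fun z hz => by
    simpa using hz.1
  have hg1 : ContinuousOn (fun x => (g x).1) (closedBall 0 1) := continuous_fst.comp_continuousOn h1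
  have hg2 : ContinuousOn (fun x => (g x).2) (closedBall 0 1) := continuous_snd.comp_continuousOn h1
  have hgI : ∀ x, ‖x‖ ≤ 1 → (g x).2 ∈ Ioc (0 : ℝ) 1 := fun x hx => (h2 (by simpa using hx)).2
  -- Lowers the heights by a factor that is less than 1 inside the ball and equal to 1 on the
  -- sphere, where they are below 1 already.
  let v : (ι → ℝ) × ℝ → ℝ := fun z => (g z.1).2 * (1 - z.2 * ((1 - ‖z.1‖) / 2))
  have hvc : ContinuousOn v (ballCyl (ι → ℝ)) := by
    have : ContinuousOn (fun z : (ι → ℝ) × ℝ => (g z.1).2) (ballCyl (ι → ℝ)) :=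
      hg2.comp continuous_fst.continuousOn hfstb
    fun_prop
  have hv : ∀ z ∈ ballCyl (ι → ℝ), v z ∈ Ioc (0 : ℝ) 1 := by
    intro z hz
    have h := hgI _ hz.1
    have hn := norm_nonneg z.1
    have hz1 : ‖z.1‖ ≤ 1 := hz.1
    have a1 : 0 ≤ z.2 * ((1 - ‖z.1‖) / 2) := mul_nonneg hz.2.1 (by linarith)
    have a2 : z.2 * ((1 - ‖z.1‖) / 2) ≤ 1 / 2 := by nlinarith [hz.2.1, hz.2.2]
    exact ⟨mul_pos h.1 (by linarith), mul_le_one₀ h.2 (by linarith) (by linarith)⟩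
  let P : (ι → ℝ) × ℝ → Y := fun z => cyl ((g z.1).1, v z)
  have hP : ContinuousOn P (ballCyl (ι → ℝ)) :=
    hcyl.comp ((hg1.comp continuous_fst.continuousOn hfstb).prodMk hvc)
      fun z hz => ⟨trivial, Ioc_subset_Icc_self (hv z hz)⟩
  obtain ⟨Q, hQ, hQ0, hQ1, hQm⟩ := exists_homotopy_trans h4 hP fun x hx => by
    rw [h7 x hx]
    simp [P, v]
  have hgS : ∀ x, ‖x‖ = 1 → ∀ s, P (x, s) = k₁ x := by
    intro x hx s
    simp only [P, v]
    rw [h3 x hx, hx, hk₁S x hx]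
    norm_num
  refine HasCompression.congr (g := k₁) (h := k₁) ⟨fun x => P (x, 1), Q,
    hP.comp (by fun_prop) fun x hx => hone x (by simpa using hx), fun x hx => ?_,
    fun x hx => hgS x hx 1, hQ, fun z hz => ?_, fun x hx => ?_, fun x _ => hQ1 x,
    fun x s hx hs => ?_⟩ (fun x hx => (hKS ⟨hx, zero_le_one, le_rfl⟩)) fun _ _ => rfl
  · have hx' : ‖x‖ ≤ 1 := by simpa using hx
    have h := hv _ (hone x hx')
    simp only [P, mem_ofPred_eq]
    rw [htcyl _ _ (Ioc_subset_Icc_self h)]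
    refine ⟨h.1, ?_⟩
    have hg' := hgI x hx'
    rcases eq_or_lt_of_le hx' with h' | h'
    · simp only [v]
      rw [h3 x h']
      norm_num [h']
      exact (hkZ x h').2
    · simp only [v]
      have hn := norm_nonneg x
      nlinarith [hg'.1, hg'.2]
  · obtain ⟨s', hs', hh | hh⟩ := hQm z.1 z.2 hz.2
    · have := h5 (show (z.1, s') ∈ ballCyl (ι → ℝ) from ⟨hz.1, hs'⟩)
      rwa [← hh] at this
    · have hm : (z.1, s') ∈ ballCyl (ι → ℝ) := ⟨hz.1, hs'⟩
      have h := hv _ hm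
      change 0 < t (Q (z.1, z.2))
      rw [hh]
      simp only [P]
      rw [htcyl _ _ (Ioc_subset_Icc_self h)]
      exact h.1
  · rw [hQ0, h6 x hx]
  · obtain ⟨s', hs', hh | hh⟩ := hQm x s hs
    · rw [hh, h8 x s' hx hs']
    · rw [hh, hgS x hx]

end Cylinder

/-! ### Cubical subdivision -/

section Cubical

variable {ι : Type}

/-- The closed cell of the cubical grid of mesh `2` with centre `c`. It is the product of the
intervals `[c i - 1, c i + 1]` for `c i` odd and the points `c i` for `c i` even. -/
def gridCell (c : ι → ℤ) : Set (ι → ℝ) := {x | ∀ i, |x i - c i| ≤ (c i % 2 : ℤ)}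

theorem isClosed_gridCell (c : ι → ℤ) : IsClosed (gridCell c) := by
  simp only [gridCell, ofPred_forall]
  exact isClosed_iInter fun i => isClosed_le (by fun_prop) continuous_const

theorem center_mem_gridCell (c : ι → ℤ) : (fun i => (c i : ℝ)) ∈ gridCell c := fun i => by
  rw [sub_self, abs_zero]
  exact_mod_cast Int.emod_nonneg _ two_ne_zero

theorem eq_of_mem_gridCell {c : ι → ℤ} {x : ι → ℝ} (hx : x ∈ gridCell c) {i : ι}
    (hi : c i % 2 ≠ 1) : x i = c i := by
  have h := hx i
  rw [show c i % 2 = 0 by omega] at h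
  have h' : |x i - c i| ≤ 0 := by exact_mod_cast h
  exact sub_eq_zero.1 (abs_nonpos_iff.1 h')

theorem abs_sub_le_of_mem_gridCell {c : ι → ℤ} {x : ι → ℝ} (hx : x ∈ gridCell c) (i : ι) :
    |x i - c i| ≤ 1 := by
  refine (hx i).trans ?_
  have : c i % 2 ≤ 1 := by omega
  exact_mod_cast this

/-- Moving the odd coordinate `c i` by one, to the side on which `x` lies, gives the centre of the
face: the coordinate becomes even, and the interval an end point. -/
theorem exists_face_of_mem_gridCell {c : ι → ℤ} {x : ι → ℝ} (hx : x ∈ gridCell c) {i : ι}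
    (hi : c i % 2 = 1) (hxi : |x i - c i| = 1) :
    ∃ c', x ∈ gridCell c' ∧ gridCell c' ⊆ gridCell c ∧ c' ≠ c := by
  classical
  obtain ⟨d, hd, hxd⟩ : ∃ d : ℤ, (d = 1 ∨ d = -1) ∧ x i = (c i + d : ℤ) := by
    rcases eq_or_eq_neg_of_abs_eq hxi with h | h
    · exact ⟨1, Or.inl rfl, by push_cast; linarith⟩
    · exact ⟨-1, Or.inr rfl, by push_cast; linarith⟩
  have hpar : (c i + d) % 2 = 0 := by rcases hd with rfl | rfl <;> omega
  refine ⟨Function.update c i (c i + d), fun j => ?_, fun y hy j => ?_, fun h => ?_⟩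
  · rcases eq_or_ne j i with rfl | hj
    · rw [Function.update_self, hxd, hpar]; simp
    · rw [Function.update_of_ne hj]; exact hx j
  · have := hy j
    rcases eq_or_ne j i with rfl | hj
    · rw [Function.update_self, hpar] at this
      have h' : |y j - (c j + d : ℤ)| ≤ 0 := by exact_mod_cast this
      rw [sub_eq_zero.1 (abs_nonpos_iff.1 h'), hi]
      rcases hd with rfl | rfl <;> norm_num
    · rwa [Function.update_of_ne hj] at this
  · have := congrFun h i
    rw [Function.update_self] at this
    omega

/-- The affine parametrization of a cell by a cube. -/
def gridParam (c : ι → ℤ) (z : {i // c i % 2 = 1} → ℝ) : ι → ℝ := fun i =>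
  if h : c i % 2 = 1 then c i + z ⟨i, h⟩ else c i

/-- The inverse of the affine parametrization of a cell. -/
def gridCoord (c : ι → ℤ) (x : ι → ℝ) : {i // c i % 2 = 1} → ℝ := fun i => x i - c i

theorem continuous_gridParam (c : ι → ℤ) : Continuous (gridParam c) := by
  refine continuous_pi fun i => ?_
  unfold gridParam
  split_ifs <;> fun_prop

theorem continuous_gridCoord (c : ι → ℤ) : Continuous (gridCoord c) := by
  unfold gridCoord; fun_prop

theorem gridParam_gridCoord {c : ι → ℤ} {x : ι → ℝ} (hx : x ∈ gridCell c) :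
    gridParam c (gridCoord c x) = x := by
  funext i
  unfold gridParam
  split_ifs with h
  · simp [gridCoord]
  · exact (eq_of_mem_gridCell hx h).symm

variable [Fintype ι]

theorem gridParam_mem {c : ι → ℤ} {z : {i // c i % 2 = 1} → ℝ} (hz : ‖z‖ ≤ 1) :
    gridParam c z ∈ gridCell c := by
  intro i
  unfold gridParam
  split_ifs with h
  · rw [add_sub_cancel_left, h]
    simpa using norm_apply_le hz ⟨i, h⟩
  · rw [show c i % 2 = 0 by omega]; simp

theorem norm_gridCoord_le {c : ι → ℤ} {x : ι → ℝ} (hx : x ∈ gridCell c) :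
    ‖gridCoord c x‖ ≤ 1 :=
  (pi_norm_le_iff_of_nonneg zero_le_one).2 fun i => abs_sub_le_of_mem_gridCell hx i

/-- The dimension of a cell. -/
def gridDim (c : ι → ℤ) : ℕ := (Finset.univ.filter fun i => c i % 2 = 1).card

/-- An interior coordinate forces the interval: every odd coordinate of `c` is one of `c'`. By the
bound on dimensions there are no further odd ones, and the even coordinates are then read off from
`x`. -/
theorem eq_of_interior_of_mem_gridCell {c c' : ι → ℤ} {x : ι → ℝ} (hx : x ∈ gridCell c)
    (hint : ∀ i, c i % 2 = 1 → |x i - c i| < 1) (hx' : x ∈ gridCell c')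
    (hd : gridDim c' ≤ gridDim c) : c' = c := by
  have hodd : ∀ i, c i % 2 = 1 → c' i = c i := by
    intro i hi
    have h1 := abs_lt.1 (hint i hi)
    by_cases h2 : c' i % 2 = 1
    · have h3 := abs_le.1 (abs_sub_le_of_mem_gridCell hx' i)
      have h4 : (c' i : ℝ) < c i + 2 := by linarith [h1.1, h1.2, h3.1, h3.2]
      have h5 : (c i : ℝ) < c' i + 2 := by linarith [h1.1, h1.2, h3.1, h3.2]
      have h4' : c' i < c i + 2 := by exact_mod_cast h4
      have h5' : c i < c' i + 2 := by exact_mod_cast h5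
      omega
    · rw [eq_of_mem_gridCell hx' h2] at h1
      have h4 : (c' i : ℝ) < c i + 1 := by linarith [h1.2]
      have h5 : (c i : ℝ) < c' i + 1 := by linarith [h1.1]
      have h4' : c' i < c i + 1 := by exact_mod_cast h4
      have h5' : c i < c' i + 1 := by exact_mod_cast h5
      omega
  have hsub : (Finset.univ.filter fun i => c i % 2 = 1) ⊆
      Finset.univ.filter fun i => c' i % 2 = 1 := by
    intro i hi
    have hi' := (Finset.mem_filter.1 hi).2
    simp [hodd i hi', hi']
  have heq := Finset.eq_of_subset_of_card_le hsub hd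
  funext i
  by_cases hi : c i % 2 = 1
  · exact hodd i hi
  · have hi' : c' i % 2 ≠ 1 := fun h => hi (by
      have : i ∈ Finset.univ.filter fun i => c i % 2 = 1 := heq ▸ by simp [h]
      exact (Finset.mem_filter.1 this).2)
    have := (eq_of_mem_gridCell hx' hi').symm.trans (eq_of_mem_gridCell hx hi)
    exact_mod_cast this

variable {Y : Type*} [TopologicalSpace Y]

/-- Let `h` be a map to `Y` defined on a finite subcomplex of the cubical grid, each of whose cells
is mapped to `{t < 1 / 2}` or to `{t > 0}`. If maps to the pair `({t > 0}, {0 < t < 1})` can be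
compressed, then `h` is homotopic to a map to `{t < 1}`, relative to the cells that are mapped to
`{t < 1 / 2}`. -/
theorem exists_homotopy_of_cells {t : Y → ℝ}
    (hZW : ∀ (κ : Type) [Fintype κ] (k : (κ → ℝ) → Y), ContinuousOn k (closedBall 0 1) →
      MapsTo k (closedBall 0 1) {y | 0 < t y} → (∀ x, ‖x‖ = 1 → k x ∈ {y | 0 < t y ∧ t y < 1}) →
      HasCompression id {y | 0 < t y ∧ t y < 1} {y | 0 < t y} k k)
    {h : (ι → ℝ) → Y} (N : ℕ) :
    ∀ 𝒮 : Finset (ι → ℤ), 𝒮.card = N → (∀ c ∈ 𝒮, ∀ c', gridCell c' ⊆ gridCell c → c' ∈ 𝒮) →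
    (∀ c ∈ 𝒮, ContinuousOn h (gridCell c)) →
    (∀ c ∈ 𝒮, (∀ x ∈ gridCell c, t (h x) < 1 / 2) ∨ ∀ x ∈ gridCell c, 0 < t (h x)) →
    ∃ H : (ι → ℝ) × ℝ → Y, ContinuousOn H ((⋃ c ∈ 𝒮, gridCell c) ×ˢ Icc (0 : ℝ) 1) ∧
      ∀ c ∈ 𝒮, ∀ x ∈ gridCell c, H (x, 0) = h x ∧ t (H (x, 1)) < 1 ∧
        ((∀ x ∈ gridCell c, t (h x) < 1 / 2) → ∀ s ∈ Icc (0 : ℝ) 1, H (x, s) = h x) ∧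
        ((∀ x ∈ gridCell c, 0 < t (h x)) → ∀ s ∈ Icc (0 : ℝ) 1, 0 < t (H (x, s))) := by
  classical
  induction N with
  | zero =>
    intro 𝒮 hN _ _ _
    obtain rfl := Finset.card_eq_zero.1 hN
    exact ⟨fun z => h z.1, by simp, by simp⟩
  | succ N ih =>
    intro 𝒮 hN hdown hcont hact
    have hne : 𝒮.Nonempty := Finset.card_pos.1 (by omega)
    obtain ⟨e, he, hmax⟩ := Finset.exists_max_image 𝒮 gridDim hne
    have hsub : ∀ c ∈ 𝒮.erase e, c ∈ 𝒮 := fun c hc => Finset.mem_of_mem_erase hc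
    -- Without `e` the family is still closed under faces: as `e` has maximal dimension, it is not
    -- contained in another cell of the family.
    obtain ⟨H, hH, hHc⟩ := ih (𝒮.erase e) (by rw [Finset.card_erase_of_mem he, hN]; rfl)
      (fun c hc c' hcc => Finset.mem_erase.2 ⟨fun hce => by
        refine Finset.ne_of_mem_erase hc (eq_of_interior_of_mem_gridCell (center_mem_gridCell e)
          (fun i _ => by simp) (hcc ?_) (hmax c (hsub c hc)))
        rw [hce]; exact center_mem_gridCell e, hdown c (hsub c hc) c' hcc⟩)
      (fun c hc => hcont c (hsub c hc)) fun c hc => hact c (hsub c hc)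
    set U := ⋃ c ∈ 𝒮.erase e, gridCell c with hU
    have hUcl : IsClosed U := Set.Finite.isClosed_biUnion (Finset.finite_toSet _)
      fun c _ => isClosed_gridCell c
    have hunion : (⋃ c ∈ 𝒮, gridCell c) = gridCell e ∪ U := by
      conv_lhs => rw [← Finset.insert_erase he]
      rw [Finset.set_biUnion_insert]
    have hface : ∀ x ∈ gridCell e, ∀ i, e i % 2 = 1 → |x i - e i| = 1 →
        ∃ c ∈ 𝒮.erase e, x ∈ gridCell c ∧ gridCell c ⊆ gridCell e := by
      intro x hx i hi hxi
      obtain ⟨c, h1, h2, h3⟩ := exists_face_of_mem_gridCell hx hi hxi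
      exact ⟨c, Finset.mem_erase.2 ⟨h3, hdown e he c h2⟩, h1, h2⟩
    have hbd : ∀ x ∈ gridCell e, x ∈ U → ∃ i, e i % 2 = 1 ∧ |x i - e i| = 1 := by
      intro x hx hxU
      obtain ⟨c, hc, hxc⟩ := mem_iUnion₂.1 hxU
      by_contra! hcon
      refine Finset.ne_of_mem_erase hc (eq_of_interior_of_mem_gridCell hx (fun i hi =>
        lt_of_le_of_ne (abs_sub_le_of_mem_gridCell hx i) (hcon i hi)) hxc (hmax c (hsub c hc)))
    -- The cell `e` meets the union of the others only in its own faces, so it is enough to extend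
    -- the homotopy from there to `e`.
    suffices hK : ∃ K : (ι → ℝ) × ℝ → Y, ContinuousOn K (gridCell e ×ˢ Icc (0 : ℝ) 1) ∧
        (∀ x ∈ gridCell e, x ∈ U → ∀ s ∈ Icc (0 : ℝ) 1, K (x, s) = H (x, s)) ∧
        ∀ x ∈ gridCell e, K (x, 0) = h x ∧ t (K (x, 1)) < 1 ∧
          ((∀ x ∈ gridCell e, t (h x) < 1 / 2) → ∀ s ∈ Icc (0 : ℝ) 1, K (x, s) = h x) ∧
          ((∀ x ∈ gridCell e, 0 < t (h x)) → ∀ s ∈ Icc (0 : ℝ) 1, 0 < t (K (x, s))) by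
      obtain ⟨K, hK, hKH, hKe⟩ := hK
      let H' : (ι → ℝ) × ℝ → Y := fun z => if z.1 ∈ gridCell e then K z else H z
      have h1 : ∀ x ∈ gridCell e, ∀ s, H' (x, s) = K (x, s) := fun x hx s => if_pos hx
      have h2 : ∀ x ∈ U, ∀ s ∈ Icc (0 : ℝ) 1, H' (x, s) = H (x, s) := by
        intro x hx s hs
        by_cases hxe : x ∈ gridCell e
        · rw [h1 x hxe, hKH x hxe hx s hs]
        · exact if_neg hxe
      refine ⟨H', ?_, fun c hc x hx => ?_⟩
      · rw [hunion, union_prod]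
        exact (hK.congr fun z hz => h1 z.1 hz.1 z.2).union_of_isClosed
          (hH.congr fun z hz => h2 z.1 hz.1 z.2 hz.2)
          ((isClosed_gridCell e).prod isClosed_Icc) (hUcl.prod isClosed_Icc)
      · by_cases hce : c = e
        · subst hce
          simp only [h1 x hx]
          exact hKe x hx
        · have hc' : c ∈ 𝒮.erase e := Finset.mem_erase.2 ⟨hce, hc⟩
          have hxU : x ∈ U := mem_iUnion₂.2 ⟨c, hc', hx⟩
          have h3 := hHc c hc' x hx
          refine ⟨(h2 x hxU 0 (by simp)).trans h3.1, ?_, fun hi s hs => ?_, fun ha s hs => ?_⟩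
          · rw [h2 x hxU 1 (by simp)]; exact h3.2.1
          · rw [h2 x hxU s hs]; exact h3.2.2.1 hi s hs
          · rw [h2 x hxU s hs]; exact h3.2.2.2 ha s hs
    -- A cell satisfying both conditions is kept fixed. This is consistent with its faces, which
    -- also satisfy t < 1/2 and were kept fixed.
    by_cases hi : ∀ x ∈ gridCell e, t (h x) < 1 / 2
    · refine ⟨fun z => h z.1, (hcont e he).comp continuous_fst.continuousOn fun z hz => hz.1,
        fun x hx hxU s hs => ?_, fun x hx => ⟨rfl, by linarith [hi x hx], fun _ _ _ => rfl,
          fun ha _ _ => ha x hx⟩⟩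
      obtain ⟨i, hi1, hi2⟩ := hbd x hx hxU
      obtain ⟨c, hc, hxc, hce⟩ := hface x hx i hi1 hi2
      exact ((hHc c hc x hxc).2.2.1 (fun y hy => hi y (hce hy)) s hs).symm
    · have ha := (hact e he).resolve_left hi
      have hnorm : ∀ z : {i // e i % 2 = 1} → ℝ, ‖z‖ = 1 → gridParam e z ∈ gridCell e ∧
          ∃ c ∈ 𝒮.erase e, gridParam e z ∈ gridCell c ∧ gridCell c ⊆ gridCell e := by
        intro z hz
        have hm := gridParam_mem hz.le
        obtain ⟨i, hzi⟩ := exists_abs_eq_one hz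
        refine ⟨hm, hface _ hm i.1 i.2 ?_⟩
        simpa [gridParam, i.2] using hzi
      -- All faces of `e` lie in {t > 0}, so the homotopy on them stays there, and it ends in {0 < t
      -- < 1}. The compression property extends it to `e` under the same two conditions.
      obtain ⟨M, hM, hMW, hM0, hMS⟩ := exists_ballCup_map (W := {y | 0 < t y})
        (h := fun z => h (gridParam e z)) (H := fun z => H (gridParam e z.1, z.2))
        ((hcont e he).comp (continuous_gridParam e).continuousOn
          fun z hz => gridParam_mem (by simpa using hz))
        (fun z hz => ha _ (gridParam_mem (by simpa using hz)))
        (hH.comp (((continuous_gridParam e).comp continuous_fst).prodMk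
          continuous_snd).continuousOn fun z hz => by
            obtain ⟨-, c, hc, hzc, -⟩ := hnorm z.1 hz.1
            exact ⟨mem_iUnion₂.2 ⟨c, hc, hzc⟩, hz.2⟩)
        (fun z hz => by
          obtain ⟨-, c, hc, hzc, hce⟩ := hnorm z.1 hz.1
          exact (hHc c hc _ hzc).2.2.2 (fun y hy => ha y (hce hy)) _ hz.2)
        (fun z hz => by
          obtain ⟨-, c, hc, hzc, -⟩ := hnorm z hz
          exact (hHc c hc _ hzc).1)
      obtain ⟨M', hM', hMM', hMW', hMZ'⟩ := exists_extension_of_hasCompression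
        (Z := {y | 0 < t y ∧ t y < 1}) (hZW _) hM hMW fun z hz => by
          have hz1 : (z, (1 : ℝ)) ∈ sphereCyl ({i // e i % 2 = 1} → ℝ) :=
            ⟨hz, zero_le_one, le_rfl⟩
          obtain ⟨-, c, hc, hzc, hce⟩ := hnorm z hz
          refine ⟨hMW (Or.inr hz1), ?_⟩
          rw [hMS hz1]
          exact (hHc c hc _ hzc).2.1
      have hmem : ∀ x ∈ gridCell e, ∀ s ∈ Icc (0 : ℝ) 1,
          (gridCoord e x, s) ∈ ballCyl ({i // e i % 2 = 1} → ℝ) := fun x hx s hs =>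
        ⟨norm_gridCoord_le hx, hs⟩
      refine ⟨fun z => M' (gridCoord e z.1, z.2), hM'.comp (((continuous_gridCoord e).comp
        continuous_fst).prodMk continuous_snd).continuousOn fun z hz => hmem _ hz.1 _ hz.2,
        fun x hx hxU s hs => ?_, fun x hx => ⟨?_, (hMZ' _ (norm_gridCoord_le hx)).2,
          fun h' => absurd h' hi, fun _ s hs => hMW' (hmem x hx s hs)⟩⟩
      · obtain ⟨i, hi1, hi2⟩ := hbd x hx hxU
        have hn : ‖gridCoord e x‖ = 1 :=
          norm_eq_one_of_abs_eq_one (i := ⟨i, hi1⟩) (norm_gridCoord_le hx) hi2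
        have hms : (gridCoord e x, s) ∈ sphereCyl ({i // e i % 2 = 1} → ℝ) := ⟨hn, hs⟩
        refine (hMM' (Or.inr hms)).trans ((hMS hms).trans ?_)
        simp only [gridParam_gridCoord hx]
      · simp only
        rw [hMM' (Or.inl ⟨norm_gridCoord_le hx, rfl⟩), hM0, gridParam_gridCoord hx]

theorem exists_gridCell (N : ℕ) (hN : 1 ≤ N) {x : ι → ℝ} (hx : ‖x‖ ≤ 2 * N) :
    ∃ c : ι → ℤ, x ∈ gridCell c ∧ gridCell c ⊆ closedBall 0 (2 * N) := by
  have hx' : ∀ i, |x i| ≤ 2 * N := fun i => (norm_le_pi_norm x i).trans hx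
  -- The minimum matters for x i = 2N only: the last interval is used instead of the one beyond it.
  let m : ι → ℤ := fun i => min ⌊x i / 2⌋ (N - 1)
  have hm1 : ∀ i, -(N : ℤ) ≤ m i := by
    intro i
    refine le_min (Int.le_floor.2 ?_) (by omega)
    have := (abs_le.1 (hx' i)).1
    push_cast; linarith
  have hm2 : ∀ i, m i ≤ N - 1 := fun i => min_le_right _ _
  have hodd : ∀ i, (2 * m i + 1) % 2 = 1 := fun i => by omega
  refine ⟨fun i => 2 * m i + 1, fun i => ?_, fun y hy => ?_⟩
  · rw [hodd, abs_le]
    push_cast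
    have h1 : (m i : ℝ) ≤ x i / 2 := by
      refine le_trans ?_ (Int.floor_le (x i / 2))
      exact_mod_cast min_le_left _ _
    refine ⟨by linarith, ?_⟩
    rcases le_total ⌊x i / 2⌋ (N - 1) with h | h
    · have h2 : m i = ⌊x i / 2⌋ := min_eq_left h
      have := Int.lt_floor_add_one (x i / 2)
      rw [← h2] at this
      linarith
    · have h2 : m i = N - 1 := min_eq_right h
      rw [h2]
      push_cast
      linarith [(abs_le.1 (hx' i)).2]
  · rw [mem_closedBall_zero_iff, pi_norm_le_iff_of_nonneg (by positivity)]
    intro i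
    have h := hy i
    rw [hodd] at h
    push_cast at h
    have h1 : (-(N : ℝ)) ≤ m i := by exact_mod_cast hm1 i
    have h2 : (m i : ℝ) ≤ N - 1 := by exact_mod_cast hm2 i
    rw [abs_le] at h
    rw [Real.norm_eq_abs, abs_le]
    constructor <;> linarith [h.1, h.2]

theorem finite_gridCell_subset (R : ℝ) : {c : ι → ℤ | gridCell c ⊆ closedBall 0 R}.Finite := by
  refine Set.Finite.subset (Set.Finite.pi' fun _ : ι => Set.finite_Icc (-⌈R⌉) ⌈R⌉) ?_
  intro c hc i
  have h := hc (center_mem_gridCell c)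
  rw [mem_closedBall_zero_iff] at h
  have h' := abs_le.1 ((norm_le_pi_norm _ i).trans h)
  have := Int.le_ceil R
  constructor
  · have : (-⌈R⌉ : ℝ) ≤ c i := by linarith [h'.1]
    exact_mod_cast this
  · have : (c i : ℝ) ≤ ⌈R⌉ := by linarith [h'.2]
    exact_mod_cast this

/-- If maps to the pair `({t > 0}, {0 < t < 1})` can be compressed, then a map from the ball whose
restriction to the sphere is contained in `{t ≤ 0}` is homotopic, relative to the sphere, to a map
to `{t < 1}`. -/
theorem exists_homotopy_of_height {t : Y → ℝ} (ht : Continuous t)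
    (hZW : ∀ (κ : Type) [Fintype κ] (k : (κ → ℝ) → Y), ContinuousOn k (closedBall 0 1) →
      MapsTo k (closedBall 0 1) {y | 0 < t y} → (∀ x, ‖x‖ = 1 → k x ∈ {y | 0 < t y ∧ t y < 1}) →
      HasCompression id {y | 0 < t y ∧ t y < 1} {y | 0 < t y} k k)
    {h : (ι → ℝ) → Y} (hh : ContinuousOn h (closedBall 0 1)) (hS : ∀ x, ‖x‖ = 1 → t (h x) ≤ 0) :
    ∃ H : (ι → ℝ) × ℝ → Y, ContinuousOn H (ballCyl (ι → ℝ)) ∧ (∀ x, ‖x‖ ≤ 1 → H (x, 0) = h x) ∧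
      (∀ x, ‖x‖ ≤ 1 → t (H (x, 1)) < 1) ∧
      ∀ x s, ‖x‖ = 1 → s ∈ Icc (0 : ℝ) 1 → H (x, s) = h x := by
  have huc := (isCompact_closedBall (0 : ι → ℝ) 1).uniformContinuousOn_of_continuous
    (ht.comp_continuousOn hh)
  obtain ⟨δ, hδ, hδh⟩ := Metric.uniformContinuousOn_iff.1 huc (1 / 2) (by norm_num)
  obtain ⟨N, hN⟩ := exists_nat_gt (1 / δ)
  have hN0 : (0 : ℝ) < N := lt_trans (by positivity) hN
  have hN1 : 1 ≤ N := by exact_mod_cast hN0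
  have hNδ : 1 / (N : ℝ) < δ := by
    rw [div_lt_iff₀ hN0]; rwa [div_lt_iff₀ hδ, mul_comm] at hN
  -- Cells have diameter at most 2; after rescaling by ρ⁻¹ this is 1 / N, less than the modulus of
  -- continuity δ for 1/2.
  set ρ : ℝ := 2 * N with hρ
  have hρ0 : 0 < ρ := by positivity
  have hscale : ∀ x : ι → ℝ, ‖x‖ ≤ ρ → ‖ρ⁻¹ • x‖ ≤ 1 := fun x hx => by
    rw [norm_smul, norm_inv, Real.norm_of_nonneg hρ0.le]
    exact inv_mul_le_one_of_le₀ hx hρ0.le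
  let 𝒮 : Finset (ι → ℤ) := (finite_gridCell_subset ρ).toFinset
  have h𝒮 : ∀ {c}, c ∈ 𝒮 ↔ gridCell c ⊆ closedBall 0 ρ := by simp [𝒮]
  have hosc : ∀ c ∈ 𝒮, ∀ x ∈ gridCell c, ∀ y ∈ gridCell c,
      t (h (ρ⁻¹ • x)) < t (h (ρ⁻¹ • y)) + 1 / 2 := by
    intro c hc x hx y hy
    have hxn := hscale x (by simpa using h𝒮.1 hc hx)
    have hyn := hscale y (by simpa using h𝒮.1 hc hy)
    have hd : dist (ρ⁻¹ • x) (ρ⁻¹ • y) < δ := by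
      have hxy : ‖x - y‖ ≤ 2 := by
        rw [pi_norm_le_iff_of_nonneg zero_le_two]
        intro i
        have h1 := abs_le.1 (abs_sub_le_of_mem_gridCell hx i)
        have h2 := abs_le.1 (abs_sub_le_of_mem_gridCell hy i)
        rw [Pi.sub_apply, Real.norm_eq_abs, abs_le]
        constructor <;> linarith [h1.1, h1.2, h2.1, h2.2]
      rw [dist_eq_norm, ← smul_sub, norm_smul, norm_inv, Real.norm_of_nonneg hρ0.le]
      refine lt_of_le_of_lt (mul_le_mul_of_nonneg_left hxy (by positivity)) ?_
      rw [hρ]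
      convert! hNδ using 1
      field_simp
    have := hδh _ (by simpa using hxn) _ (by simpa using hyn) hd
    rw [Real.dist_eq, abs_lt] at this
    simp only [Function.comp] at this
    linarith [this.2]
  obtain ⟨H, hH, hHc⟩ := exists_homotopy_of_cells hZW (h := fun x => h (ρ⁻¹ • x)) 𝒮.card 𝒮 rfl
    (fun c hc c' hcc => h𝒮.2 (hcc.trans (h𝒮.1 hc)))
    (fun c hc => hh.comp (by fun_prop) fun x hx => by
      simpa using hscale x (by simpa using h𝒮.1 hc hx))
    -- A cell violating both conditions would contain points with t ≥ 1/2 and t ≤ 0, against the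
    -- bound on the oscillation.
    (fun c hc => by
      by_contra! hcon
      obtain ⟨⟨x, hx, hx1⟩, y, hy, hy1⟩ := hcon
      linarith [hosc c hc x hx y hy])
  have hcell : ∀ x : ι → ℝ, ‖x‖ ≤ 1 → ∃ c ∈ 𝒮, ρ • x ∈ gridCell c := by
    intro x hx
    obtain ⟨c, h1, h2⟩ := exists_gridCell N hN1 (x := ρ • x) (by
      rw [norm_smul, Real.norm_of_nonneg hρ0.le]
      exact mul_le_of_le_one_right hρ0.le hx)
    exact ⟨c, h𝒮.2 h2, h1⟩
  have hinv : ∀ x : ι → ℝ, ρ⁻¹ • ρ • x = x := fun x => inv_smul_smul₀ hρ0.ne' x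
  refine ⟨fun z => H (ρ • z.1, z.2), hH.comp (by fun_prop) fun z hz => ?_, fun x hx => ?_,
    fun x hx => ?_, fun x s hx hs => ?_⟩
  · obtain ⟨c, hc, hxc⟩ := hcell z.1 hz.1
    exact ⟨mem_iUnion₂.2 ⟨c, hc, hxc⟩, hz.2⟩
  · obtain ⟨c, hc, hxc⟩ := hcell x hx
    refine (hHc c hc _ hxc).1.trans ?_
    rw [hinv]
  · obtain ⟨c, hc, hxc⟩ := hcell x hx
    exact (hHc c hc _ hxc).2.1
  · obtain ⟨c, hc, hxc⟩ := hcell x hx.le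
    -- A cell containing a point of the sphere, where t ≤ 0, satisfies t < 1/2 throughout and is
    -- therefore kept fixed.
    refine ((hHc c hc _ hxc).2.2.1 (fun y hy => ?_) s hs).trans (by rw [hinv])
    have h1 := hosc c hc y hy _ hxc
    rw [hinv] at h1
    linarith [hS x hx]

end Cubical

/-! ### Gluing on the mapping cylinder of a weak equivalence. -/

section Gluing

variable {A C X Y : Type*} [TopologicalSpace A] [TopologicalSpace C] [TopologicalSpace X]
  [TopologicalSpace Y]

/-- Gluing the mapping cylinder of a weak homotopy equivalence to a space yields a weak homotopy
equivalence. -/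
theorem CylinderDecomposition.isWeakHomotopyEquiv {φ : C(A, C)} {f : C(X, Y)}
    (D : CylinderDecomposition φ f) (hφ : IsWeakHomotopyEquiv φ) : IsWeakHomotopyEquiv f := by
  refine IsWeakHomotopyEquiv.of_hasCompression ?_ fun n g h hg hh hgh => ?_
  · rintro ⟨y⟩
    by_cases hy : D.t y < 1
    · exact ⟨D.base ⟨y, hy⟩⟩
    -- A point over the upper end gives a point of `C`, hence one of `A`, and the lower end of the
    -- cylinder retracts to `X`.
    · obtain ⟨a⟩ := hφ.nonempty ⟨D.proj y⟩
      have : D.t (D.cyl (a, 0)) < 1 := by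
        rw [D.t_cyl a 0 (by simp)]; exact zero_lt_one
      exact ⟨D.base ⟨_, this⟩⟩
  have hX : Nonempty X := ⟨g 0⟩
  obtain ⟨b, hb, hbD⟩ := exists_continuousOn_extension D.base
  -- First push the ball off {t = 1}, then follow `down` into the base. Both homotopies are constant
  -- on the sphere.
  obtain ⟨H, hH, hH0, hH1, hHS⟩ := exists_homotopy_of_height D.continuous_t
    (fun κ _ k hk hkW hkZ => D.hasCompression hφ hk hkW hkZ) hh fun x hx => by
      rw [← hgh x hx, D.t_base]
  have hb1 : MapsTo (fun x => H (x, 1)) (closedBall 0 1) {y | D.t y < 1} := fun x hx =>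
    hH1 x (by simpa using hx)
  have hH1c : ContinuousOn (fun x => H (x, 1)) (closedBall 0 1) :=
    hH.comp (by fun_prop) fun x hx => ⟨by simpa using hx, by simp⟩
  have hfst : MapsTo Prod.fst (ballCyl (Fin n → ℝ)) (closedBall 0 1) := fun z hz => by
    simpa using hz.1
  obtain ⟨K, hK, hK0, hK1, hKm⟩ := exists_homotopy_trans hH
    (H' := fun z => D.down (H (z.1, 1), z.2))
    (D.continuousOn_down.comp ((hH1c.comp continuous_fst.continuousOn hfst).prodMk
      continuous_snd.continuousOn) fun z hz => ⟨hb1 (hfst hz), hz.2⟩)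
    fun x hx => (D.down_zero _ (hH1 x hx)).symm
  have hHS1 : ∀ x, ‖x‖ = 1 → H (x, 1) = f (g x) := fun x hx =>
    (hHS x 1 hx (by simp)).trans (hgh x hx).symm
  refine ⟨fun x => b (H (x, 1)), K, hb.comp hH1c hb1, mapsTo_univ _ _, fun x hx => ?_, hK,
    mapsTo_univ _ _, fun x hx => (hK0 x).trans (hH0 x hx), fun x hx => ?_, fun x s hx hs => ?_⟩
  · have : D.t (f (g x)) < 1 := by
      rw [D.t_base]; exact zero_lt_one
    simp only [hHS1 x hx]
    exact (hbD ⟨_, this⟩).trans (D.base_map _ _)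
  · refine (hK1 x).trans ((D.down_one ⟨_, hH1 x hx⟩).trans ?_)
    rw [← hbD]
  · obtain ⟨s', hs', h' | h'⟩ := hKm x s hs
    · rw [h', hHS x s' hx hs']
    · rw [h', hHS1 x hx, D.down_map _ _ hs', hgh x hx]

end Gluing

/-! ### Maps out of homotopy colimits -/

namespace Hocolim

variable {P : Type} [PartialOrder P] [Fintype P] {F : P ⥤ TopCat.{u}}

/-- The point of the homotopy colimit given by a point of `|p ↓ P|` and a point of `F(p)`. -/
def mk (F : P ⥤ TopCat.{u}) (p : P) (x : UnderComplex p) (a : F.obj p) : Hocolim F :=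
  Quot.mk _ ⟨p, x, a⟩

theorem ind {motive : Hocolim F → Prop} (h : ∀ p x a, motive (mk F p x a)) (y : Hocolim F) :
    motive y :=
  Quot.ind (fun z => h z.1 z.2.1 z.2.2) y

theorem mk_incl {p p' : P} (h : p ≤ p') (x : UnderComplex p') (a : F.obj p) :
    mk F p (x.incl h) a = mk F p' x (F.map (homOfLE h) a) :=
  Quot.sound (HocolimRel.glue h x a)

theorem continuous_mk (p : P) : Continuous fun z : UnderComplex p × F.obj p => mk F p z.1 z.2 :=
  continuous_quot_mk.comp (continuous_sigmaMk (σ := fun p => UnderComplex p × F.obj p) (i := p))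

theorem continuous_underComplex {p : P} {Z : Type*} [TopologicalSpace Z] {f : Z → UnderComplex p}
    (hf : ∀ q, Continuous fun z => (f z).1 q) : Continuous f :=
  Continuous.subtype_mk (Continuous.subtype_mk (continuous_pi hf) _) _

theorem continuous_underComplex_apply {p : P} (q : P) :
    Continuous fun x : UnderComplex p => x.1 q :=
  (continuous_apply q).comp (continuous_subtype_val.comp continuous_subtype_val)

theorem continuous_mk_comp {p : P} {Z : Type*} [TopologicalSpace Z] {f : Z → UnderComplex p}
    {a : Z → F.obj p} (hf : ∀ q, Continuous fun z => (f z).1 q) (ha : Continuous a) :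
    Continuous fun z => mk F p (f z) (a z) :=
  (continuous_mk p).comp ((continuous_underComplex hf).prodMk ha)

theorem underComplex_ext {p : P} {x x' : UnderComplex p} (h : ∀ q, x.1 q = x'.1 q) : x = x' :=
  Subtype.ext (Subtype.ext (funext h))

/-- The weights of a point of a homotopy colimit. -/
def weight (y : Hocolim F) : P → ℝ :=
  Quot.lift (fun z q => z.2.1.1 q) (by rintro _ _ ⟨h, x, a⟩; rfl) y

@[simp]
theorem weight_mk (p : P) (x : UnderComplex p) (a : F.obj p) (q : P) :
    weight (mk F p x a) q = x.1 q := rfl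

theorem continuous_weight : Continuous (weight : Hocolim F → P → ℝ) :=
  continuous_quot_lift _ (continuous_sigma fun _ => continuous_pi fun q =>
    (continuous_underComplex_apply q).comp continuous_fst)

/-- The pieces of an open subspace of the homotopy colimit. -/
abbrev Piece (V : Set (Hocolim F)) (p : P) : Type u :=
  {z : UnderComplex p × F.obj p // mk F p z.1 z.2 ∈ V}

theorem continuous_piece_fst {V : Set (Hocolim F)} {p : P} {Z : Type*} [TopologicalSpace Z] :
    Continuous fun z : Piece V p × Z => z.1.1.1 :=
  continuous_fst.comp (continuous_subtype_val.comp continuous_fst)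

theorem continuous_piece_snd {V : Set (Hocolim F)} {p : P} {Z : Type*} [TopologicalSpace Z] :
    Continuous fun z : Piece V p × Z => z.1.1.2 :=
  continuous_snd.comp (continuous_subtype_val.comp continuous_fst)

/-- A quotient map remains one when restricted to the preimage of an open subset. -/
theorem isQuotientMap_piece {V : Set (Hocolim F)} (hV : IsOpen V) :
    IsQuotientMap fun z : Σ p, Piece V p =>
      (⟨mk F z.1 z.2.1.1 z.2.1.2, z.2.2⟩ : V) := by
  have hc : Continuous fun z : Σ p, Piece V p => (⟨mk F z.1 z.2.1.1 z.2.1.2, z.2.2⟩ : V) :=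
    continuous_sigma fun p => ((continuous_mk p).comp continuous_subtype_val).subtype_mk _
  rw [isQuotientMap_iff, isCoinducing_iff]
  refine ⟨fun U => ⟨fun hU => ?_, fun hU => hU.preimage hc⟩, ?_⟩
  · rw [hV.isOpenEmbedding_subtypeVal.isOpen_iff_image_isOpen]
    refine isQuotientMap_quot_mk.isOpen_preimage.1 (isOpen_sigma_iff.2 fun p => ?_)
    have h1 := isOpen_sigma_iff.1 hU p
    have h2 : IsOpen {z : UnderComplex p × F.obj p | mk F p z.1 z.2 ∈ V} :=
      hV.preimage (continuous_mk p)
    have h3 := h2.isOpenEmbedding_subtypeVal.isOpen_iff_image_isOpen.1 h1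
    convert h3 using 1
    ext z
    constructor
    · rintro ⟨y, hy, hyz⟩
      have hz : mk F p z.1 z.2 ∈ V := by
        have := y.2; rw [hyz] at this; exact this
      refine ⟨⟨z, hz⟩, ?_, rfl⟩
      have : y = ⟨mk F p z.1 z.2, hz⟩ := Subtype.ext hyz
      change (⟨mk F p z.1 z.2, hz⟩ : V) ∈ U
      rw [← this]
      exact hy
    · rintro ⟨z, hz, rfl⟩
      exact ⟨_, hz, rfl⟩
  · rintro ⟨y, hy⟩
    induction y using Hocolim.ind with | _ p x a
    exact ⟨⟨p, (x, a), hy⟩, rfl⟩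

/-- The construction of maps out of the product of an open subspace of a homotopy colimit and an
interval. -/
theorem exists_lift {V : Set (Hocolim F)} (hV : IsOpen V) {T : Type*} [TopologicalSpace T]
    (g : ∀ p, Piece V p → Icc (0 : ℝ) 1 → T)
    (hg : ∀ p p' (h : p ≤ p') (x : UnderComplex p') (a : F.obj p)
      (hm : mk F p (x.incl h) a ∈ V) (hm' : mk F p' x (F.map (homOfLE h) a) ∈ V) s,
      g p ⟨(x.incl h, a), hm⟩ s = g p' ⟨(x, F.map (homOfLE h) a), hm'⟩ s)
    (hc : ∀ p, Piece V p → Continuous fun z : Piece V p × Icc (0 : ℝ) 1 => g p z.1 z.2) :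
    ∃ f : C(V × Icc (0 : ℝ) 1, T), ∀ p x a (hm : mk F p x a ∈ V) s,
      f (⟨mk F p x a, hm⟩, s) = g p ⟨(x, a), hm⟩ s := by
  classical
  -- A map out of the quotient has to be defined on all of it; `none` is the value outside `V`.
  let o : Hocolim F → Option (Icc (0 : ℝ) 1 → T) :=
    Quot.lift (fun z => if h : mk F z.1 z.2.1 z.2.2 ∈ V then some (g z.1 ⟨z.2, h⟩) else none) (by
      rintro _ _ ⟨h, x, a⟩
      have heq := mk_incl h x a
      by_cases hm : mk F _ (x.incl h) a ∈ V
      · rw [dif_pos hm, dif_pos (heq ▸ hm)]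
        exact congrArg some (funext (hg _ _ h x a hm (heq ▸ hm)))
      · rw [dif_neg hm, dif_neg (heq ▸ hm)])
  have ho : ∀ p x a (hm : mk F p x a ∈ V), o (mk F p x a) = some (g p ⟨(x, a), hm⟩) :=
    fun p x a hm => dif_pos hm
  have hsome : ∀ y : V, (o y).isSome := by
    rintro ⟨y, hy⟩
    induction y using Hocolim.ind with | _ p x a
    simp only [ho p x a hy, Option.isSome_some]
  let f : V × Icc (0 : ℝ) 1 → T := fun z => (o z.1).get (hsome z.1) z.2
  have hf : ∀ p x a (hm : mk F p x a ∈ V) s,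
      f (⟨mk F p x a, hm⟩, s) = g p ⟨(x, a), hm⟩ s := fun p x a hm s => by
    have : ∀ h : (o (mk F p x a)).isSome, (o (mk F p x a)).get h = g p ⟨(x, a), hm⟩ := by
      rw [ho p x a hm]
      exact fun _ => rfl
    exact congrFun (this _) s
  have hfc : Continuous f := by
    -- The product of a quotient map with the compact interval is a quotient map.
    refine (isQuotientMap_piece hV).continuous_lift_prod_left ?_
    rw [← (Homeomorph.sigmaProdDistrib (X := fun p => Piece V p)
      (Y := Icc (0 : ℝ) 1)).symm.comp_continuous_iff']
    refine continuous_sigma fun p => ?_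
    -- Continuity is needed on nonempty pieces only. The point handed to `hc` makes available
    -- properties of `p` that hold because the piece is nonempty.
    rcases isEmpty_or_nonempty (Piece V p) with _ | ⟨⟨z₀⟩⟩
    · exact continuous_iff_continuousAt.2 fun z => isEmptyElim z.1
    refine (hc p z₀).congr fun z => ?_
    exact (hf p z.1.1.1 z.1.1.2 z.1.2 z.2).symm
  exact ⟨⟨f, hfc⟩, hf⟩

/-- A variation of the weights of the points of an open subspace of a homotopy colimit defines a
homotopy. -/
theorem exists_reweight {O : Set (P → ℝ)} (hO : IsOpen O) (Φ : (P → ℝ) → ℝ → P → ℝ)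
    (hΦ : ∀ q, ContinuousOn (fun z : (P → ℝ) × ℝ => Φ z.1 z.2 q) (O ×ˢ Icc (0 : ℝ) 1))
    (h : ∀ w ∈ O, w ∈ stdSimplex ℝ P → IsChain (· ≤ ·) {q | w q ≠ 0} → ∀ s ∈ Icc (0 : ℝ) 1,
      Φ w s ∈ stdSimplex ℝ P ∧ IsChain (· ≤ ·) {q | Φ w s q ≠ 0} ∧
        ∀ q, Φ w s q ≠ 0 → ∃ q', w q' ≠ 0 ∧ q' ≤ q) :
    ∃ f : Hocolim F × ℝ → Hocolim F,
      ContinuousOn f ({y | weight y ∈ O} ×ˢ Icc (0 : ℝ) 1) ∧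
      ∀ p (x : UnderComplex p) a, (x.1 : P → ℝ) ∈ O → ∀ s ∈ Icc (0 : ℝ) 1,
        ∃ x' : UnderComplex p, (∀ q, x'.1 q = Φ x.1 s q) ∧ f (mk F p x a, s) = mk F p x' a := by
  let V : Set (Hocolim F) := {y | weight y ∈ O}
  have hV : IsOpen V := hO.preimage continuous_weight
  -- Each element of the new support lies above one of the old support, hence above `p`, so the
  -- point of F(p) is kept and the gluing relations are respected.
  let x' : ∀ p (x : UnderComplex p), (x.1 : P → ℝ) ∈ O → Icc (0 : ℝ) 1 → UnderComplex p :=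
    fun p x hx s => ⟨⟨Φ x.1 s, (h _ hx x.1.2 x.2.1 s s.2).1⟩, (h _ hx x.1.2 x.2.1 s s.2).2.1,
      fun q hq => by
        obtain ⟨q', h1, h2⟩ := (h _ hx x.1.2 x.2.1 s s.2).2.2 q hq
        exact (x.2.2 q' h1).trans h2⟩
  have hcont : ∀ p, Continuous fun z : Piece V p × Icc (0 : ℝ) 1 =>
      ((fun q => z.1.1.1.1 q : P → ℝ), (z.2 : ℝ)) := fun p => by
    refine Continuous.prodMk (continuous_pi fun q => ?_) (continuous_subtype_val.comp continuous_snd)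
    exact (continuous_underComplex_apply q).comp continuous_piece_fst
  obtain ⟨f, hf⟩ := exists_lift (T := Hocolim F) hV
    (fun p z s => mk F p (x' p z.1.1 z.2 s) z.1.2)
    (fun p p' hp x a hm hm' s => mk_incl hp (x' p' x hm' s) a) (fun p _ => continuous_mk_comp
      (fun q => (hΦ q).comp_continuous (hcont p) fun z => ⟨z.1.2, z.2.2⟩)
      continuous_piece_snd)
  classical
  refine ⟨fun z => if hz : z.1 ∈ V ∧ z.2 ∈ Icc (0 : ℝ) 1 then f (⟨z.1, hz.1⟩, ⟨z.2, hz.2⟩)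
    else z.1, ?_, fun p x a hx s hs => ⟨x' p x hx ⟨s, hs⟩, fun q => rfl, ?_⟩⟩
  · rw [continuousOn_iff_continuous_domRestrict]
    refine (f.continuous.comp (((continuous_fst.comp continuous_subtype_val).subtype_mk
      fun z => z.2.1).prodMk ((continuous_snd.comp continuous_subtype_val).subtype_mk
        fun z => z.2.2))).congr fun z => ?_
    simp only [domRestrict_apply]
    rw [dif_pos ⟨z.2.1, z.2.2⟩]
    rfl
  · simp only
    rw [dif_pos ⟨hx, hs⟩]
    exact hf p x a hx ⟨s, hs⟩

end Hocolim

/-! ### Operations on weights -/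

section Weights

variable {P : Type} [PartialOrder P] [Fintype P]

omit [Fintype P] in
theorem IsChain.of_forall_ne_zero {w w' : P → ℝ} (hw : IsChain (· ≤ ·) {q | w q ≠ 0})
    (h : ∀ q, w' q ≠ 0 → w q ≠ 0) : IsChain (· ≤ ·) {q | w' q ≠ 0} :=
  hw.mono fun q hq => h q hq

omit [PartialOrder P] in
theorem eq_one_of_forall_ne_zero {w : P → ℝ} (hw : w ∈ stdSimplex ℝ P) {c : P}
    (h : ∀ q, w q ≠ 0 → q = c) : w c = 1 := by
  rw [← hw.2]
  exact (Finset.sum_eq_single c (fun q _ hq => by_contra fun h' => hq (h q h')) (by simp)).symm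

open Classical in
/-- The vertex `c`, as a weight. -/
def vertexWeight (c : P) : P → ℝ := fun q => if q = c then 1 else 0

omit [PartialOrder P] in
theorem vertexWeight_mem (c : P) : vertexWeight c ∈ stdSimplex ℝ P :=
  ⟨fun q => by unfold vertexWeight; split_ifs <;> norm_num, by classical simp [vertexWeight, Finset.sum_ite_eq']⟩

/-- The motion of a weight on a straight line towards the vertex `c`. -/
def towardsVertex (c : P) (w : P → ℝ) (s : ℝ) : P → ℝ :=
  fun q => (1 - s) * w q + s * vertexWeight c q

omit [PartialOrder P] [Fintype P] in
theorem towardsVertex_self (c : P) (w : P → ℝ) (s : ℝ) :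
    towardsVertex c w s c = (1 - s) * w c + s := by
  simp [towardsVertex, vertexWeight]

omit [PartialOrder P] [Fintype P] in
theorem towardsVertex_of_ne {c q : P} (h : q ≠ c) (w : P → ℝ) (s : ℝ) :
    towardsVertex c w s q = (1 - s) * w q := by
  simp [towardsVertex, vertexWeight, h]

omit [PartialOrder P] in
theorem towardsVertex_mem (c : P) {w : P → ℝ} (hw : w ∈ stdSimplex ℝ P) {s : ℝ}
    (hs : s ∈ Icc (0 : ℝ) 1) : towardsVertex c w s ∈ stdSimplex ℝ P :=
  (convex_stdSimplex ℝ P) hw (vertexWeight_mem c) (by linarith [hs.2]) hs.1 (by ring)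

omit [PartialOrder P] [Fintype P] in
theorem ne_zero_or_of_towardsVertex_ne_zero {c q : P} {w : P → ℝ} {s : ℝ}
    (h : towardsVertex c w s q ≠ 0) : w q ≠ 0 ∨ q = c := by
  by_contra! hcon
  exact h (by rw [towardsVertex_of_ne hcon.2, hcon.1, mul_zero])

/-- The motion of a weight on a straight line towards the face opposite to the vertex `c`. -/
def awayFromVertex (c : P) (w : P → ℝ) (s : ℝ) : P → ℝ :=
  open Classical in fun q => if q = c then (1 - s) * w c else w q * (1 - s + s * (1 - w c)⁻¹)

omit [PartialOrder P] [Fintype P] in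
theorem awayFromVertex_self (c : P) (w : P → ℝ) (s : ℝ) :
    awayFromVertex c w s c = (1 - s) * w c := by
  simp [awayFromVertex]

omit [PartialOrder P] [Fintype P] in
theorem awayFromVertex_of_ne {c q : P} (h : q ≠ c) (w : P → ℝ) (s : ℝ) :
    awayFromVertex c w s q = w q * (1 - s + s * (1 - w c)⁻¹) := by
  simp [awayFromVertex, h]

omit [PartialOrder P] [Fintype P] in
theorem ne_zero_of_awayFromVertex_ne_zero {c q : P} {w : P → ℝ} {s : ℝ}
    (h : awayFromVertex c w s q ≠ 0) : w q ≠ 0 := by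
  intro hq
  by_cases hc : q = c
  · subst hc; exact h (by rw [awayFromVertex_self, hq, mul_zero])
  · exact h (by rw [awayFromVertex_of_ne hc, hq, zero_mul])

omit [PartialOrder P] in
theorem awayFromVertex_mem {c : P} {w : P → ℝ} (hw : w ∈ stdSimplex ℝ P) (hc : w c < 1) {s : ℝ}
    (hs : s ∈ Icc (0 : ℝ) 1) : awayFromVertex c w s ∈ stdSimplex ℝ P := by
  classical
  have h1 : 0 < 1 - w c := by linarith
  have h2 : 0 ≤ 1 - s := by linarith [hs.2]
  have h3 : 0 ≤ 1 - s + s * (1 - w c)⁻¹ := add_nonneg h2 (mul_nonneg hs.1 (inv_nonneg.2 h1.le))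
  refine ⟨fun q => ?_, ?_⟩
  · by_cases hq : q = c
    · subst hq; rw [awayFromVertex_self]; exact mul_nonneg h2 (hw.1 _)
    · rw [awayFromVertex_of_ne hq]; exact mul_nonneg (hw.1 _) h3
  · have h4 : ∑ q ∈ Finset.univ.erase c, w q = 1 - w c := by
      rw [← hw.2, ← Finset.add_sum_erase _ _ (Finset.mem_univ c)]; ring
    rw [← Finset.add_sum_erase _ _ (Finset.mem_univ c), awayFromVertex_self,
      Finset.sum_congr rfl fun q hq => awayFromVertex_of_ne (Finset.ne_of_mem_erase hq) w s,
      ← Finset.sum_mul, h4]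
    field_simp
    ring

/-- The part of the mass of a weight at `q` that is among the upper part of size `s`. -/
def upperPart (w : P → ℝ) (s : ℝ) (q : P) : ℝ :=
  open Classical in max 0 (min (w q) (s - ∑ q' ∈ Finset.univ.filter (q < ·), w q'))

theorem upperPart_nonneg (w : P → ℝ) (s : ℝ) (q : P) : 0 ≤ upperPart w s q := le_max_left _ _

theorem upperPart_le {w : P → ℝ} (hw : ∀ q, 0 ≤ w q) (s : ℝ) (q : P) : upperPart w s q ≤ w q :=
  max_le (hw q) (min_le_left _ _)

theorem upperPart_eq_zero {w : P → ℝ} (hw : ∀ q, 0 ≤ w q) {s : ℝ} {q : P} (hq : w q = 0) :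
    upperPart w s q = 0 :=
  le_antisymm ((upperPart_le hw s q).trans hq.le) (upperPart_nonneg w s q)

theorem upperPart_zero {w : P → ℝ} (hw : ∀ q, 0 ≤ w q) (q : P) : upperPart w 0 q = 0 := by
  refine max_eq_left ((min_le_right _ _).trans ?_)
  rw [zero_sub, neg_nonpos]
  exact Finset.sum_nonneg fun i _ => hw i

theorem upperPart_one {w : P → ℝ} (hw : w ∈ stdSimplex ℝ P) (q : P) : upperPart w 1 q = w q := by
  classical
  have h : w q + ∑ q' ∈ Finset.univ.filter (q < ·), w q' ≤ 1 := by
    rw [← hw.2, ← Finset.sum_insert (by simp)]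
    exact Finset.sum_le_sum_of_subset_of_nonneg (Finset.subset_univ _) fun i _ _ => hw.1 i
  unfold upperPart
  rw [min_eq_left, max_eq_right (hw.1 q)]
  convert le_sub_iff_add_le.2 h

/-- The upper part is filled from the top: a positive amount is taken at `q` only if the amount `s`
exceeds the mass strictly above `q`, to which `q'` contributes. -/
theorem upperPart_eq_of_lt {w : P → ℝ} (hw : ∀ q, 0 ≤ w q) {s : ℝ} {q q' : P} (h : q < q')
    (hq : upperPart w s q ≠ 0) : upperPart w s q' = w q' := by
  classical
  have h1 : 0 < s - ∑ q'' ∈ Finset.univ.filter (q < ·), w q'' := by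
    by_contra! hcon
    refine hq (max_eq_left ((min_le_right _ _).trans ?_))
    convert hcon
  have h2 : w q' + ∑ q'' ∈ Finset.univ.filter (q' < ·), w q'' ≤
      ∑ q'' ∈ Finset.univ.filter (q < ·), w q'' := by
    rw [← Finset.sum_insert (by simp)]
    refine Finset.sum_le_sum_of_subset_of_nonneg ?_ fun i _ _ => hw i
    intro i hi
    rcases Finset.mem_insert.1 hi with rfl | hi
    · simpa using h
    · simpa using h.trans (by simpa using hi)
  unfold upperPart
  rw [min_eq_left, max_eq_right (hw q')]
  have : w q' ≤ s - ∑ q'' ∈ Finset.univ.filter (q' < ·), w q'' := by linarith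
  convert this

theorem continuous_upperPart (q : P) :
    Continuous fun z : (P → ℝ) × ℝ => upperPart z.1 z.2 q := by
  unfold upperPart
  fun_prop

/-- The homotopy from the identity to the map on weights induced by a map `r` with `q ≤ r q`: at time
`s`, the upper part of size `s` of the mass is moved along `r`. -/
def prismMotion (r : P → P) (w : P → ℝ) (s : ℝ) : P → ℝ :=
  open Classical in fun q => w q - upperPart w s q +
    ∑ q' ∈ Finset.univ.filter (fun q' => r q' = q), upperPart w s q'

theorem prismMotion_mem (r : P → P) {w : P → ℝ} (hw : w ∈ stdSimplex ℝ P) (s : ℝ) :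
    prismMotion r w s ∈ stdSimplex ℝ P := by
  classical
  refine ⟨fun q => add_nonneg (sub_nonneg.2 (upperPart_le hw.1 s q))
    (Finset.sum_nonneg fun i _ => upperPart_nonneg w s i), ?_⟩
  have h : ∑ q, ∑ q' ∈ Finset.univ.filter (fun q' => r q' = q), upperPart w s q' =
      ∑ q, upperPart w s q := Finset.sum_fiberwise Finset.univ r (upperPart w s)
  unfold prismMotion
  rw [Finset.sum_add_distrib, Finset.sum_sub_distrib, hw.2]
  have h' : ∀ x y : ℝ, x = y → 1 - y + x = 1 := fun x y hxy => by rw [hxy]; ring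
  apply h'
  convert h

theorem of_prismMotion_ne_zero {r : P → P} {w : P → ℝ} (hw : ∀ q, 0 ≤ w q) {s : ℝ} {q : P}
    (hq : prismMotion r w s q ≠ 0) :
    (w q ≠ 0 ∧ upperPart w s q ≠ w q) ∨ ∃ q', w q' ≠ 0 ∧ upperPart w s q' ≠ 0 ∧ r q' = q := by
  classical
  by_contra! hcon
  refine hq ?_
  unfold prismMotion
  have h1 : w q - upperPart w s q = 0 := by
    by_cases h : w q = 0
    · rw [upperPart_eq_zero hw h, h, sub_zero]
    · rw [hcon.1 h, sub_self]
  rw [h1, zero_add]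
  refine Finset.sum_eq_zero fun q' hq' => by_contra fun h => ?_
  exact hcon.2 q' (fun h' => h (upperPart_eq_zero hw h')) h (by simpa using hq')

/-- If `q` is not completely moved and some mass of `q'` is, then q ≤ q', because everything above a
partly moved element is moved completely. So q ≤ q' ≤ r q'. A linear homotopy would not do: a chain
together with its image under `r` need not be a chain. -/
theorem isChain_prismMotion {r : P → P} {w : P → ℝ} (hw : ∀ q, 0 ≤ w q)
    (hch : IsChain (· ≤ ·) {q | w q ≠ 0}) (hle : ∀ q, w q ≠ 0 → q ≤ r q)
    (hr : ∀ q q', w q ≠ 0 → w q' ≠ 0 → q ≤ q' → r q ≤ r q') (s : ℝ) :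
    IsChain (· ≤ ·) {q | prismMotion r w s q ≠ 0} := by
  have key : ∀ q q', w q ≠ 0 → upperPart w s q ≠ w q → w q' ≠ 0 → upperPart w s q' ≠ 0 →
      q ≤ r q' := by
    intro q q' hq hq1 hq' hq1'
    rcases hch.total hq hq' with h | h
    · exact h.trans (hle q' hq')
    · rcases eq_or_lt_of_le h with rfl | h
      · exact hle _ hq
      · exact absurd (upperPart_eq_of_lt hw h hq1') hq1
  intro a ha b hb _
  rcases of_prismMotion_ne_zero hw ha with ⟨h1, h2⟩ | ⟨a', h1, h2, rfl⟩ <;>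
    rcases of_prismMotion_ne_zero hw hb with ⟨h3, h4⟩ | ⟨b', h3, h4, rfl⟩
  · exact hch.total h1 h3
  · exact Or.inl (key _ _ h1 h2 h3 h4)
  · exact Or.inr (key _ _ h3 h4 h1 h2)
  · exact (hch.total h1 h3).imp (hr _ _ h1 h3) (hr _ _ h3 h1)

theorem prismMotion_zero (r : P → P) {w : P → ℝ} (hw : ∀ q, 0 ≤ w q) : prismMotion r w 0 = w := by
  funext q
  simp [prismMotion, upperPart_zero hw]

theorem of_prismMotion_one_ne_zero {r : P → P} {w : P → ℝ} (hw : w ∈ stdSimplex ℝ P) {q : P}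
    (hq : prismMotion r w 1 q ≠ 0) : ∃ q', w q' ≠ 0 ∧ r q' = q := by
  rcases of_prismMotion_ne_zero hw.1 hq with ⟨_, h⟩ | ⟨q', h1, -, h2⟩
  · exact absurd (upperPart_one hw q) h
  · exact ⟨q', h1, h2⟩

/-- The prism motion does not change the weight of a vertex which is only moved to itself. -/
theorem prismMotion_fixed {r : P → P} {w : P → ℝ} (hw : ∀ q, 0 ≤ w q) {c : P} (hc : r c = c)
    (h : ∀ q, w q ≠ 0 → r q = c → q = c) (s : ℝ) : prismMotion r w s c = w c := by
  classical
  unfold prismMotion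
  rw [Finset.sum_eq_single c (fun q hq hqc => by_contra fun hne => hqc
    (h q (fun h' => hne (upperPart_eq_zero hw h')) (by simpa using hq))) (by simp [hc])]
  ring

theorem continuous_prismMotion (r : P → P) (q : P) :
    Continuous fun z : (P → ℝ) × ℝ => prismMotion r z.1 z.2 q := by
  have h := continuous_upperPart (P := P)
  unfold prismMotion
  fun_prop

variable {P' : Type} [PartialOrder P'] [Fintype P']

/-- The restriction of a weight to a sub-poset that contains all vertices in its support apart from
the vertex `c`. -/
def restrictWeight (f : P' →o P) (c : P) (w : P → ℝ) : P' → ℝ := fun q => w (f q) * (1 - w c)⁻¹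

theorem sum_weight_restrict {f : P' →o P} (hf : Function.Injective f) {c : P} (hc : ∀ q, f q ≠ c)
    {w : P → ℝ} (hsupp : ∀ q, w q ≠ 0 → q = c ∨ q ∈ range f) :
    w c + ∑ q, w (f q) = ∑ q, w q := by
  -- The vertex `c` and the sub-poset together, as one injection, whose range contains the support.
  let e : Option P' → P := fun o => o.elim c f
  have he : Function.Injective e := by
    rintro (_ | a) (_ | b) h
    · rfl
    · exact absurd h.symm (hc b)
    · exact absurd h (hc a)
    · exact congrArg some (hf h)
  rw [← Fintype.sum_of_injective e he (fun o => w (e o)) w ?_ fun _ => rfl, Fintype.sum_option]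
  · rfl
  · intro q hq
    by_contra h
    rcases hsupp q h with rfl | ⟨a, rfl⟩
    · exact hq ⟨none, rfl⟩
    · exact hq ⟨some a, rfl⟩

theorem restrictWeight_mem {f : P' →o P} (hf : Function.Injective f) {c : P} (hc : ∀ q, f q ≠ c)
    {w : P → ℝ} (hw : w ∈ stdSimplex ℝ P) (hwc : w c < 1)
    (hsupp : ∀ q, w q ≠ 0 → q = c ∨ q ∈ range f) : restrictWeight f c w ∈ stdSimplex ℝ P' := by
  have h1 : 0 < 1 - w c := by linarith
  refine ⟨fun q => mul_nonneg (hw.1 _) (inv_nonneg.2 h1.le), ?_⟩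
  unfold restrictWeight
  rw [← Finset.sum_mul, mul_inv_eq_one₀ h1.ne', eq_sub_iff_add_eq', sum_weight_restrict hf hc hsupp,
    hw.2]

theorem UnderComplex.map_apply {f : P' →o P} (hf : Function.Injective f) {p : P'}
    (x : UnderComplex p) (q : P') : (x.map f).1 (f q) = x.1 q := by
  classical
  change stdSimplex.map f x.1 (f q) = _
  rw [stdSimplex.map_coe, FunOnFinite.linearMap_apply_apply]
  refine Finset.sum_eq_single_of_mem q (by simp) fun q' hq' hne => ?_
  exact absurd (hf (by simpa using hq')) hne

theorem UnderComplex.map_apply_of_notMem (f : P' →o P) {p : P'} (x : UnderComplex p) {q : P}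
    (hq : q ∉ range f) : (x.map f).1 q = 0 := by
  classical
  change stdSimplex.map f x.1 q = _
  rw [stdSimplex.map_coe, FunOnFinite.linearMap_apply_apply]
  exact Finset.sum_eq_zero fun q' hq' => absurd ⟨q', by simpa using hq'⟩ hq

end Weights

/-! ### The order of the categories of pearled trees -/

namespace PearledTree

variable {k : ℕ} (hk : 2 ≤ k)

theorem not_corolla_le_corollaPrime : ¬ corolla k ≤ corollaPrime hk := fun h =>
  corollaPrime_ne_corolla hk (top_le_iff.1 h)

/-- Contraction of the edge to the pearl from a vertex that has all leaves, but not the pearl, above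
it. -/
def prune : PearledTree k →o PearledTree k where
  toFun T :=
    { vertices := T.vertices.erase (Finset.univ.erase none)
      root_mem := Finset.mem_erase.2
        ⟨fun h => Finset.notMem_erase none Finset.univ (h ▸ Finset.mem_univ none), T.root_mem⟩
      laminar := fun v hv w hw =>
        T.laminar v (Finset.mem_of_mem_erase hv) w (Finset.mem_of_mem_erase hw)
      arity := fun v hv => T.arity v (Finset.mem_of_mem_erase hv) }
  monotone' _ _ h := Finset.erase_subset_erase _ h

theorem le_prune (T : PearledTree k) : T ≤ prune T := Finset.erase_subset _ _

/-- A tree has a morphism to c'_k only if it contains the vertex of c'_k other than the root, which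
is the one that pruning deletes. -/
theorem not_prune_le_corollaPrime (T : PearledTree k) : ¬ prune T ≤ corollaPrime hk := by
  intro h
  have : Finset.univ.erase none ∈ (prune T).vertices := h (by simp [corollaPrime])
  exact Finset.notMem_erase _ _ this

theorem eq_of_prune_eq_corolla {T : PearledTree k} (h : prune T = corolla k) :
    T = corollaPrime hk ∨ T = corolla k := by
  refine eq_of_corollaPrime_le hk (show T.vertices ⊆ _ from fun v hv => ?_)
  by_cases hv' : v = Finset.univ.erase none
  · simp [corollaPrime, hv']
  · have h1 : v ∈ (prune T).vertices := Finset.mem_erase.2 ⟨hv', hv⟩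
    rw [h] at h1
    simp [corollaPrime, Finset.mem_singleton.1 h1]

theorem prune_corolla : prune (corolla k) = corolla k :=
  le_antisymm (le_top (α := PearledTree k)) (le_prune _)

end PearledTree

namespace PsiPrime

variable {k : ℕ} (hk : 2 ≤ k)

/-- The pearled corolla, as an object of `Ψ'_k`. -/
def cor : PsiPrime hk := ⟨corolla k⟩

variable {hk}

theorem eq_cor_of_le {q : PsiPrime hk} (h : cor hk ≤ q) : q = cor hk :=
  PsiPrime.ext (top_le_iff.1 (show (⊤ : PearledTree k) ≤ q.tree from h.1))

/-- `cor hk` is maximal in Ψ'_k but not a greatest element: only c'_k is not below it, its arrow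
having been removed. -/
theorem le_cor_of_ne {q : PsiPrime hk} (h : q.tree ≠ corollaPrime hk) : q ≤ cor hk :=
  ⟨show q.tree ≤ ⊤ from le_top, fun e => h e.1⟩

theorem ne_of_le_cor {q : PsiPrime hk} (h : q ≤ cor hk) : q.tree ≠ corollaPrime hk :=
  fun e => h.2 ⟨e, rfl⟩

theorem ofBoundary_le {p q : Boundary (PearledTree k)}
    (h : ofBoundary hk p ≤ ofBoundary hk q) : p ≤ q := h.1

theorem ofBoundary_injective : Function.Injective (ofBoundary hk) := fun _ _ h =>
  Subtype.ext (congrArg PsiPrime.tree h)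

theorem ofBoundary_ne_cor (p : Boundary (PearledTree k)) : ofBoundary hk p ≠ cor hk := fun h =>
  p.2 (isTop_iff_eq_top.2 (show p.1 = ⊤ from congrArg PsiPrime.tree h))

theorem exists_ofBoundary {q : PsiPrime hk} (h : q ≠ cor hk) : ∃ p, ofBoundary hk p = q :=
  ⟨⟨q.tree, fun h' => h (PsiPrime.ext (show q.tree = ⊤ from isTop_iff_eq_top.1 h'))⟩, rfl⟩

variable (hk) in
/-- The inclusion functor `∂Ψ_k^U → Ψ'_k`. -/
def ofBoundaryU : Boundary (PsiU hk) →o PsiPrime hk :=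
  ⟨fun T => ⟨T.1.1⟩, fun T _ h => ⟨h, fun e => T.1.2 e.1.le⟩⟩

theorem ofBoundaryU_le {p q : Boundary (PsiU hk)} (h : ofBoundaryU hk p ≤ ofBoundaryU hk q) :
    p ≤ q := h.1

theorem ofBoundaryU_injective : Function.Injective (ofBoundaryU hk) := fun _ _ h =>
  Subtype.ext (Subtype.ext (congrArg PsiPrime.tree h))

theorem ofBoundaryU_ne_cor (p : Boundary (PsiU hk)) : ofBoundaryU hk p ≠ cor hk := fun h =>
  p.2 fun r => show r.1 ≤ p.1.1 from le_top.trans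
    (show (⊤ : PearledTree k) ≤ p.1.1 from (congrArg PsiPrime.tree h).ge)

theorem ofBoundaryU_le_cor (p : Boundary (PsiU hk)) : ofBoundaryU hk p ≤ cor hk :=
  le_cor_of_ne fun e => p.1.2 (le_of_eq e)

theorem exists_ofBoundaryU {q : PsiPrime hk} (h : ¬ q.tree ≤ corollaPrime hk) (h' : q ≠ cor hk) :
    ∃ p, ofBoundaryU hk p = q :=
  ⟨⟨⟨q.tree, h⟩, fun ht => h' (PsiPrime.ext (top_le_iff.1
    (show (⊤ : PearledTree k) ≤ q.tree from ht ⟨corolla k, not_corolla_le_corollaPrime hk⟩)))⟩, rfl⟩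

variable (hk) in
/-- The map from `Ψ'_k` to itself that contracts the edge to the pearl from a vertex that has all
leaves, but not the pearl, above it. -/
def pruned : PsiPrime hk →o PsiPrime hk :=
  ⟨fun q => ⟨prune q.tree⟩, fun q _ h => ⟨prune.monotone h.1, fun e =>
    not_prune_le_corollaPrime hk q.tree e.1.le⟩⟩

/-- For c'_k the inequality fails, since pruning turns it into c_k; the hypothesis excludes this
tree. -/
theorem le_pruned {q : PsiPrime hk} (h : q ≤ cor hk) : q ≤ pruned hk q :=
  ⟨le_prune q.tree, fun e => ne_of_le_cor h e.1⟩

theorem pruned_cor : pruned hk (cor hk) = cor hk := PsiPrime.ext prune_corolla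

theorem eq_cor_of_pruned {q : PsiPrime hk} (h : q ≤ cor hk) (hq : pruned hk q = cor hk) :
    q = cor hk :=
  PsiPrime.ext ((eq_of_prune_eq_corolla hk (congrArg PsiPrime.tree hq)).resolve_left
    (ne_of_le_cor h))

theorem exists_ofBoundaryU_eq_pruned {q : PsiPrime hk} (h : q ≤ cor hk) (hq : q ≠ cor hk) :
    ∃ p, ofBoundaryU hk p = pruned hk q :=
  exists_ofBoundaryU (not_prune_le_corollaPrime hk q.tree) fun e => hq (eq_cor_of_pruned h e)

/-- Positive weight at the maximal element `cor hk` keeps c'_k out of the support, so pruning is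
increasing on it. -/
theorem le_cor_of_isChain {w : PsiPrime hk → ℝ} (hw : IsChain (· ≤ ·) {q | w q ≠ 0})
    (hc : w (cor hk) ≠ 0) {q : PsiPrime hk} (hq : w q ≠ 0) : q ≤ cor hk :=
  (hw.total hq hc).elim id fun h => (eq_cor_of_le h).le

end PsiPrime

open PsiPrime

/-! ### The prism homotopy of pruning where the weight of c_k is positive. -/

section PruneMotion

variable {k : ℕ} {hk : 2 ≤ k} {w : PsiPrime hk → ℝ}

/-- Among the trees in the support only c_k is pruned to c_k, so no mass arrives there: the homotopy
preserves the height t. -/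
theorem prismMotion_pruned_cor (hw : w ∈ stdSimplex ℝ (PsiPrime hk))
    (hch : IsChain (· ≤ ·) {q | w q ≠ 0}) (hc : 0 < w (cor hk)) (s : ℝ) :
    prismMotion (pruned hk) w s (cor hk) = w (cor hk) :=
  prismMotion_fixed hw.1 pruned_cor
    (fun _ hq => eq_cor_of_pruned (le_cor_of_isChain hch hc.ne' hq)) s

theorem isChain_prismMotion_pruned (hw : w ∈ stdSimplex ℝ (PsiPrime hk))
    (hch : IsChain (· ≤ ·) {q | w q ≠ 0}) (hc : 0 < w (cor hk)) (s : ℝ) :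
    IsChain (· ≤ ·) {q | prismMotion (pruned hk) w s q ≠ 0} :=
  isChain_prismMotion hw.1 hch (fun _ hq => le_pruned (le_cor_of_isChain hch hc.ne' hq))
    (fun _ _ _ _ h => (pruned hk).monotone h) s

theorem eq_cor_or_mem_range_of_prismMotion_ne_zero (hw : w ∈ stdSimplex ℝ (PsiPrime hk))
    (hch : IsChain (· ≤ ·) {q | w q ≠ 0}) (hc : 0 < w (cor hk)) {q : PsiPrime hk}
    (hq : prismMotion (pruned hk) w 1 q ≠ 0) : q = cor hk ∨ q ∈ range (ofBoundaryU hk) := by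
  obtain ⟨q', hq', rfl⟩ := of_prismMotion_one_ne_zero hw hq
  have h := le_cor_of_isChain hch hc.ne' hq'
  by_cases hne : q' = cor hk
  · exact Or.inl (by rw [hne, pruned_cor])
  · exact Or.inr (exists_ofBoundaryU_eq_pruned h hne)

end PruneMotion

/-! ### The cylinder decomposition of the homotopy colimit over `Ψ'_k` -/

section Decomposition

open Hocolim

variable {k : ℕ} {hk : 2 ≤ k} {ρ : PearledTree k ⥤ TopCat.{u}}

variable (hk ρ) in
/-- The homotopy colimit over `Ψ'_k`. -/
abbrev HocolimPrime : Type u := Hocolim ((PsiPrime.incl hk).monotone.functor ⋙ ρ)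

variable (hk ρ) in
/-- The homotopy colimit over `∂Ψ_k^U`. -/
abbrev HocolimBoundaryU : Type u := Hocolim ((boundaryPsiUIncl hk).monotone.functor ⋙ ρ)

variable (ρ) in
/-- The homotopy colimit over `∂Ψ_k`. -/
abbrev HocolimBoundary : Type u := Hocolim ((Boundary.incl (PearledTree k)).monotone.functor ⋙ ρ)

variable (hk ρ) in
/-- The points of the homotopy colimit over `Ψ'_k`. -/
abbrev mkPrime (p : PsiPrime hk) (x : UnderComplex p) (a : ρ.obj p.tree) : HocolimPrime hk ρ :=
  mk ((PsiPrime.incl hk).monotone.functor ⋙ ρ) p x a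

variable (hk ρ) in
/-- The points of the homotopy colimit over `∂Ψ_k^U`. -/
abbrev mkBoundaryU (p : Boundary (PsiU hk)) (x : UnderComplex p) (a : ρ.obj p.1.1) :
    HocolimBoundaryU hk ρ :=
  mk ((boundaryPsiUIncl hk).monotone.functor ⋙ ρ) p x a

variable (ρ) in
/-- The points of the homotopy colimit over `∂Ψ_k`. -/
abbrev mkBoundary (p : Boundary (PearledTree k)) (x : UnderComplex p) (a : ρ.obj p.1) :
    HocolimBoundary ρ :=
  mk ((Boundary.incl (PearledTree k)).monotone.functor ⋙ ρ) p x a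

theorem map_map_apply {T T' T'' : PearledTree k} (h : T ≤ T') (h' : T' ≤ T'') (a : ρ.obj T) :
    ρ.map (homOfLE h') (ρ.map (homOfLE h) a) = ρ.map (homOfLE (h.trans h')) a := by
  rw [← homOfLE_comp h h', ρ.map_comp]
  rfl

/-- For comparing two representatives over different objects: equal weights suffice once the point
of the diagram has been transported. -/
theorem mkPrime_eq {p p' : PsiPrime hk} (h : p ≤ p') {x : UnderComplex p} {x' : UnderComplex p'}
    (hx : ∀ q, x.1 q = x'.1 q) (a : ρ.obj p.tree) :
    mkPrime hk ρ p x a = mkPrime hk ρ p' x' (ρ.map (homOfLE h.1) a) := by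
  obtain rfl : x = x'.incl h := underComplex_ext hx
  exact mk_incl (F := (PsiPrime.incl hk).monotone.functor ⋙ ρ) h x' a

/-- As nothing lies strictly above c_k, the complex under it is a single vertex, of weight 1. -/
theorem ne_cor_of_lt {p : PsiPrime hk} {x : UnderComplex p} (hx : x.1 (cor hk) < 1) :
    p ≠ cor hk := by
  rintro rfl
  exact hx.ne (eq_one_of_forall_ne_zero x.1.2 fun q hq => eq_cor_of_le (x.2.2 q hq))

theorem map_ofBoundaryU_cor {p : Boundary (PsiU hk)} (x : UnderComplex p) :
    (x.map (ofBoundaryU hk)).1 (cor hk) = 0 :=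
  UnderComplex.map_apply_of_notMem _ x fun ⟨q, hq⟩ => ofBoundaryU_ne_cor q hq

theorem map_ofBoundary_cor {p : Boundary (PearledTree k)} (x : UnderComplex p) :
    (x.map (ofBoundary hk)).1 (cor hk) = 0 :=
  UnderComplex.map_apply_of_notMem _ x fun ⟨q, hq⟩ => ofBoundary_ne_cor q hq

variable (hk ρ)

/-- The map `(a, u) ↦ (1 - u) a + u c_k` from the cylinder on the homotopy colimit over `∂Ψ_k^U`. -/
theorem exists_cylinder : ∃ cyl : C(HocolimBoundaryU hk ρ × ℝ, HocolimPrime hk ρ),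
    ∀ p x a, ∀ u ∈ Icc (0 : ℝ) 1, ∃ x' : UnderComplex (ofBoundaryU hk p),
      (∀ q, x'.1 q = towardsVertex (cor hk) (x.map (ofBoundaryU hk)).1 u q) ∧
        cyl (mkBoundaryU hk ρ p x a, u) = mkPrime hk ρ (ofBoundaryU hk p) x' a := by
  -- All trees of ∂Ψ_k^U map to c_k in Ψ'_k, so adjoining c_k to a chain of them gives a chain.
  have hle : ∀ p (x : UnderComplex p) q, (x.map (ofBoundaryU hk)).1 q ≠ 0 → q ≤ cor hk := by
    intro p x q hq
    by_contra h
    refine hq (UnderComplex.map_apply_of_notMem _ x ?_)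
    rintro ⟨q', rfl⟩
    exact h (ofBoundaryU_le_cor q')
  let x' : ∀ p, UnderComplex p → Icc (0 : ℝ) 1 → UnderComplex (ofBoundaryU hk p) := fun p x u =>
    ⟨⟨towardsVertex (cor hk) (x.map (ofBoundaryU hk)).1 u,
      towardsVertex_mem _ (x.map (ofBoundaryU hk)).1.2 u.2⟩, by
        intro q hq q' hq' _
        rcases ne_zero_or_of_towardsVertex_ne_zero hq with h | rfl <;>
          rcases ne_zero_or_of_towardsVertex_ne_zero hq' with h' | rfl
        · exact (x.map (ofBoundaryU hk)).2.1.total h h'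
        · exact Or.inl (hle p x q h)
        · exact Or.inr (hle p x q' h')
        · exact Or.inl le_rfl, by
        intro q hq
        rcases ne_zero_or_of_towardsVertex_ne_zero hq with h | rfl
        · exact (x.map (ofBoundaryU hk)).2.2 q h
        · exact ofBoundaryU_le_cor p⟩
  obtain ⟨f, hf⟩ := exists_lift (F := (boundaryPsiUIncl hk).monotone.functor ⋙ ρ) isOpen_univ
    (fun p z u => mkPrime hk ρ (ofBoundaryU hk p) (x' p z.1.1 u) z.1.2)
    (fun p p' h x a _ _ u => mk_incl (F := (PsiPrime.incl hk).monotone.functor ⋙ ρ)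
      ((ofBoundaryU hk).monotone h) (x' p' x u) a)
    (fun p _ => continuous_mk_comp (F := (PsiPrime.incl hk).monotone.functor ⋙ ρ)
      (fun q => ((continuous_const.sub (continuous_subtype_val.comp continuous_snd)).mul
        ((continuous_underComplex_apply q).comp ((UnderComplex.continuous_map _ p).comp
          continuous_piece_fst))).add
        ((continuous_subtype_val.comp continuous_snd).mul continuous_const))
      continuous_piece_snd)
  refine ⟨f.comp ⟨fun z => (⟨z.1, mem_univ _⟩, projIcc 0 1 zero_le_one z.2),
    (continuous_fst.subtype_mk _).prodMk (continuous_projIcc.comp continuous_snd)⟩, ?_⟩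
  intro p x a u hu
  refine ⟨x' p x ⟨u, hu⟩, fun _ => rfl, ?_⟩
  have := hf p x a (mem_univ _) ⟨u, hu⟩
  simpa only [ContinuousMap.comp_apply, ContinuousMap.coe_mk, projIcc_of_mem _ hu] using this

/-- The map from the part of the homotopy colimit over `Ψ'_k` with weight of `c_k` in `(0, 1)` to the
homotopy colimit over `∂Ψ_k^U`, given by pruning and projection from `c_k`. -/
theorem exists_retraction :
    ∃ retr : C({y : HocolimPrime hk ρ | 0 < weight y (cor hk) ∧ weight y (cor hk) < 1},
        HocolimBoundaryU hk ρ),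
      ∀ p x a (hm : 0 < weight (mkPrime hk ρ p x a) (cor hk) ∧
          weight (mkPrime hk ρ p x a) (cor hk) < 1),
        ∃ (p' : Boundary (PsiU hk)) (hp : p ≤ ofBoundaryU hk p') (x' : UnderComplex p'),
          (∀ q, x'.1 q = restrictWeight (ofBoundaryU hk) (cor hk)
            (prismMotion (pruned hk) x.1 1) q) ∧
          retr ⟨mkPrime hk ρ p x a, hm⟩ = mkBoundaryU hk ρ p' x' (ρ.map (homOfLE hp.1) a) := by
  let F := (PsiPrime.incl hk).monotone.functor ⋙ ρ
  let V : Set (HocolimPrime hk ρ) := {y | 0 < weight y (cor hk) ∧ weight y (cor hk) < 1}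
  have hcw : Continuous fun y : HocolimPrime hk ρ => weight y (cor hk) :=
    (continuous_apply _).comp continuous_weight
  have hV : IsOpen V := (isOpen_lt continuous_const hcw).inter (isOpen_lt hcw continuous_const)
  have hle : ∀ p (z : Piece (F := F) V p), p ≤ cor hk := fun p z => z.1.1.2.2 _ z.2.1.ne'
  -- The new index is the pruned tree, which lies in ∂Ψ_k^U as p is neither c_k nor c'_k; `e` is
  -- monotone, so the gluing relations are preserved.
  have hex : ∀ p, p ≤ cor hk → p ≠ cor hk → ∃ p', ofBoundaryU hk p' = pruned hk p :=
    fun p => exists_ofBoundaryU_eq_pruned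
  choose e he using hex
  have hne : ∀ p (z : Piece (F := F) V p), p ≠ cor hk := fun p z => ne_cor_of_lt z.2.2
  have hple : ∀ p h h', p ≤ ofBoundaryU hk (e p h h') := fun p h h' =>
    (le_pruned h).trans (he p h h').ge
  have hee : ∀ p p' (h : p ≤ p') h1 h2 h3 h4, e p h1 h2 ≤ e p' h3 h4 := fun p p' h h1 h2 h3 h4 =>
    ofBoundaryU_le (by rw [he, he]; exact (pruned hk).monotone h)
  -- At time 1 the prism motion has pushed the whole weight forward along pruning. Dropping the
  -- weight at c_k, which is still less than 1, and renormalizing leaves a weight on ∂Ψ_k^U.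
  let x' : ∀ p (z : Piece (F := F) V p) h h', UnderComplex (e p h h') := fun p z h h' =>
    ⟨⟨restrictWeight (ofBoundaryU hk) (cor hk) (prismMotion (pruned hk) z.1.1.1 1),
      restrictWeight_mem ofBoundaryU_injective ofBoundaryU_ne_cor
        (prismMotion_mem _ z.1.1.1.2 1)
        ((prismMotion_pruned_cor z.1.1.1.2 z.1.1.2.1 z.2.1 1).trans_lt z.2.2)
        fun q => eq_cor_or_mem_range_of_prismMotion_ne_zero z.1.1.1.2 z.1.1.2.1 z.2.1⟩, by
      intro q hq q' hq' _
      exact ((isChain_prismMotion_pruned z.1.1.1.2 z.1.1.2.1 z.2.1 1).total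
        (left_ne_zero_of_mul hq) (left_ne_zero_of_mul hq')).imp ofBoundaryU_le ofBoundaryU_le, by
      intro q hq
      obtain ⟨q', hq', h1⟩ := of_prismMotion_one_ne_zero z.1.1.1.2 (left_ne_zero_of_mul hq)
      refine ofBoundaryU_le ?_
      rw [he, ← h1]
      exact (pruned hk).monotone (z.1.1.2.2 q' hq')⟩
  obtain ⟨f, hf⟩ := exists_lift (F := F) hV
    (fun p z _ => mkBoundaryU hk ρ (e p (hle p z) (hne p z)) (x' p z _ _)
      (ρ.map (homOfLE (hple p _ _).1) z.1.2))
    (fun p p' h x a hm hm' _ => by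
      refine (mk_incl (F := (boundaryPsiUIncl hk).monotone.functor ⋙ ρ)
        (hee p p' h (hle p ⟨(_, a), hm⟩) (hne p ⟨(_, a), hm⟩) (hle p' ⟨(x, _), hm'⟩) (hne p' ⟨(x, _), hm'⟩))
        (x' p' ⟨(x, _), hm'⟩ _ _) _).trans (congrArg (mkBoundaryU hk ρ _ _) ?_)
      exact (map_map_apply (hple p _ _).1 (hee p p' h (hle p ⟨(_, a), hm⟩) (hne p ⟨(_, a), hm⟩)
        (hle p' ⟨(x, _), hm'⟩) (hne p' ⟨(x, _), hm'⟩)) a).trans (map_map_apply h.1 (hple p' _ _).1 a).symm)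
    (fun p z₀ => by
      refine continuous_mk_comp (F := (boundaryPsiUIncl hk).monotone.functor ⋙ ρ)
        (p := e p (hle p z₀) (hne p z₀)) (fun q => ?_)
        ((ρ.map (homOfLE (hple p (hle p z₀) (hne p z₀)).1)).hom.continuous.comp
          continuous_piece_snd)
      have h0 : ∀ q, Continuous fun z : Piece (F := F) V p × Icc (0 : ℝ) 1 =>
          prismMotion (pruned hk) (z.1.1.1.1 : PsiPrime hk → ℝ) 1 q := fun q =>
        (continuous_prismMotion _ q).comp ((continuous_pi fun q =>
          (continuous_underComplex_apply q).comp continuous_piece_fst).prodMk continuous_const)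
      refine (h0 _).mul ((continuous_const.sub (h0 (cor hk))).inv₀ fun z => ?_)
      have := (prismMotion_pruned_cor z.1.1.1.1.2 z.1.1.1.2.1 z.1.2.1 1).trans_lt z.1.2.2
      exact (sub_pos.2 this).ne')
  refine ⟨f.comp ⟨fun y => (y, 0), by fun_prop⟩, fun p x a hm => ?_⟩
  exact ⟨e p (hle p ⟨(x, a), hm⟩) (hne p ⟨(x, a), hm⟩), hple p _ _, x' p ⟨(x, a), hm⟩ _ _,
    fun _ => rfl, hf p x a hm 0⟩

/-- The projection from `c_k` to the homotopy colimit over `∂Ψ_k`. -/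
theorem exists_baseRetraction :
    ∃ base : C({y : HocolimPrime hk ρ | weight y (cor hk) < 1}, HocolimBoundary ρ),
      ∀ p x a (hm : weight (mkPrime hk ρ (ofBoundary hk p) x a) (cor hk) < 1),
        ∃ x' : UnderComplex p,
          (∀ q, x'.1 q = restrictWeight (ofBoundary hk) (cor hk) x.1 q) ∧
          base ⟨mkPrime hk ρ (ofBoundary hk p) x a, hm⟩ = mkBoundary ρ p x' a := by
  let F := (PsiPrime.incl hk).monotone.functor ⋙ ρ
  let V : Set (HocolimPrime hk ρ) := {y | weight y (cor hk) < 1}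
  have hV : IsOpen V :=
    isOpen_lt ((continuous_apply _).comp continuous_weight) continuous_const
  let e : ∀ p, p ≠ cor hk → Boundary (PearledTree k) := fun p hp =>
    ⟨p.tree, fun h => hp (PsiPrime.ext (show p.tree = ⊤ from isTop_iff_eq_top.1 h))⟩
  have hne : ∀ p (z : Piece (F := F) V p), p ≠ cor hk := fun p z => ne_cor_of_lt z.2
  -- No pruning is necessary here: c'_k belongs to ∂Ψ_k, so every element of the support other than
  -- c_k does.
  let x' : ∀ p (z : Piece (F := F) V p) h, UnderComplex (e p h) := fun p z h =>
    ⟨⟨restrictWeight (ofBoundary hk) (cor hk) z.1.1.1,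
      restrictWeight_mem ofBoundary_injective ofBoundary_ne_cor z.1.1.1.2 z.2
        fun q _ => or_iff_not_imp_left.2 exists_ofBoundary⟩, by
      intro q hq q' hq' _
      exact (z.1.1.2.1.total (left_ne_zero_of_mul hq) (left_ne_zero_of_mul hq')).imp
        ofBoundary_le ofBoundary_le, by
      intro q hq
      exact (z.1.1.2.2 _ (left_ne_zero_of_mul hq)).1⟩
  obtain ⟨f, hf⟩ := exists_lift (F := F) hV
    (fun p z _ => mkBoundary ρ (e p (hne p z)) (x' p z _) z.1.2)
    (fun p p' h x a hm hm' _ => mk_incl (F := (Boundary.incl (PearledTree k)).monotone.functor ⋙ ρ)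
      (show e p (hne p ⟨(_, a), hm⟩) ≤ e p' (hne p' ⟨(x, _), hm'⟩) from h.1) (x' p' ⟨(x, _), hm'⟩ _) a)
    (fun p z₀ => by
      refine continuous_mk_comp (F := (Boundary.incl (PearledTree k)).monotone.functor ⋙ ρ)
        (p := e p (hne p z₀)) (fun q => ?_) continuous_piece_snd
      have h0 : ∀ q, Continuous fun z : Piece (F := F) V p × Icc (0 : ℝ) 1 => z.1.1.1.1 q :=
        fun q => (continuous_underComplex_apply q).comp continuous_piece_fst
      exact (h0 _).mul ((continuous_const.sub (h0 (cor hk))).inv₀ fun z => (sub_pos.2 z.1.2).ne'))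
  refine ⟨f.comp ⟨fun y => (y, 0), by fun_prop⟩, fun p x a hm => ?_⟩
  exact ⟨x' (ofBoundary hk p) ⟨(x, a), hm⟩ (hne _ ⟨(x, a), hm⟩), fun _ => rfl, hf _ x a hm 0⟩

end Decomposition

/-! ### Assembly of the cylinder decomposition and the theorem. -/

section Decomposition

open Hocolim PsiPrime

variable {k : ℕ} (hk : 2 ≤ k) (ρ : PearledTree k ⥤ TopCat.{u})

/-- The homotopy colimit over `Ψ'_k` is glued from the one over `∂Ψ_k` and the mapping cylinder of
`hocolim_{∂Ψ_k^U} ρ → ρ(c_k)`. -/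
theorem nonempty_cylinderDecomposition :
    Nonempty (CylinderDecomposition (strongCoherenceMap hk ρ) (coherenceMap hk ρ)) := by
  let F := (PsiPrime.incl hk).monotone.functor ⋙ ρ
  obtain ⟨cyl, hcyl⟩ := exists_cylinder hk ρ
  obtain ⟨retr, hretr⟩ := exists_retraction hk ρ
  obtain ⟨base, hbase⟩ := exists_baseRetraction hk ρ
  let c := cor hk
  have hcont : ∀ q, Continuous fun w : PsiPrime hk → ℝ => w q := fun q => continuous_apply q
  -- The three motions keep the point of the diagram and change weights only: `up` moves all weight
  -- to c_k, `down` removes the weight at c_k, and `mid` prunes.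
  obtain ⟨up, hupc, hup⟩ := exists_reweight (F := F) (O := {w | 0 < w c})
    (isOpen_lt continuous_const (hcont c)) (towardsVertex c)
    (fun q => by
      have h1 : Continuous fun z : (PsiPrime hk → ℝ) × ℝ => z.1 q := (hcont q).comp continuous_fst
      exact ((((continuous_const.sub continuous_snd).mul h1).add
        (continuous_snd.mul continuous_const))).continuousOn)
    (fun w hwc hw hch s hs => ⟨towardsVertex_mem c hw hs, by
      refine hch.of_forall_ne_zero fun q hq => ?_
      rcases ne_zero_or_of_towardsVertex_ne_zero hq with h | rfl
      exacts [h, hwc.ne'], fun q hq => by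
      rcases ne_zero_or_of_towardsVertex_ne_zero hq with h | rfl
      exacts [⟨q, h, le_rfl⟩, ⟨_, hwc.ne', le_rfl⟩]⟩)
  obtain ⟨down, hdownc, hdown⟩ := exists_reweight (F := F) (O := {w | w c < 1})
    (isOpen_lt (hcont c) continuous_const) (awayFromVertex c)
    (fun q => by
      have h1 : ∀ q, Continuous fun z : (PsiPrime hk → ℝ) × ℝ => z.1 q :=
        fun q => (hcont q).comp continuous_fst
      by_cases hq : q = c
      · simp only [hq, awayFromVertex_self]
        exact ((continuous_const.sub continuous_snd).mul (h1 c)).continuousOn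
      · simp only [awayFromVertex_of_ne hq]
        exact (h1 q).continuousOn.mul ((continuous_const.sub continuous_snd).continuousOn.add
          (continuous_snd.continuousOn.mul ((continuous_const.sub (h1 c)).continuousOn.inv₀
            fun z hz => (sub_pos.2 hz.1).ne'))))
    (fun w hwc hw hch s hs => ⟨awayFromVertex_mem hw hwc hs,
      hch.of_forall_ne_zero fun q hq => ne_zero_of_awayFromVertex_ne_zero hq,
      fun q hq => ⟨q, ne_zero_of_awayFromVertex_ne_zero hq, le_rfl⟩⟩)
  obtain ⟨mid, hmidc, hmid⟩ := exists_reweight (F := F) (O := {w | 0 < w c ∧ w c < 1})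
    ((isOpen_lt continuous_const (hcont c)).inter (isOpen_lt (hcont c) continuous_const))
    (prismMotion (pruned hk))
    (fun q => (continuous_prismMotion _ q).continuousOn)
    (fun w hwc hw hch s hs => ⟨prismMotion_mem _ hw s, isChain_prismMotion_pruned hw hch hwc.1 s,
      fun q hq => by
        rcases of_prismMotion_ne_zero hw.1 hq with ⟨h, -⟩ | ⟨q', h, -, rfl⟩
        exacts [⟨q, h, le_rfl⟩, ⟨q', h, le_pruned (le_cor_of_isChain hch hwc.1.ne' h)⟩]⟩)
  let v : UnderComplex c := ⟨⟨vertexWeight c, vertexWeight_mem c⟩, by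
    have hv : ∀ q, vertexWeight c q ≠ 0 → q = c := fun q hq => by
      by_contra h
      exact hq (by simp [vertexWeight, h])
    exact ⟨fun q hq q' hq' hne => absurd ((hv q hq).trans (hv q' hq').symm) hne,
      fun q hq => (hv q hq).ge⟩⟩
  have hvc : v.1 c = 1 := if_pos rfl
  -- When all weight is at c_k, the representative can be moved along p ≤ c_k and becomes a point of
  -- ρ(c_k).
  have htop : ∀ (p : PsiPrime hk) (hp : p ≤ c) (x : UnderComplex p) (a : ρ.obj p.tree) (w),
      (∀ q, x.1 q = towardsVertex c w 1 q) →
      mkPrime hk ρ p x a = mkPrime hk ρ c v (ρ.map (homOfLE hp.1) a) := fun p hp x a w hx =>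
    mkPrime_eq hp (fun q => (hx q).trans (by simp [towardsVertex]; rfl)) a
  have hsame : ∀ (p : PsiPrime hk) (x x' : UnderComplex p) (a : ρ.obj p.tree),
      (∀ q, x.1 q = x'.1 q) → mkPrime hk ρ p x a = mkPrime hk ρ p x' a := fun p x x' a h => by
    rw [underComplex_ext h]
  exact ⟨{
    t := fun y => weight y c
    continuous_t := (hcont c).comp continuous_weight
    t_base := fun x => by
      induction x using Hocolim.ind with | _ p x a
      exact map_ofBoundary_cor x
    cyl := cyl
    continuousOn_cyl := cyl.continuous.continuousOn
    t_cyl := fun a u hu => by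
      induction a using Hocolim.ind with | _ p x a
      obtain ⟨x', hx', h⟩ := hcyl p x a u hu
      rw [h]
      refine (hx' c).trans ?_
      rw [towardsVertex_self, map_ofBoundaryU_cor]
      ring
    top := ⟨fun a => mkPrime hk ρ c v a, continuous_mk_comp (F := F) (fun q => continuous_const)
      continuous_id⟩
    -- Defined on the whole homotopy colimit: in Ψ_k all trees, including c'_k, have a morphism to
    -- c_k, and a cocone to ρ(c_k) needs no more.
    proj := hocolimDesc _ (topCocone (PsiPrime.incl hk) ρ)
    cyl_one := fun a => by
      induction a using Hocolim.ind with | _ p x a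
      obtain ⟨x', hx', h⟩ := hcyl p x a 1 (by simp)
      rw [h]
      exact htop _ (ofBoundaryU_le_cor p) x' a _ hx'
    t_top := fun a => hvc
    proj_cyl := fun a u hu => by
      induction a using Hocolim.ind with | _ p x a
      obtain ⟨x', hx', h⟩ := hcyl p x a u hu
      rw [h]
      rfl
    up := up
    continuousOn_up := hupc
    t_up_pos := fun y hy s hs => by
      induction y using Hocolim.ind with | _ p x a
      obtain ⟨x', hx', h⟩ := hup p x a hy s hs
      rw [h, weight_mk, hx', towardsVertex_self]
      have hy' : 0 < x.1 c := hy
      rcases eq_or_lt_of_le hs.2 with rfl | h1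
      · simp
      · exact add_pos_of_pos_of_nonneg (mul_pos (by linarith) hy') hs.1
    up_zero := fun y hy => by
      induction y using Hocolim.ind with | _ p x a
      obtain ⟨x', hx', h⟩ := hup p x a hy 0 (by simp)
      rw [h]
      exact hsame p _ _ a fun q => by rw [hx']; simp [towardsVertex]
    up_one := fun y hy => by
      induction y using Hocolim.ind with | _ p x a
      obtain ⟨x', hx', h⟩ := hup p x a hy 1 (by simp)
      rw [h]
      exact htop p (x.2.2 _ hy.ne') x' a _ hx'
    up_cyl := fun a u hu s hs => by
      have hu' : u ∈ Icc (0 : ℝ) 1 := ⟨hu.1.le, hu.2⟩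
      have hus : u + s * (1 - u) ∈ Icc (0 : ℝ) 1 :=
        ⟨add_nonneg hu'.1 (mul_nonneg hs.1 (by linarith [hu.2])), by nlinarith [hu.2, hs.2]⟩
      induction a using Hocolim.ind with | _ p x a
      obtain ⟨x₁, hx₁, h₁⟩ := hcyl p x a u hu'
      obtain ⟨x₂, hx₂, h₂⟩ := hcyl p x a _ hus
      have hpos : 0 < x₁.1 c := by
        rw [hx₁, towardsVertex_self, map_ofBoundaryU_cor]
        linarith [hu.1]
      obtain ⟨x₃, hx₃, h₃⟩ := hup _ x₁ a hpos s hs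
      rw [h₁, h₂, h₃]
      -- Two successive linear motions towards c_k, by u and then by s, amount to one by u + s(1 -
      -- u).
      refine hsame _ _ _ a fun q => ?_
      rw [hx₃, hx₂]
      unfold towardsVertex
      rw [hx₁]
      unfold towardsVertex
      ring
    retr := retr
    mid := mid
    continuousOn_mid := hmidc
    t_mid := fun y hy hy' s hs => by
      induction y using Hocolim.ind with | _ p x a
      obtain ⟨x', hx', h⟩ := hmid p x a ⟨hy, hy'⟩ s hs
      rw [h, weight_mk, hx', weight_mk]
      exact prismMotion_pruned_cor x.1.2 x.2.1 hy s
    mid_zero := fun y hy hy' => by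
      induction y using Hocolim.ind with | _ p x a
      obtain ⟨x', hx', h⟩ := hmid p x a ⟨hy, hy'⟩ 0 (by simp)
      rw [h]
      exact hsame p _ _ a fun q =>
        (hx' q).trans (congrFun (prismMotion_zero (pruned hk) x.1.2.1) q)
    mid_one := fun ⟨y, hy⟩ => by
      induction y using Hocolim.ind with | _ p x a
      obtain ⟨x₁, hx₁, h₁⟩ := hmid p x a hy 1 (by simp)
      obtain ⟨p', hp, x₂, hx₂, h₂⟩ := hretr p x a hy
      have hw : x.1 c ∈ Icc (0 : ℝ) 1 := ⟨hy.1.le, hy.2.le⟩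
      obtain ⟨x₃, hx₃, h₃⟩ := hcyl p' x₂ (ρ.map (homOfLE hp.1) a) (x.1 c) hw
      have hc : prismMotion (pruned hk) x.1 1 (cor hk) = x.1 c :=
        prismMotion_pruned_cor x.1.2 x.2.1 hy.1 1
      refine h₁.trans (Eq.trans ?_ (congrArg (fun b => cyl (b, x.1 c)) h₂).symm)
      refine Eq.trans (mkPrime_eq hp (fun q => ?_) a) h₃.symm
      rw [hx₁, hx₃]
      -- Coning the renormalized weight back at the original height undoes the renormalization. So
      -- both weights agree at c_k and on ∂Ψ_k^U, and both vanish elsewhere.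
      by_cases hqc : q = c
      · subst hqc
        rw [towardsVertex_self, map_ofBoundaryU_cor]
        refine hc.trans ?_
        ring
      rw [towardsVertex_of_ne hqc]
      by_cases hq : q ∈ range (ofBoundaryU hk)
      · obtain ⟨q, rfl⟩ := hq
        rw [UnderComplex.map_apply ofBoundaryU_injective, hx₂, restrictWeight, hc]
        have : (1 : ℝ) - x.1 c ≠ 0 := (sub_pos.2 hy.2).ne'
        exact (mul_div_cancel₀ _ this).symm
      · rw [UnderComplex.map_apply_of_notMem _ _ hq, mul_zero]
        by_contra hne
        exact (eq_cor_or_mem_range_of_prismMotion_ne_zero x.1.2 x.2.1 hy.1 hne).elim hqc hq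
    base := base
    base_map := fun y hy => by
      induction y using Hocolim.ind with | _ p x a
      obtain ⟨x', hx', h⟩ := hbase p (x.map (ofBoundary hk)) a hy
      refine h.trans (congrArg (fun x => mkBoundary ρ p x a) (underComplex_ext fun q => ?_))
      rw [hx', restrictWeight, UnderComplex.map_apply ofBoundary_injective, map_ofBoundary_cor]
      simp
    down := down
    continuousOn_down := hdownc
    down_zero := fun y hy => by
      induction y using Hocolim.ind with | _ p x a
      obtain ⟨x', hx', h⟩ := hdown p x a hy 0 (by simp)
      rw [h]
      refine hsame p _ _ a fun q => ?_
      rw [hx']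
      by_cases hq : q = c
      · rw [hq, awayFromVertex_self]; ring
      · rw [awayFromVertex_of_ne hq]; ring
    down_one := fun ⟨y, hy⟩ => by
      induction y using Hocolim.ind with | _ p x a
      obtain ⟨p, rfl⟩ := exists_ofBoundary (ne_cor_of_lt hy)
      obtain ⟨x₁, hx₁, h₁⟩ := hdown _ x a hy 1 (by simp)
      obtain ⟨x₂, hx₂, h₂⟩ := hbase p x a hy
      refine h₁.trans (Eq.trans ?_ (congrArg (coherenceMap hk ρ) h₂).symm)
      refine hsame _ x₁ (x₂.map (ofBoundary hk)) a fun q => ?_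
      rw [hx₁]
      by_cases hq : q = c
      · rw [hq, awayFromVertex_self, map_ofBoundary_cor, sub_self, zero_mul]
      · obtain ⟨q, rfl⟩ := exists_ofBoundary hq
        rw [awayFromVertex_of_ne hq, UnderComplex.map_apply ofBoundary_injective, hx₂,
          restrictWeight, sub_self, zero_add, one_mul]
    down_map := fun y s hs => by
      induction y using Hocolim.ind with | _ p x a
      have hc := map_ofBoundary_cor (hk := hk) x
      obtain ⟨x', hx', h⟩ := hdown _ (x.map (ofBoundary hk)) a
        (hc.trans_lt one_pos : (x.map (ofBoundary hk)).1 c < 1) s hs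
      refine h.trans (hsame _ x' (x.map (ofBoundary hk)) a fun q => ?_)
      rw [hx']
      by_cases hq : q = c
      · rw [hq, awayFromVertex_self, hc, mul_zero]
      · rw [awayFromVertex_of_ne hq, hc]
        simp }⟩

/-- A strongly coherent diagram is coherent. -/
theorem IsStronglyCoherent.isCoherent (h : IsStronglyCoherent hk ρ) : IsCoherent hk ρ :=
  (nonempty_cylinderDecomposition hk ρ).some.isWeakHomotopyEquiv h

end Decomposition

end

/-- (i) A strongly coherent diagram `ρ : Ψ_k → Top`, `k ≥ 2`, is coherent. (ii) A strongly coherent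
(respectively, strongly `k`-coherent) operad is coherent (respectively, `k`-coherent). -/
theorem theorem4p7 :
    (∀ (k : ℕ) (hk : 2 ≤ k) (ρ : PearledTree k ⥤ TopCat.{u}),
      IsStronglyCoherent hk ρ → IsCoherent hk ρ) ∧
    (∀ O : TopOperad.{u},
      (O.IsStronglyCoherent → O.IsCoherent) ∧
      ∀ k : ℕ, O.IsStronglyKCoherent k → O.IsKCoherent k) :=
  ⟨fun _ hk ρ h => h.isCoherent hk ρ, fun _ => ⟨fun h i hi => (h i hi).isCoherent hi _,
    fun _ h i hi hik => (h i hi hik).isCoherent hi _⟩⟩
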